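/- Let $n\ge 2$, $1<p<\infty$ and $\kappa>0$. Write points of $\mathbf{R}^n=\mathbf{R}^{n-1}\times\mathbf{R}$ as $x=(x',x_n)$, let $B'$ be the open unit ball of $\mathbf{R}^{n-1}$, $G=B'\times(0,\infty)$, and for $t\ge0$ let $G_t=\overline{B'}\times(t,\infty)$ and $Q_t=\overline{B'}\times[0,t]$. Define $$T(x)=\Bigl(\frac{2e^{-\kappa x_n}x'}{1+|x'|^2},\ \frac{e^{-\kappa x_n}(1-|x'|^2)}{1+|x'|^2}\Bigr),\qquad \widetilde T=P\circ T,\qquad P(\xi',\xi_n)=(\xi',-\xi_n),$$ $\widetilde w(\xi)=|\xi|^{p-n}$ for $\xi\ne0$ and $\widetilde w(0)=0$, and $B_r=\{\xi\in\mathbf{R}^n:|\xi|<r\}$. Let $L^{1,p}_{\kappa,0}(\overline G\setminus Q_t)$ be the completion of $\{\varphi|_{\overline G}:\varphi\in C_0^\infty(\mathbf{R}^n\setminus Q_t)\}$ in the norm $\bigl(\int_{G\setminus Q_t}(|v|^pe^{-p\kappa x_n}+|\nabla v|^p)\,dx\bigr)^{1/p}$, where $\nabla v$ is the distributional gradient.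 For $E\subset G_t$ let $$\mathrm{cap}_{p,G_t}(E)=\inf_v\int_{G_t}|\nabla v|^p\,dx,$$ the infimum being over all $v\in L^{1,p}_{\kappa,0}(\overline G\setminus Q_t)$ with $v\ge1$ (a.e.) in $G_t\cap U$ for some open $U\supset E$. For a compact subset $K$ of an open set $\Omega\subset\mathbf{R}^n$ let $$\mathrm{cap}_{p,\widetilde w}(K,\Omega)=\inf\Bigl\{\int_\Omega|\nabla v|^p\,\widetilde w\,d\xi:\ v\in C_0^\infty(\Omega),\ v\ge1\text{ on }K\Bigr\},$$ extended to open $U\subset\Omega$ as the supremum over compact $K\subset U$, and to arbitrary $E\subset\Omega$ as the infimum over open $U$ with $E\subset U\subset\Omega$. Then there exist constants $C',C''>0$, independent of $t\ge0$ (and of $E$), such that for all $t\ge0$ and all Borel sets $E\subset G_t$, $$C'\,\mathrm{cap}_{p,G_t}(E)\le \mathrm{cap}_{p,\widetilde w}(\widetilde E,B_r)\le C''\,\mathrm{cap}_{p,G_t}(E),$$ where $\widetilde E=T(E)\cup\widetilde T(E)$ and $r=e^{-\kappa t}$. (Both capacities may be $+\infty$.) -/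

import Mathlib

open MeasureTheory Filter Topology Set
open scoped ENNReal ContDiff Gradient

noncomputable section

namespace CylCap

/-- The Euclidean space `ℝⁿ` with `n = m + 1`; its points are written `x = (x', x_n)`. -/
abbrev Rn (m : ℕ) : Type := EuclideanSpace ℝ (Fin (m + 1))

/-- The first `n - 1` coordinates `x'` of `x`, with the Euclidean norm. -/
def head {m : ℕ} (x : Rn m) : EuclideanSpace ℝ (Fin m) :=
  WithLp.toLp 2 fun i => x i.castSucc

/-- The last coordinate `x_n` of `x`. -/
def last {m : ℕ} (x : Rn m) : ℝ := x (Fin.last m)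

/-- The point `(y, s)` of `ℝⁿ = ℝⁿ⁻¹ × ℝ`. -/
def point {m : ℕ} (y : EuclideanSpace ℝ (Fin m)) (s : ℝ) : Rn m :=
  WithLp.toLp 2 (Fin.snoc (α := fun _ => ℝ) (fun i => y i) s)

/-- The open half-cylinder `G = B' × (0, ∞)`, with `B'` the open unit ball of `ℝⁿ⁻¹`. -/
def cyl (m : ℕ) : Set (Rn m) := {x | ‖head x‖ < 1 ∧ 0 < last x}

/-- The truncated cylinder `G_t`, that is, closed unit ball of `ℝⁿ⁻¹` times `(t, ∞)`. -/
def cylAbove (m : ℕ) (t : ℝ) : Set (Rn m) := {x | ‖head x‖ ≤ 1 ∧ t < last x}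

/-- The set `Q_t`, that is, closed unit ball of `ℝⁿ⁻¹` times `[0, t]`. -/
def cylBelow (m : ℕ) (t : ℝ) : Set (Rn m) := {x | ‖head x‖ ≤ 1 ∧ 0 ≤ last x ∧ last x ≤ t}

/-- The change of variables `T` from the half-cylinder to the half-ball:
`ξ' = 2 e^{-κ x_n} x' / (1 + |x'|²)` and `ξ_n = e^{-κ x_n} (1 - |x'|²) / (1 + |x'|²)`. -/
def T {m : ℕ} (κ : ℝ) (x : Rn m) : Rn m :=
  point ((2 * Real.exp (-κ * last x) / (1 + ‖head x‖ ^ 2)) • head x)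
    (Real.exp (-κ * last x) * (1 - ‖head x‖ ^ 2) / (1 + ‖head x‖ ^ 2))

/-- The reflection `P(ξ', ξ_n) = (ξ', -ξ_n)`. -/
def reflect {m : ℕ} (ξ : Rn m) : Rn m := point (head ξ) (-last ξ)

/-- The weight `|ξ|^{p - n}`, set to `0` at the origin. -/
def weight {m : ℕ} (p : ℝ) (ξ : Rn m) : ℝ :=
  if ξ = 0 then 0 else ‖ξ‖ ^ (p - ((m : ℝ) + 1))

/-- `φ ∈ C₀^∞(Ω)`: smooth on `ℝⁿ`, with compact support contained in `Ω`. -/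
def IsTest {m : ℕ} (Ω : Set (Rn m)) (φ : Rn m → ℝ) : Prop :=
  ContDiff ℝ ∞ φ ∧ HasCompactSupport φ ∧ tsupport φ ⊆ Ω

/-- `g` is the distributional gradient of `v` in the open set `Ω`, both being locally integrable
in `Ω`. The values of `v` and `g` outside `Ω` play no role. -/
def HasWeakGradient {m : ℕ} (Ω : Set (Rn m)) (v : Rn m → ℝ) (g : Rn m → Rn m) : Prop :=
  LocallyIntegrableOn v Ω ∧ LocallyIntegrableOn g Ω ∧
    ∀ φ : Rn m → ℝ, IsTest Ω φ → ∀ i : Fin (m + 1),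
      ∫ x in Ω, v x * (∇ φ x) i = -∫ x in Ω, g x i * φ x

/-- The norm `(∫_Ω (|v|^p e^{-pκ x_n} + |∇v|^p) dx)^{1/p}` of `L^{1,p}_κ(Ω)`, where `g`
stands for `∇v`. -/
def normL {m : ℕ} (p κ : ℝ) (Ω : Set (Rn m)) (v : Rn m → ℝ) (g : Rn m → Rn m) : ℝ≥0∞ :=
  (∫⁻ x in Ω, (‖v x‖ₑ ^ p * ENNReal.ofReal (Real.exp (-p * κ * last x)) + ‖g x‖ₑ ^ p)) ^ (1 / p)

/-- `v ∈ L^{1,p}_κ(Ω)`, with distributional gradient `g`. -/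
def MemL {m : ℕ} (p κ : ℝ) (Ω : Set (Rn m)) (v : Rn m → ℝ) (g : Rn m → Rn m) : Prop :=
  HasWeakGradient Ω v g ∧ normL p κ Ω v g < ⊤

/-- `v ∈ L^{1,p}_{κ,0}(closure(G) \ F)`, with distributional gradient `g`: the closure, in the norm
of `L^{1,p}_κ(G \ F)`, of the restrictions of functions from `C₀^∞(ℝⁿ \ F)`. -/
def MemLZero {m : ℕ} (p κ : ℝ) (F : Set (Rn m)) (v : Rn m → ℝ) (g : Rn m → Rn m) : Prop :=
  MemL p κ (cyl m \ F) v g ∧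
    ∃ φ : ℕ → Rn m → ℝ, (∀ j, IsTest Fᶜ (φ j)) ∧
      Tendsto (fun j => normL p κ (cyl m \ F) (fun x => φ j x - v x) (fun x => ∇ (φ j) x - g x))
        atTop (𝓝 0)

/-- The Neumann variational `p`-capacity `cap_{p,G_t}(E)`: the infimum of `∫_{G_t} |∇v|^p dx` over
all `v ∈ L^{1,p}_{κ,0}(closure(G) \ Q_t)` such that `v ≥ 1` in `G_t ∩ U` for some open
neighbourhood `U` of `E` (almost everywhere, `v` being defined up to null sets). -/
def capCyl {m : ℕ} (p κ t : ℝ) (E : Set (Rn m)) : ℝ≥0∞ :=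
  ⨅ (v : Rn m → ℝ) (g : Rn m → Rn m) (_ : MemLZero p κ (cylBelow m t) v g)
    (_ : ∃ U : Set (Rn m), IsOpen U ∧ E ⊆ U ∧ ∀ᵐ x, x ∈ cylAbove m t ∩ U → 1 ≤ v x),
    ∫⁻ x in cylAbove m t, ‖g x‖ₑ ^ p

/-- The variational `(p, w)`-capacity of a compact set `K ⊆ Ω`: the infimum of
`∫_Ω |∇v|^p w dξ` over all `v ∈ C₀^∞(Ω)` with `v ≥ 1` on `K`. -/
def wcapCompact {m : ℕ} (p : ℝ) (w : Rn m → ℝ) (K Ω : Set (Rn m)) : ℝ≥0∞ :=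
  ⨅ (v : Rn m → ℝ) (_ : IsTest Ω v) (_ : ∀ ξ ∈ K, 1 ≤ v ξ),
    ∫⁻ ξ in Ω, ‖∇ v ξ‖ₑ ^ p * ENNReal.ofReal (w ξ)

/-- The variational `(p, w)`-capacity of an open set `U ⊆ Ω`: the supremum over its compact
subsets. -/
def wcapOpen {m : ℕ} (p : ℝ) (w : Rn m → ℝ) (U Ω : Set (Rn m)) : ℝ≥0∞ :=
  ⨆ (K : Set (Rn m)) (_ : IsCompact K) (_ : K ⊆ U), wcapCompact p w K Ω

/-- The variational `(p, w)`-capacity of an arbitrary set `E ⊆ Ω`: the infimum over the open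
sets between `E` and `Ω`. -/
def wcap {m : ℕ} (p : ℝ) (w : Rn m → ℝ) (E Ω : Set (Rn m)) : ℝ≥0∞ :=
  ⨅ (U : Set (Rn m)) (_ : IsOpen U) (_ : E ⊆ U) (_ : U ⊆ Ω), wcapOpen p w U Ω

/-- The symmetrized image `T(E) ∪ (P ∘ T)(E)`. -/
def sym {m : ℕ} (κ : ℝ) (E : Set (Rn m)) : Set (Rn m) :=
  T κ '' E ∪ (fun x => reflect (T κ x)) '' E

end CylCap

end

noncomputable section

namespace CylCap

variable {m : ℕ}

/-! ### Coordinates -/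

/-! Write `T κ x` as r ω, where r = e^{-κ x_n} and ω is the inverse stereographic image of x'. At
scale r, `T` is bi-Lipschitz with constants comparable to r (`norm_T_sub_le`, `le_norm_T_sub`).
Gradients therefore scale by r and volumes by r^n, and the weight |ξ|^{p-n} is the one for which r^n
|ξ|^{p-n} = r^p (`IsPolarChart.exp_pow_mul_weight`). The Dirichlet energy on the cylinder and the
weighted energy on the ball are then comparable under transplantation, with constants depending only
on n, p and κ: `lintegral_gradient_comp_T_le` pulls back, and `lintegral_fderiv_descend_le` pushes
forward by even reflection. What remains is to match the two classes of admissible functions.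

From the ball to the cylinder (`capCyl_le_wcapOpen`): the capacity of an open set U is a supremum
over compact subsets, so no single test function need be at least 1 on U. Near-minimizers for a
compact exhaustion have gradients that form a Cauchy sequence, by uniform convexity
(`cauchy_of_midpoint`). Composed with `T`, they are Cauchy in the full norm by a Hardy inequality
(`lintegral_rpow_mul_exp_le`). They need not vanish as x_n tends to infinity, but a cutoff there
costs arbitrarily little energy because p > 1 (`exists_isTest_energy_sub_le`). Hence the limit
belongs to the completion and is admissible.

From the cylinder to the ball (`wcapCompact_le_lintegral`): an admissible v is approximated by test
functions φ_j, whose even transplants are Lipschitz but only close to a function at least 1 in a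
weighted L^p sense. They are averaged with a variable radius (`exists_isTest_of_descend`). On the
compact set K the radius is a fixed ε, so L^p closeness becomes a pointwise lower bound 1/2. Away
from K the radius is small depending on φ_j, so the support stays in the ball and the weight stays
comparable near the origin. Doubling the result gives a competitor for K. -/

@[simp] lemma head_point (y : EuclideanSpace ℝ (Fin m)) (s : ℝ) : head (point y s) = y := by
  ext i; simp [head, point]

@[simp] lemma last_point (y : EuclideanSpace ℝ (Fin m)) (s : ℝ) : last (point y s) = s := by
  simp [last, point]

lemma ext_head_last {x y : Rn m} (h : head x = head y) (h' : last x = last y) : x = y := by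
  ext i
  refine Fin.lastCases h' (fun i => ?_) i
  exact congrArg (fun z : EuclideanSpace ℝ (Fin m) => z i) h

@[simp] lemma point_head_last (x : Rn m) : point (head x) (last x) = x :=
  ext_head_last (by simp) (by simp)

@[simp] lemma head_add (x y : Rn m) : head (x + y) = head x + head y := by ext i; simp [head]
@[simp] lemma head_sub (x y : Rn m) : head (x - y) = head x - head y := by ext i; simp [head]
@[simp] lemma head_smul (c : ℝ) (x : Rn m) : head (c • x) = c • head x := by ext i; simp [head]
@[simp] lemma last_add (x y : Rn m) : last (x + y) = last x + last y := by simp [last]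
@[simp] lemma last_sub (x y : Rn m) : last (x - y) = last x - last y := by simp [last]
@[simp] lemma last_smul (c : ℝ) (x : Rn m) : last (c • x) = c * last x := by simp [last]
@[simp] lemma head_zero : head (0 : Rn m) = 0 := by ext i; simp [head]
@[simp] lemma last_zero : last (0 : Rn m) = 0 := by simp [last]

lemma norm_sq_eq (x : Rn m) : ‖x‖ ^ 2 = ‖head x‖ ^ 2 + last x ^ 2 := by
  simp [EuclideanSpace.norm_sq_eq, Fin.sum_univ_castSucc, head, last]

lemma norm_head_le (x : Rn m) : ‖head x‖ ≤ ‖x‖ := by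
  have := norm_sq_eq x
  exact abs_le_of_sq_le_sq' (by nlinarith [sq_nonneg (last x)]) (norm_nonneg _) |>.2

lemma abs_last_le (x : Rn m) : |last x| ≤ ‖x‖ := by
  have := norm_sq_eq x
  exact abs_le_of_sq_le_sq (by nlinarith [sq_nonneg ‖head x‖]) (norm_nonneg _)

/-- `head` as a continuous linear map. -/
def headL (m : ℕ) : Rn m →L[ℝ] EuclideanSpace ℝ (Fin m) :=
  LinearMap.mkContinuous { toFun := head, map_add' := head_add, map_smul' := head_smul } 1
    fun x => by simpa using norm_head_le x

/-- `last` as a continuous linear map. -/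
def lastL (m : ℕ) : Rn m →L[ℝ] ℝ :=
  LinearMap.mkContinuous { toFun := last, map_add' := last_add, map_smul' := last_smul } 1
    fun x => by simpa using abs_last_le x

@[simp] lemma headL_apply (x : Rn m) : headL m x = head x := rfl
@[simp] lemma lastL_apply (x : Rn m) : lastL m x = last x := rfl

lemma contDiff_head : ContDiff ℝ ∞ (head : Rn m → _) := (headL m).contDiff
lemma contDiff_last : ContDiff ℝ ∞ (last : Rn m → ℝ) := (lastL m).contDiff
lemma continuous_head : Continuous (head : Rn m → _) := (headL m).continuous
lemma continuous_last : Continuous (last : Rn m → ℝ) := (lastL m).continuous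

lemma contDiff_point {E : Type*} [NormedAddCommGroup E] [NormedSpace ℝ E]
    {f : E → EuclideanSpace ℝ (Fin m)} {g : E → ℝ} {k : WithTop ℕ∞}
    (hf : ContDiff ℝ k f) (hg : ContDiff ℝ k g) : ContDiff ℝ k fun x => point (f x) (g x) := by
  rw [contDiff_euclidean]
  intro i
  refine Fin.lastCases ?_ (fun i => ?_) i
  · simpa [point] using hg
  · simpa [point] using (contDiff_euclidean.1 hf i)

lemma continuousOn_point {X : Type*} [TopologicalSpace X] {s : Set X}
    {f : X → EuclideanSpace ℝ (Fin m)} {g : X → ℝ}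
    (hf : ContinuousOn f s) (hg : ContinuousOn g s) :
    ContinuousOn (fun x => point (f x) (g x)) s := by
  have h : Continuous fun q : EuclideanSpace ℝ (Fin m) × ℝ => point q.1 q.2 :=
    (contDiff_point (k := 0) contDiff_fst contDiff_snd).continuous
  exact h.comp_continuousOn (hf.prodMk hg)

lemma point_sub (y z : EuclideanSpace ℝ (Fin m)) (s t : ℝ) :
    point y s - point z t = point (y - z) (s - t) := ext_head_last (by simp) (by simp)

lemma norm_point_sq (y : EuclideanSpace ℝ (Fin m)) (s : ℝ) :
    ‖point y s‖ ^ 2 = ‖y‖ ^ 2 + s ^ 2 := by simp [norm_sq_eq]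

/-! ### The map `T` and its reflection -/

/-- For unit vectors, |rω - sσ|² = (r - s)² + rs|ω - σ|², and the chordal distance |ω - σ| of two
inverse stereographic images is explicit. Both Lipschitz bounds are read off from this formula. -/
lemma norm_T_sub_sq (κ : ℝ) (x y : Rn m) :
    ‖T κ x - T κ y‖ ^ 2 = (Real.exp (-κ * last x) - Real.exp (-κ * last y)) ^ 2 +
      4 * Real.exp (-κ * last x) * Real.exp (-κ * last y) * ‖head x - head y‖ ^ 2 /
        ((1 + ‖head x‖ ^ 2) * (1 + ‖head y‖ ^ 2)) := by
  unfold T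
  rw [point_sub, norm_point_sq, norm_sub_sq_real, norm_sub_sq_real, norm_smul, norm_smul,
    inner_smul_left, inner_smul_right, mul_pow, mul_pow, Real.norm_eq_abs, Real.norm_eq_abs,
    sq_abs, sq_abs]
  simp only [conj_trivial]
  generalize ‖head x‖ = a at *
  generalize ‖head y‖ = b at *
  generalize Real.exp (-κ * last x) = r
  generalize Real.exp (-κ * last y) = s
  generalize inner ℝ (head x) (head y) = c
  field_simp
  ring

lemma norm_T (κ : ℝ) (x : Rn m) : ‖T κ x‖ = Real.exp (-κ * last x) := by
  rw [← abs_of_nonneg (norm_nonneg (T κ x)), ← abs_of_pos (Real.exp_pos (-κ * last x)),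
    ← sq_eq_sq_iff_abs_eq_abs]
  unfold T
  rw [norm_point_sq, norm_smul, mul_pow, Real.norm_eq_abs, sq_abs]
  field_simp
  ring

lemma contDiff_T (κ : ℝ) : ContDiff ℝ ∞ (T κ : Rn m → Rn m) := by
  have h1 : ∀ x : Rn m, 1 + ‖head x‖ ^ 2 ≠ 0 := fun x => by positivity
  have h2 : ContDiff ℝ ∞ fun x : Rn m => ‖head x‖ ^ 2 := contDiff_head.norm_sq ℝ
  have h3 : ContDiff ℝ ∞ fun x : Rn m => Real.exp (-κ * last x) :=
    (contDiff_const.mul contDiff_last).exp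
  unfold T
  exact contDiff_point (((contDiff_const.mul h3).div (contDiff_const.add h2) h1).smul contDiff_head)
    ((h3.mul (contDiff_const.sub h2)).div (contDiff_const.add h2) h1)

lemma reflect_reflect (x : Rn m) : reflect (reflect x) = x := by
  simp [reflect]

lemma contDiff_reflect : ContDiff ℝ ∞ (reflect : Rn m → Rn m) :=
  contDiff_point contDiff_head contDiff_last.neg

lemma norm_reflect_sub (x y : Rn m) : ‖reflect x - reflect y‖ = ‖x - y‖ := by
  rw [← abs_of_nonneg (norm_nonneg (x - y)), ← abs_of_nonneg (norm_nonneg (_ - _)),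
    ← sq_eq_sq_iff_abs_eq_abs, norm_sq_eq (x - y), norm_sq_eq]
  simp [reflect]
  ring

lemma norm_reflect (x : Rn m) : ‖reflect x‖ = ‖x‖ := by
  simpa [reflect_reflect, show reflect (0 : Rn m) = 0 from ext_head_last (by simp [reflect])
    (by simp [reflect])] using norm_reflect_sub x 0

/-- The radial term is controlled by e^s ≥ 1 + s and the angular term by 4 max²; the constant comes
from κ² + 4 ≤ (κ + 2)². -/
lemma norm_T_sub_le {κ : ℝ} (hκ : 0 < κ) (x y : Rn m) :
    ‖T κ x - T κ y‖ ≤ (κ + 2) * max (Real.exp (-κ * last x)) (Real.exp (-κ * last y)) * ‖x - y‖ := by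
  set a := Real.exp (-κ * last x) with ha
  set b := Real.exp (-κ * last y) with hb
  have ha0 : 0 < a := Real.exp_pos _
  have hb0 : 0 < b := Real.exp_pos _
  have key : |a - b| ≤ max a b * (κ * |last x - last y|) := by
    wlog hab : a ≤ b generalizing x y
    · have := this y x rfl rfl (Real.exp_pos _) (Real.exp_pos _) (le_of_not_ge hab)
      rwa [abs_sub_comm, max_comm, abs_sub_comm (last x)]
    rw [abs_of_nonpos (by linarith), max_eq_right hab]
    have h1 : a = b * Real.exp (-κ * (last x - last y)) := by
      rw [ha, hb, ← Real.exp_add]; ring_nf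
    have h2 := Real.add_one_le_exp (-κ * (last x - last y))
    have h3 : κ * (last x - last y) ≤ κ * |last x - last y| :=
      mul_le_mul_of_nonneg_left (le_abs_self _) hκ.le
    have h4 : 1 - Real.exp (-κ * (last x - last y)) ≤ κ * |last x - last y| := by linarith
    calc -(a - b) = b * (1 - Real.exp (-κ * (last x - last y))) := by rw [h1]; ring
      _ ≤ _ := by gcongr
  have hM : 0 < max a b := lt_max_of_lt_left ha0
  set M := max a b
  refine abs_le_of_sq_le_sq ?_ (by positivity) |> (le_abs_self _).trans
  rw [norm_T_sub_sq, mul_pow, norm_sq_eq (x - y), ← ha, ← hb]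
  have e1 : (a - b) ^ 2 ≤ M ^ 2 * κ ^ 2 * (last x - last y) ^ 2 := by
    rw [← sq_abs, ← sq_abs (last x - _)]
    calc _ ≤ (M * (κ * |last x - last y|)) ^ 2 := by gcongr
      _ = _ := by ring
  have e2 : 4 * a * b * ‖head x - head y‖ ^ 2 / ((1 + ‖head x‖ ^ 2) * (1 + ‖head y‖ ^ 2))
      ≤ 4 * M ^ 2 * ‖head x - head y‖ ^ 2 := by
    rw [div_le_iff₀ (by positivity)]
    have h1 : a * b ≤ M ^ 2 := by
      rw [sq]; exact mul_le_mul (le_max_left _ _) (le_max_right _ _) hb0.le hM.le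
    have h2 : 1 ≤ (1 + ‖head x‖ ^ 2) * (1 + ‖head y‖ ^ 2) := by
      nlinarith [sq_nonneg ‖head x‖, sq_nonneg ‖head y‖, mul_nonneg (sq_nonneg ‖head x‖) (sq_nonneg ‖head y‖)]
    calc _ = 4 * (a * b) * ‖head x - head y‖ ^ 2 * 1 := by ring
      _ ≤ _ := by gcongr
  simp only [head_sub, last_sub]
  have h3 : 0 ≤ M ^ 2 * ‖head x - head y‖ ^ 2 := by positivity
  have h4 : 0 ≤ M ^ 2 * (last x - last y) ^ 2 := by positivity
  nlinarith [mul_nonneg hκ.le h3, mul_nonneg hκ.le h4, mul_nonneg (mul_nonneg hκ.le hκ.le) h3]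

/-- The bound 2 on the heads, rather than 1, leaves room for difference quotients at the lateral
boundary of the cylinder. It gives 2/5, since 4 / ((1 + 2²)(1 + 2²)) = (2/5)². -/
lemma le_norm_T_sub {κ : ℝ} (hκ : 0 < κ) {x y : Rn m} (hx : ‖head x‖ ≤ 2) (hy : ‖head y‖ ≤ 2) :
    min κ (2 / 5) * min (Real.exp (-κ * last x)) (Real.exp (-κ * last y)) * ‖x - y‖ ≤
      ‖T κ x - T κ y‖ := by
  set a := Real.exp (-κ * last x) with ha
  set b := Real.exp (-κ * last y) with hb
  have ha0 : 0 < a := Real.exp_pos _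
  have hb0 : 0 < b := Real.exp_pos _
  have key : min a b * (κ * |last x - last y|) ≤ |a - b| := by
    wlog hab : a ≤ b generalizing x y
    · have := this hy hx rfl rfl (Real.exp_pos _) (Real.exp_pos _) (le_of_not_ge hab)
      rwa [abs_sub_comm a, min_comm, abs_sub_comm (last x)]
    have hl : last y ≤ last x := by
      have := Real.exp_le_exp.1 hab
      nlinarith
    rw [abs_of_nonpos (by linarith : a - b ≤ 0), min_eq_left hab, abs_of_nonneg (by linarith)]
    have h1 : b = a * Real.exp (κ * (last x - last y)) := by
      rw [ha, hb, ← Real.exp_add]; ring_nf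
    have h2 := Real.add_one_le_exp (κ * (last x - last y))
    calc _ ≤ a * (Real.exp (κ * (last x - last y)) - 1) := by gcongr; linarith
      _ = _ := by rw [h1]; ring
  have hM : 0 < min a b := lt_min ha0 hb0
  set M := min a b
  set l := min κ (2 / 5)
  have hl1 : l ≤ κ := min_le_left _ _
  have hl2 : l ≤ 2 / 5 := min_le_right _ _
  refine (le_abs_self _).trans (abs_le_of_sq_le_sq ?_ (norm_nonneg _))
  rw [norm_T_sub_sq, mul_pow, norm_sq_eq (x - y), ← ha, ← hb]
  have e1 : M ^ 2 * l ^ 2 * (last x - last y) ^ 2 ≤ (a - b) ^ 2 := by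
    rw [← sq_abs (a - b), ← sq_abs (last x - _)]
    calc _ = (M * (l * |last x - last y|)) ^ 2 := by ring
      _ ≤ (M * (κ * |last x - last y|)) ^ 2 := by gcongr
      _ ≤ _ := by gcongr
  have e2 : M ^ 2 * l ^ 2 * ‖head x - head y‖ ^ 2 ≤
      4 * a * b * ‖head x - head y‖ ^ 2 / ((1 + ‖head x‖ ^ 2) * (1 + ‖head y‖ ^ 2)) := by
    rw [le_div_iff₀ (by positivity)]
    have h1 : M ^ 2 ≤ a * b := by
      rw [sq]; exact mul_le_mul (min_le_left _ _) (min_le_right _ _) hM.le ha0.le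
    have h2 : (1 + ‖head x‖ ^ 2) * (1 + ‖head y‖ ^ 2) ≤ (1 + 2 ^ 2) * (1 + 2 ^ 2) := by gcongr
    calc _ ≤ a * b * (2 / 5) ^ 2 * ‖head x - head y‖ ^ 2 * ((1 + 2 ^ 2) * (1 + 2 ^ 2)) := by gcongr
      _ = _ := by ring
  simp only [head_sub, last_sub]
  nlinarith

/-- A smooth map with the metric properties shared by `T` and `reflect ∘ T`. -/
structure IsPolarChart (κ : ℝ) (Φ : Rn m → Rn m) : Prop where
  contDiff : ContDiff ℝ ∞ Φ
  norm_eq : ∀ x, ‖Φ x‖ = Real.exp (-κ * last x)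
  le_dist : ∀ x y, ‖head x‖ ≤ 2 → ‖head y‖ ≤ 2 →
    min κ (2 / 5) * min (Real.exp (-κ * last x)) (Real.exp (-κ * last y)) * ‖x - y‖ ≤ ‖Φ x - Φ y‖
  dist_le : ∀ x y,
    ‖Φ x - Φ y‖ ≤ (κ + 2) * max (Real.exp (-κ * last x)) (Real.exp (-κ * last y)) * ‖x - y‖

lemma isPolarChart_T {κ : ℝ} (hκ : 0 < κ) : IsPolarChart κ (T κ : Rn m → Rn m) :=
  ⟨contDiff_T κ, norm_T κ, fun _ _ => le_norm_T_sub hκ, norm_T_sub_le hκ⟩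

lemma isPolarChart_reflect_T {κ : ℝ} (hκ : 0 < κ) :
    IsPolarChart κ (fun x : Rn m => reflect (T κ x)) :=
  ⟨contDiff_reflect.comp (contDiff_T κ), fun x => by rw [norm_reflect, norm_T],
    fun x y hx hy => by rw [norm_reflect_sub]; exact le_norm_T_sub hκ hx hy,
    fun x y => by rw [norm_reflect_sub]; exact norm_T_sub_le hκ x y⟩

/-! ### The inverse of `T` -/

/-- The continuous left inverse of both `T` and `reflect ∘ T` away from the origin. -/
def unfold (κ : ℝ) (ξ : Rn m) : Rn m :=
  point ((‖ξ‖ + |last ξ|)⁻¹ • head ξ) (-Real.log ‖ξ‖ / κ)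

lemma unfold_reflect (κ : ℝ) (ξ : Rn m) : unfold κ (reflect ξ) = unfold κ ξ := by
  unfold CylCap.unfold
  rw [norm_reflect]
  simp [reflect]

lemma unfold_T {κ : ℝ} (hκ : 0 < κ) {x : Rn m} (hx : ‖head x‖ ≤ 1) : unfold κ (T κ x) = x := by
  unfold CylCap.unfold
  have h3 : 0 ≤ 1 - ‖head x‖ ^ 2 := by nlinarith [norm_nonneg (head x)]
  rw [norm_T]
  refine ext_head_last ?_ ?_
  · simp only [T, head_point, last_point]
    rw [abs_of_nonneg (by positivity), smul_smul]
    have : (Real.exp (-κ * last x) + Real.exp (-κ * last x) * (1 - ‖head x‖ ^ 2) /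
        (1 + ‖head x‖ ^ 2))⁻¹ * (2 * Real.exp (-κ * last x) / (1 + ‖head x‖ ^ 2)) = 1 := by
      have : (Real.exp (-κ * last x) + Real.exp (-κ * last x) * (1 - ‖head x‖ ^ 2) /
        (1 + ‖head x‖ ^ 2)) = (2 * Real.exp (-κ * last x) / (1 + ‖head x‖ ^ 2)) := by
        field_simp; ring
      rw [this]; exact inv_mul_cancel₀ (by positivity)
    rw [this, one_smul]
  · simp [hκ.ne']

/-- `unfold` forgets the sign of the last coordinate, so the composition is the fold onto the closed
upper half-space. The computation rests on |ξ'|² = (|ξ| - |ξ_n|)(|ξ| + |ξ_n|). -/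
lemma T_unfold {κ : ℝ} (hκ : 0 < κ) {ξ : Rn m} (hξ : ξ ≠ 0) :
    T κ (unfold κ ξ) = point (head ξ) |last ξ| := by
  have h0 : 0 < ‖ξ‖ := norm_pos_iff.2 hξ
  have h1 : Real.exp (-κ * (-Real.log ‖ξ‖ / κ)) = ‖ξ‖ := by
    rw [show -κ * (-Real.log ‖ξ‖ / κ) = Real.log ‖ξ‖ by field_simp, Real.exp_log h0]
  have h2 : ‖head (unfold κ ξ)‖ ^ 2 = (‖ξ‖ - |last ξ|) / (‖ξ‖ + |last ξ|) := by
    have := norm_sq_eq ξ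
    rw [← sq_abs (last ξ)] at this
    have h : 0 < ‖ξ‖ + |last ξ| := by positivity
    simp only [CylCap.unfold, head_point, norm_smul, mul_pow, norm_inv, Real.norm_eq_abs,
      abs_of_pos h]
    field_simp
    linarith
  have h : 0 < ‖ξ‖ + |last ξ| := by positivity
  unfold T
  rw [h2]
  simp only [CylCap.unfold, head_point, last_point, h1, smul_smul]
  have e : 1 + (‖ξ‖ - |last ξ|) / (‖ξ‖ + |last ξ|) = 2 * ‖ξ‖ / (‖ξ‖ + |last ξ|) := by
    field_simp; ring
  rw [e]
  congr 1
  · rw [show 2 * ‖ξ‖ / (2 * ‖ξ‖ / (‖ξ‖ + |last ξ|)) * (‖ξ‖ + |last ξ|)⁻¹ = 1 by field_simp, one_smul]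
  · field_simp; ring

lemma norm_head_unfold_le (κ : ℝ) (ξ : Rn m) : ‖head (unfold κ ξ)‖ ≤ 1 := by
  simp only [CylCap.unfold, head_point, norm_smul, norm_inv, Real.norm_eq_abs]
  rw [abs_of_nonneg (by positivity)]
  refine inv_mul_le_one_of_le₀ ?_ (by positivity)
  linarith [norm_head_le ξ, abs_nonneg (last ξ)]

lemma exp_last_unfold {κ : ℝ} (hκ : 0 < κ) {ξ : Rn m} (hξ : ξ ≠ 0) :
    Real.exp (-κ * last (unfold κ ξ)) = ‖ξ‖ := by
  have h0 : 0 < ‖ξ‖ := norm_pos_iff.2 hξ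
  simp only [CylCap.unfold, last_point]
  rw [show -κ * (-Real.log ‖ξ‖ / κ) = Real.log ‖ξ‖ by field_simp, Real.exp_log h0]

lemma eq_T_or_eq_reflect_T {κ : ℝ} (hκ : 0 < κ) {ξ : Rn m} (hξ : ξ ≠ 0) :
    ξ = T κ (unfold κ ξ) ∨ ξ = reflect (T κ (unfold κ ξ)) := by
  rw [T_unfold hκ hξ]
  rcases abs_choice (last ξ) with h | h
  · left; rw [h, point_head_last]
  · right; rw [h]; simp [reflect]

lemma lt_last_unfold {κ t : ℝ} (hκ : 0 < κ) {ξ : Rn m} (hξ : ξ ≠ 0)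
    (h : ‖ξ‖ < Real.exp (-κ * t)) : t < last (unfold κ ξ) := by
  rw [← exp_last_unfold hκ hξ, Real.exp_lt_exp] at h
  nlinarith

/-- The lower bound for `T` is applied to the unfolded points; `T` after `unfold` is the fold, which
does not increase distances. -/
lemma norm_unfold_sub_le {κ : ℝ} (hκ : 0 < κ) {ξ η : Rn m} (hξ : ξ ≠ 0) (hη : η ≠ 0) :
    min κ (2 / 5) * min ‖ξ‖ ‖η‖ * ‖unfold κ ξ - unfold κ η‖ ≤ ‖ξ - η‖ := by
  have h := le_norm_T_sub hκ (x := unfold κ ξ) (y := unfold κ η)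
    (by linarith [norm_head_unfold_le κ ξ]) (by linarith [norm_head_unfold_le κ η])
  rw [exp_last_unfold hκ hξ, exp_last_unfold hκ hη, T_unfold hκ hξ, T_unfold hκ hη] at h
  refine h.trans (abs_le_of_sq_le_sq ?_ (norm_nonneg _) |> (le_abs_self _).trans)
  rw [norm_sq_eq (ξ - η), point_sub, norm_point_sq]
  simp only [head_sub, last_sub]
  exact add_le_add le_rfl (sq_le_sq.2 (abs_abs_sub_abs_le_abs_sub _ _))

lemma continuousOn_unfold (κ : ℝ) : ContinuousOn (unfold κ : Rn m → Rn m) {0}ᶜ := by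
  unfold CylCap.unfold
  refine continuousOn_point ?_ ?_
  · refine ContinuousOn.smul (f := fun ξ : Rn m => (‖ξ‖ + |last ξ|)⁻¹) (ContinuousOn.inv₀ ?_ ?_)
      continuous_head.continuousOn
    · exact (continuous_norm.add continuous_last.abs).continuousOn
    · intro x hx
      have : 0 < ‖x‖ := norm_pos_iff.2 hx
      positivity
  · refine ContinuousOn.div_const (ContinuousOn.neg ?_) _
    exact continuous_norm.continuousOn.log fun x hx => norm_ne_zero_iff.2 hx

/-! ### Determinant bounds and changes of variables -/

section Det

variable {E : Type*} [NormedAddCommGroup E] [NormedSpace ℝ E] [FiniteDimensional ℝ E]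

/-- The image of the unit ball, of volume |det A| times that of the ball, lies in the ball of radius
C. -/
lemma abs_det_le_of_norm_le (A : E →L[ℝ] E) {C : ℝ} (hC : 0 ≤ C) (h : ∀ v, ‖A v‖ ≤ C * ‖v‖) :
    |A.det| ≤ C ^ Module.finrank ℝ E := by
  borelize E
  let μ : Measure E := Measure.addHaar
  have h1 : A '' Metric.closedBall 0 1 ⊆ Metric.closedBall 0 C := by
    rintro _ ⟨v, hv, rfl⟩
    rw [mem_closedBall_zero_iff] at hv ⊢
    exact (h v).trans (mul_le_of_le_one_right hC hv)
  have h2 := measure_mono (μ := μ) h1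
  rw [Measure.addHaar_image_continuousLinearMap, Measure.addHaar_closedBall _ _ hC,
    Measure.addHaar_closedBall _ _ zero_le_one, one_pow, ENNReal.ofReal_one, one_mul] at h2
  have h3 := (ENNReal.mul_le_mul_iff_left (Metric.measure_ball_pos μ 0 one_pos).ne'
    measure_ball_lt_top.ne).1 h2
  exact (ENNReal.ofReal_le_ofReal_iff (by positivity)).1 h3

lemma pow_le_abs_det_of_le_norm (A : E →L[ℝ] E) {c : ℝ} (hc : 0 < c)
    (h : ∀ v, c * ‖v‖ ≤ ‖A v‖) : c ^ Module.finrank ℝ E ≤ |A.det| := by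
  borelize E
  let μ : Measure E := Measure.addHaar
  have hinj : Function.Injective A := by
    refine (injective_iff_map_eq_zero A).2 fun v hv => norm_eq_zero.1 ?_
    have := h v
    rw [hv, norm_zero] at this
    nlinarith [norm_nonneg v]
  have hsurj : Function.Surjective A := LinearMap.injective_iff_surjective.1
    (show Function.Injective (A : E →ₗ[ℝ] E) from hinj)
  have h1 : Metric.closedBall 0 c ⊆ A '' Metric.closedBall 0 1 := by
    intro w hw
    obtain ⟨v, rfl⟩ := hsurj w
    rw [mem_closedBall_zero_iff] at hw
    exact ⟨v, mem_closedBall_zero_iff.2 (by nlinarith [h v]), rfl⟩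
  have h2 := measure_mono (μ := μ) h1
  rw [Measure.addHaar_image_continuousLinearMap, Measure.addHaar_closedBall _ _ hc.le,
    Measure.addHaar_closedBall _ _ zero_le_one, one_pow, ENNReal.ofReal_one, one_mul] at h2
  have h3 := (ENNReal.mul_le_mul_iff_left (Metric.measure_ball_pos μ 0 one_pos).ne'
    measure_ball_lt_top.ne).1 h2
  exact (ENNReal.ofReal_le_ofReal_iff (by positivity)).1 h3

end Det

namespace IsPolarChart

variable {κ : ℝ} {Φ : Rn m → Rn m}

lemma hasFDerivAt (h : IsPolarChart κ Φ) (x : Rn m) : HasFDerivAt Φ (fderiv ℝ Φ x) x :=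
  (h.contDiff.differentiable (by simp) x).hasFDerivAt

lemma tendsto_slope (h : IsPolarChart κ Φ) (x v : Rn m) :
    Tendsto (fun s : ℝ => ‖s⁻¹ • (Φ (x + s • v) - Φ x)‖) (𝓝[≠] 0) (𝓝 ‖fderiv ℝ Φ x v‖) := by
  have := (h.hasFDerivAt x).hasLineDerivAt v
  have := hasDerivAt_iff_tendsto_slope_zero.1 this
  simpa using this.norm

lemma tendsto_exp_last (κ : ℝ) (x v : Rn m) :
    Tendsto (fun s : ℝ => Real.exp (-κ * last (x + s • v))) (𝓝[≠] 0)
      (𝓝 (Real.exp (-κ * last x))) := by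
  have : Continuous fun s : ℝ => Real.exp (-κ * last (x + s • v)) :=
    Real.continuous_exp.comp (continuous_const.mul
      (continuous_last.comp (continuous_const.add (continuous_id.smul continuous_const))))
  have := this.tendsto 0
  simp only [zero_smul, add_zero] at this
  exact this.mono_left nhdsWithin_le_nhds

lemma norm_fderiv_apply_le (h : IsPolarChart κ Φ) (x v : Rn m) :
    ‖fderiv ℝ Φ x v‖ ≤ (κ + 2) * Real.exp (-κ * last x) * ‖v‖ := by
  have h1 : Tendsto (fun s : ℝ => (κ + 2) *
      max (Real.exp (-κ * last (x + s • v))) (Real.exp (-κ * last x)) * ‖v‖) (𝓝[≠] 0)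
      (𝓝 ((κ + 2) * Real.exp (-κ * last x) * ‖v‖)) := by
    have := (((tendsto_exp_last κ x v).max
      (tendsto_const_nhds (x := Real.exp (-κ * last x)))).const_mul (κ + 2)).mul_const ‖v‖
    rwa [max_self] at this
  refine le_of_tendsto_of_tendsto (h.tendsto_slope x v) h1 ?_
  filter_upwards [self_mem_nhdsWithin] with s hs
  have hs : s ≠ 0 := hs
  have := h.dist_le (x + s • v) x
  rw [add_sub_cancel_left, norm_smul] at this
  rw [norm_smul, norm_inv, inv_mul_le_iff₀ (norm_pos_iff.2 hs)]
  linarith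

lemma le_norm_fderiv_apply (h : IsPolarChart κ Φ) {x : Rn m} (hx : ‖head x‖ ≤ 1) (v : Rn m) :
    min κ (2 / 5) * Real.exp (-κ * last x) * ‖v‖ ≤ ‖fderiv ℝ Φ x v‖ := by
  have h1 : Tendsto (fun s : ℝ => min κ (2 / 5) *
      min (Real.exp (-κ * last (x + s • v))) (Real.exp (-κ * last x)) * ‖v‖) (𝓝[≠] 0)
      (𝓝 (min κ (2 / 5) * Real.exp (-κ * last x) * ‖v‖)) := by
    have := (((tendsto_exp_last κ x v).min
      (tendsto_const_nhds (x := Real.exp (-κ * last x)))).const_mul (min κ (2 / 5))).mul_const ‖v‖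
    rwa [min_self] at this
  refine le_of_tendsto_of_tendsto h1 (h.tendsto_slope x v) ?_
  -- This is where the slack between 1 and 2 in `le_dist` is spent: x may lie on the lateral
  -- boundary.
  have h2 : ∀ᶠ s : ℝ in 𝓝[≠] 0, ‖head (x + s • v)‖ < 2 := by
    have hc : Continuous fun s : ℝ => ‖head (x + s • v)‖ :=
      (continuous_head.comp (continuous_const.add (continuous_id.smul continuous_const))).norm
    refine (hc.tendsto 0).mono_left nhdsWithin_le_nhds |>.eventually_lt_const ?_
    simp only [zero_smul, add_zero]; linarith
  filter_upwards [self_mem_nhdsWithin, h2] with s hs hs2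
  have hs : s ≠ 0 := hs
  have := h.le_dist (x + s • v) x hs2.le (by linarith)
  rw [add_sub_cancel_left, norm_smul] at this
  rw [norm_smul, norm_inv, le_inv_mul_iff₀ (norm_pos_iff.2 hs)]
  linarith

lemma norm_fderiv_le (h : IsPolarChart κ Φ) (hκ : 0 < κ) (x : Rn m) :
    ‖fderiv ℝ Φ x‖ ≤ (κ + 2) * Real.exp (-κ * last x) :=
  ContinuousLinearMap.opNorm_le_bound _ (by positivity) (h.norm_fderiv_apply_le x)

lemma injOn (h : IsPolarChart κ Φ) (hκ : 0 < κ) : InjOn Φ {x | ‖head x‖ ≤ 1} := by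
  intro x hx y hy hxy
  have hx : ‖head x‖ ≤ 1 := hx
  have hy : ‖head y‖ ≤ 1 := hy
  have := h.le_dist x y (by linarith) (by linarith)
  rw [hxy, sub_self, norm_zero] at this
  have h1 : 0 < min κ (2 / 5) * min (Real.exp (-κ * last x)) (Real.exp (-κ * last y)) :=
    mul_pos (lt_min hκ (by norm_num)) (lt_min (Real.exp_pos _) (Real.exp_pos _))
  have h2 : ‖x - y‖ ≤ 0 := by nlinarith [norm_nonneg (x - y)]
  exact sub_eq_zero.1 (norm_le_zero_iff.1 h2)

lemma lintegral_image_le (h : IsPolarChart κ Φ) (hκ : 0 < κ) {A : Set (Rn m)}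
    (hA : MeasurableSet A) (hA1 : A ⊆ {x | ‖head x‖ ≤ 1}) (f : Rn m → ℝ≥0∞) :
    ∫⁻ ξ in Φ '' A, f ξ ≤ ENNReal.ofReal ((κ + 2) ^ (m + 1)) *
      ∫⁻ x in A, ENNReal.ofReal (Real.exp (-κ * last x) ^ (m + 1)) * f (Φ x) := by
  rw [lintegral_image_eq_lintegral_abs_det_fderiv_mul volume hA
    (fun x _ => (h.hasFDerivAt x).hasFDerivWithinAt) ((h.injOn hκ).mono hA1),
    ← lintegral_const_mul' _ _ ENNReal.ofReal_ne_top]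
  refine lintegral_mono fun x => ?_
  rw [← mul_assoc, ← ENNReal.ofReal_mul (by positivity), ← mul_pow]
  gcongr
  simpa using abs_det_le_of_norm_le _ (by positivity) (h.norm_fderiv_apply_le x)

lemma le_lintegral_image (h : IsPolarChart κ Φ) (hκ : 0 < κ) {A : Set (Rn m)}
    (hA : MeasurableSet A) (hA1 : A ⊆ {x | ‖head x‖ ≤ 1}) (f : Rn m → ℝ≥0∞) :
    ENNReal.ofReal (min κ (2 / 5) ^ (m + 1)) *
      ∫⁻ x in A, ENNReal.ofReal (Real.exp (-κ * last x) ^ (m + 1)) * f (Φ x) ≤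
    ∫⁻ ξ in Φ '' A, f ξ := by
  have hl : 0 < min κ (2 / 5) := lt_min hκ (by norm_num)
  rw [lintegral_image_eq_lintegral_abs_det_fderiv_mul volume hA
    (fun x _ => (h.hasFDerivAt x).hasFDerivWithinAt) ((h.injOn hκ).mono hA1),
    ← lintegral_const_mul' _ _ ENNReal.ofReal_ne_top]
  refine setLIntegral_mono' hA fun x hx => ?_
  rw [← mul_assoc, ← ENNReal.ofReal_mul (by positivity), ← mul_pow]
  gcongr
  simpa using pow_le_abs_det_of_le_norm _ (mul_pos hl (Real.exp_pos _))
    (h.le_norm_fderiv_apply (hA1 hx))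

end IsPolarChart

/-! ### Gradients and the weight -/

lemma norm_gradient {E : Type*} [NormedAddCommGroup E] [InnerProductSpace ℝ E] [CompleteSpace E]
    (f : E → ℝ) (x : E) : ‖∇ f x‖ = ‖fderiv ℝ f x‖ := by
  rw [gradient]; simp

lemma norm_gradient_sub {E : Type*} [NormedAddCommGroup E] [InnerProductSpace ℝ E]
    [CompleteSpace E] (f g : E → ℝ) (x : E) :
    ‖∇ f x - ∇ g x‖ = ‖fderiv ℝ f x - fderiv ℝ g x‖ := by
  rw [gradient, gradient, ← map_sub, LinearIsometryEquiv.norm_map]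

lemma enorm_gradient (f : Rn m → ℝ) (x : Rn m) : ‖∇ f x‖ₑ = ‖fderiv ℝ f x‖ₑ := by
  rw [← ofReal_norm, ← ofReal_norm, norm_gradient]

lemma gradient_apply (f : Rn m → ℝ) (x : Rn m) (i : Fin (m + 1)) :
    (∇ f x) i = fderiv ℝ f x (EuclideanSpace.single i 1) := by
  have : (∇ f x) i = inner ℝ (∇ f x) (EuclideanSpace.single i (1 : ℝ)) := by
    rw [EuclideanSpace.inner_single_right]; simp
  rw [this, gradient, InnerProductSpace.toDual_symm_apply]

lemma continuous_gradient {f : Rn m → ℝ} (hf : ContDiff ℝ ∞ f) : Continuous (∇ f) := by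
  unfold gradient
  exact (LinearIsometryEquiv.continuous _).comp (hf.continuous_fderiv (by simp))

lemma weight_of_ne {p : ℝ} {ξ : Rn m} (h : ξ ≠ 0) : weight p ξ = ‖ξ‖ ^ (p - ((m : ℝ) + 1)) :=
  if_neg h

lemma measurable_weight (p : ℝ) : Measurable (weight p : Rn m → ℝ) := by
  unfold weight
  exact Measurable.ite (measurableSet_singleton 0) measurable_const
    (measurable_norm.pow_const _)

/-- The size of the Jacobian times the weight is exactly the factor by which the p-th power of a
gradient changes under the chart. This is why the exponent of the weight is p - n. -/
lemma IsPolarChart.exp_pow_mul_weight {κ p : ℝ} {Φ : Rn m → Rn m} (h : IsPolarChart κ Φ)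
    (x : Rn m) : Real.exp (-κ * last x) ^ (m + 1) * weight p (Φ x) =
      Real.exp (-κ * last x) ^ p := by
  have h0 : Φ x ≠ 0 := norm_pos_iff.1 (by rw [h.norm_eq]; positivity)
  rw [weight_of_ne h0, h.norm_eq, ← Real.rpow_natCast, ← Real.rpow_add (Real.exp_pos _)]
  push_cast
  ring_nf

/-! ### Inequalities for `p`-th powers -/

lemma rpow_add_le {p : ℝ} (hp : 1 < p) (a b : ℝ≥0∞) :
    (a + b) ^ p ≤ 2 ^ (p - 1) * (a ^ p + b ^ p) :=
  ENNReal.rpow_add_le_mul_rpow_add_rpow a b hp.le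

/-- Jensen's inequality for the p-th power, obtained from Hölder against the constant 1. -/
lemma lintegral_rpow_le_of_isProbabilityMeasure {α : Type*} [MeasurableSpace α] (ν : Measure α)
    [IsProbabilityMeasure ν] {p : ℝ} (hp : 1 < p) {h : α → ℝ≥0∞} (hh : AEMeasurable h ν) :
    (∫⁻ z, h z ∂ν) ^ p ≤ ∫⁻ z, h z ^ p ∂ν := by
  have := ENNReal.lintegral_mul_le_Lp_mul_Lq ν (Real.HolderConjugate.conjExponent hp) hh
    (aemeasurable_const (b := (1 : ℝ≥0∞)))
  simp only [Pi.mul_apply, mul_one, ENNReal.one_rpow, lintegral_const, measure_univ] at this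
  have h1 := ENNReal.rpow_le_rpow this (by linarith : 0 ≤ p)
  rwa [← ENNReal.rpow_mul, one_div_mul_cancel (by linarith), ENNReal.rpow_one] at h1

/-- If the norms agree, strictness comes from strict convexity of the norm; otherwise from strict
convexity of s ↦ s^p. -/
lemma rpow_midpoint_lt {E : Type*} [NormedAddCommGroup E] [NormedSpace ℝ E] [StrictConvexSpace ℝ E]
    {p : ℝ} (hp : 1 < p) {a b : E} (hab : a ≠ b) :
    ‖(1 / 2 : ℝ) • (a + b)‖ ^ p < (‖a‖ ^ p + ‖b‖ ^ p) / 2 := by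
  have hc := strictConvexOn_rpow hp
  rw [norm_smul, Real.norm_eq_abs, abs_of_pos (by norm_num : (0 : ℝ) < 1 / 2)]
  by_cases hn : ‖a‖ = ‖b‖
  · have h1 : ‖a + b‖ < ‖a‖ + ‖b‖ := by
      refine (norm_add_le a b).lt_of_ne fun h => hab ?_
      exact eq_of_norm_eq_of_norm_add_eq hn h
    have : 1 / 2 * ‖a + b‖ < ‖a‖ := by linarith
    have := Real.rpow_lt_rpow (by positivity) this (by linarith : 0 < p)
    rw [← hn]; linarith
  · have h1 := hc.2 (norm_nonneg a) (norm_nonneg b) hn (by norm_num : (0 : ℝ) < 1 / 2)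
      (by norm_num : (0 : ℝ) < 1 / 2) (by norm_num)
    simp only [smul_eq_mul] at h1
    have h2 : (1 / 2 * ‖a + b‖) ^ p ≤ (1 / 2 * ‖a‖ + 1 / 2 * ‖b‖) ^ p := by
      refine Real.rpow_le_rpow (by positivity) ?_ (by linarith)
      linarith [norm_add_le a b]
    linarith

/-- Quantitative strict convexity of `‖·‖ ^ p`. -/
lemma exists_rpow_norm_sub_add_le {E : Type*} [NormedAddCommGroup E] [NormedSpace ℝ E]
    [StrictConvexSpace ℝ E] [FiniteDimensional ℝ E] {p : ℝ} (hp : 1 < p) {ε : ℝ} (hε : 0 < ε) :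
    ∃ C : ℝ, 0 ≤ C ∧ ∀ a b : E, ‖a - b‖ ^ p + C * ‖(1 / 2 : ℝ) • (a + b)‖ ^ p ≤
      (ε + C / 2) * (‖a‖ ^ p + ‖b‖ ^ p) := by
  have hp0 : 0 < p := by linarith
  have : ProperSpace E := FiniteDimensional.proper ℝ E
  have hcont : ∀ {f : E × E → E}, Continuous f → Continuous fun q => ‖f q‖ ^ p := fun hf =>
    hf.norm.rpow_const fun _ => Or.inr hp0.le
  have cS : Continuous fun q : E × E => ‖q.1‖ ^ p + ‖q.2‖ ^ p :=
    (hcont continuous_fst).add (hcont continuous_snd)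
  have cD : Continuous fun q : E × E => ‖q.1 - q.2‖ ^ p :=
    hcont (continuous_fst.sub continuous_snd)
  have cM : Continuous fun q : E × E => ‖(1 / 2 : ℝ) • (q.1 + q.2)‖ ^ p :=
    hcont ((continuous_fst.add continuous_snd).const_smul _)
  set K : Set (E × E) := {q | ‖q.1‖ ^ p + ‖q.2‖ ^ p = 1 ∧ ε ≤ ‖q.1 - q.2‖ ^ p} with hK
  have hb1 : ∀ q : E × E, ‖q.1‖ ^ p + ‖q.2‖ ^ p = 1 → ‖q.1‖ ≤ 1 ∧ ‖q.2‖ ≤ 1 := by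
    intro q hq
    have h1 : 0 ≤ ‖q.1‖ ^ p := by positivity
    have h2 : 0 ≤ ‖q.2‖ ^ p := by positivity
    constructor <;> by_contra! h
    · linarith [Real.one_lt_rpow h hp0]
    · linarith [Real.one_lt_rpow h hp0]
  have hKc : IsCompact K := by
    refine Metric.isCompact_of_isClosed_isBounded ?_ ?_
    · exact (isClosed_eq cS continuous_const).inter (isClosed_le continuous_const cD)
    · refine (Metric.isBounded_closedBall (x := (0 : E × E)) (r := 1)).subset fun q hq => ?_
      rw [mem_closedBall_zero_iff, Prod.norm_def]
      exact max_le (hb1 q hq.1).1 (hb1 q hq.1).2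
  have hmid : ∀ a b : E, ‖(1 / 2 : ℝ) • (a + b)‖ ^ p ≤ (‖a‖ ^ p + ‖b‖ ^ p) / 2 := by
    intro a b
    rcases eq_or_ne a b with rfl | h
    · rw [← two_smul ℝ a, smul_smul]; norm_num
    · exact (rpow_midpoint_lt hp h).le
  -- On normalized pairs that are far apart, compactness makes the convexity gap uniform. Since |a -
  -- b|^p ≤ 2^p there, the constant 2^p / δ lets this gap absorb the difference term.
  obtain ⟨δ, hδ, hδK⟩ : ∃ δ > 0, ∀ q ∈ K, δ ≤ 1 / 2 - ‖(1 / 2 : ℝ) • (q.1 + q.2)‖ ^ p := by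
    rcases K.eq_empty_or_nonempty with h | h
    · exact ⟨1, one_pos, by simp [h]⟩
    · obtain ⟨q, hq, hmin⟩ := hKc.exists_isMinOn h (continuous_const.sub cM).continuousOn
      refine ⟨_, ?_, fun r hr => hmin hr⟩
      have hne : q.1 ≠ q.2 := by
        intro he
        have := hq.2
        rw [he, sub_self, norm_zero, Real.zero_rpow hp0.ne'] at this
        linarith
      have := rpow_midpoint_lt hp hne
      rw [hq.1] at this
      show 0 < 1 / 2 - ‖(1 / 2 : ℝ) • (q.1 + q.2)‖ ^ p
      linarith
  have hC : 0 ≤ 2 ^ p / δ := by positivity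
  have hone : ∀ a b : E, ‖a‖ ^ p + ‖b‖ ^ p = 1 →
      ‖a - b‖ ^ p + 2 ^ p / δ * ‖(1 / 2 : ℝ) • (a + b)‖ ^ p ≤ ε + 2 ^ p / δ / 2 := by
    intro a b hab
    by_cases h : ε ≤ ‖a - b‖ ^ p
    · have h1 := hδK (a, b) ⟨hab, h⟩
      have h2 : ‖a - b‖ ^ p ≤ 2 ^ p := by
        refine Real.rpow_le_rpow (norm_nonneg _) ?_ hp0.le
        have := hb1 (a, b) hab
        linarith [norm_sub_le a b, this.1, this.2]
      have h3 : 2 ^ p / δ * δ ≤ 2 ^ p / δ * (1 / 2 - ‖(1 / 2 : ℝ) • (a + b)‖ ^ p) :=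
        mul_le_mul_of_nonneg_left h1 hC
      rw [div_mul_cancel₀ _ hδ.ne'] at h3
      linarith
    · have h1 := hmid a b
      rw [hab] at h1
      have := mul_le_mul_of_nonneg_left h1 hC
      linarith
  refine ⟨2 ^ p / δ, hC, fun a b => ?_⟩
  set s := ‖a‖ ^ p + ‖b‖ ^ p with hs
  have hs0 : 0 ≤ s := by positivity
  rcases hs0.eq_or_lt with h0 | h0
  · have ha : ‖a‖ ^ p = 0 := by
      linarith [show 0 ≤ ‖a‖ ^ p by positivity, show 0 ≤ ‖b‖ ^ p by positivity]
    have hb : ‖b‖ ^ p = 0 := by linarith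
    rw [Real.rpow_eq_zero (norm_nonneg _) hp0.ne', norm_eq_zero] at ha hb
    subst ha hb
    simp [← h0, Real.zero_rpow hp0.ne']
  -- Both sides are homogeneous of degree p, so the general pair is rescaled to the normalized case.
  · set l := s ^ (-1 / p) with hl
    have hl0 : 0 < l := Real.rpow_pos_of_pos h0 _
    have hlp : l ^ p = s⁻¹ := by
      rw [hl, ← Real.rpow_mul h0.le, div_mul_cancel₀ _ hp0.ne', Real.rpow_neg_one]
    have hsc : ∀ v : E, ‖l • v‖ ^ p = s⁻¹ * ‖v‖ ^ p := fun v => by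
      rw [norm_smul, Real.norm_eq_abs, abs_of_pos hl0, Real.mul_rpow hl0.le (norm_nonneg _), hlp]
    have := hone (l • a) (l • b) (by rw [hsc, hsc, ← mul_add, ← hs, inv_mul_cancel₀ h0.ne'])
    rw [← smul_sub, ← smul_add, smul_comm, hsc, hsc] at this
    calc _ = s * (s⁻¹ * ‖a - b‖ ^ p + 2 ^ p / δ * (s⁻¹ * ‖(1 / 2 : ℝ) • (a + b)‖ ^ p)) := by
          field_simp
      _ ≤ s * (ε + 2 ^ p / δ / 2) := by gcongr
      _ = _ := by ring

/-- A sequence in `L ^ p` with asymptotically minimal energy along midpoints is Cauchy. -/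
lemma cauchy_of_midpoint {α E : Type*} [MeasurableSpace α] [NormedAddCommGroup E] [NormedSpace ℝ E]
    [StrictConvexSpace ℝ E] [FiniteDimensional ℝ E] [MeasurableSpace E] [BorelSpace E]
    {p : ℝ} (hp : 1 < p) (μ : Measure α) {f : ℕ → α → E} (hf : ∀ j, Measurable (f j))
    {a b : ℕ → ℝ} {c : ℝ} (ha : Tendsto a atTop (𝓝 c)) (hb : Tendsto b atTop (𝓝 c))
    (hb0 : ∀ j, 0 ≤ b j)
    (hfb : ∀ j, ∫⁻ x, ‖f j x‖ₑ ^ p ∂μ ≤ ENNReal.ofReal (b j))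
    (hfa : ∀ i j, i ≤ j →
      ENNReal.ofReal (a i) ≤ ∫⁻ x, ‖(1 / 2 : ℝ) • (f i x + f j x)‖ₑ ^ p ∂μ)
    {θ : ℝ} (hθ : 0 < θ) :
    ∃ N, ∀ i j, N ≤ i → i ≤ j → ∫⁻ x, ‖f i x - f j x‖ₑ ^ p ∂μ ≤ ENNReal.ofReal θ := by
  have hp0 : 0 < p := by linarith
  have hc0 : 0 ≤ c := ge_of_tendsto' hb hb0
  obtain ⟨C, hC, hCab⟩ := exists_rpow_norm_sub_add_le (E := E) hp
    (show 0 < θ / (4 * (c + 1)) by positivity)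
  -- For large indices the integral is at most (ε + C/2)(2c + 2s) - C(c - s) = 2ε(c + s) + 2Cs. The
  -- choices of ε and s make each of these two terms at most θ/2.
  set ε := θ / (4 * (c + 1)) with hε
  have hε0 : 0 < ε := by positivity
  set s : ℝ := min 1 (θ / (4 * (C + 1))) with hs
  have hs0 : 0 < s := lt_min one_pos (by positivity)
  have e1 : ∀ᶠ j in atTop, b j < c + s := hb.eventually_lt_const (by linarith)
  have e2 : ∀ᶠ j in atTop, c - s < a j := ha.eventually_const_lt (by linarith)
  obtain ⟨N, hN⟩ := (e1.and e2).exists_forall_of_atTop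
  refine ⟨N, fun i j hi hij => ?_⟩
  have hbi := (hN i hi).1
  have hbj := (hN j (hi.trans hij)).1
  have hai := (hN i hi).2
  have hpt : ∀ x, ‖f i x - f j x‖ₑ ^ p +
      ENNReal.ofReal C * ‖(1 / 2 : ℝ) • (f i x + f j x)‖ₑ ^ p ≤
      ENNReal.ofReal (ε + C / 2) * (‖f i x‖ₑ ^ p + ‖f j x‖ₑ ^ p) := by
    intro x
    have he : ∀ v : E, ‖v‖ₑ ^ p = ENNReal.ofReal (‖v‖ ^ p) := fun v => by
      rw [← ofReal_norm, ENNReal.ofReal_rpow_of_nonneg (norm_nonneg _) hp0.le]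
    simp only [he]
    rw [← ENNReal.ofReal_mul hC, ← ENNReal.ofReal_add (by positivity) (by positivity),
      ← ENNReal.ofReal_add (by positivity) (by positivity), ← ENNReal.ofReal_mul (by positivity)]
    exact ENNReal.ofReal_le_ofReal (hCab _ _)
  have mp : ∀ {g : α → E}, Measurable g → Measurable fun x => ‖g x‖ₑ ^ p := fun hg =>
    hg.enorm.pow_const p
  have h1 := lintegral_mono (μ := μ) hpt
  have m1 : Measurable fun x => ‖f i x - f j x‖ₑ ^ p := mp ((hf i).sub (hf j))
  rw [lintegral_add_left m1, lintegral_const_mul' _ _ ENNReal.ofReal_ne_top,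
    lintegral_const_mul' _ _ ENNReal.ofReal_ne_top, lintegral_add_left (mp (hf i))] at h1
  have h2 : ∫⁻ x, ‖f i x - f j x‖ₑ ^ p ∂μ + ENNReal.ofReal C * ENNReal.ofReal (a i) ≤
      ENNReal.ofReal (ε + C / 2) * (ENNReal.ofReal (b i) + ENNReal.ofReal (b j)) :=
    ((add_le_add le_rfl (mul_le_mul_right (hfa i j hij) _)).trans h1).trans
      (mul_le_mul_right (add_le_add (hfb i) (hfb j)) _)
  rw [← ENNReal.ofReal_mul hC, ← ENNReal.ofReal_add (hb0 i) (hb0 j),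
    ← ENNReal.ofReal_mul (by positivity)] at h2
  have h3 : ∫⁻ x, ‖f i x - f j x‖ₑ ^ p ∂μ ≤
      ENNReal.ofReal ((ε + C / 2) * (b i + b j)) - ENNReal.ofReal (C * a i) :=
    ENNReal.le_sub_of_add_le_right ENNReal.ofReal_ne_top h2
  refine h3.trans ?_
  rw [tsub_le_iff_right]
  refine le_trans (ENNReal.ofReal_le_ofReal ?_) ENNReal.ofReal_add_le
  have hs1 : s ≤ 1 := min_le_left _ _
  have hs2 : s * (4 * (C + 1)) ≤ θ := by
    rw [← le_div_iff₀ (by positivity)]; exact min_le_right _ _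
  have hε1 : ε * (4 * (c + 1)) = θ := by rw [hε]; field_simp
  have : ε * s ≤ ε := mul_le_of_le_one_right hε0.le hs1
  nlinarith

/-! ### The domain `G \ Q_t` -/

lemma cyl_diff_cylBelow {t : ℝ} (ht : 0 ≤ t) :
    cyl m \ cylBelow m t = {x | ‖head x‖ < 1 ∧ t < last x} := by
  ext x
  simp only [cyl, cylBelow, Set.mem_sdiff, mem_ofPred_eq, not_and, not_le]
  constructor
  · rintro ⟨⟨h1, h2⟩, h3⟩
    exact ⟨h1, h3 h1.le h2.le⟩
  · rintro ⟨h1, h2⟩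
    exact ⟨⟨h1, ht.trans_lt h2⟩, fun _ _ => h2⟩

lemma isOpen_cyl_diff {t : ℝ} (ht : 0 ≤ t) : IsOpen (cyl m \ cylBelow m t) := by
  rw [cyl_diff_cylBelow ht]
  exact (isOpen_lt continuous_head.norm continuous_const).inter
    (isOpen_lt continuous_const continuous_last)

lemma measurableSet_cylAbove (t : ℝ) : MeasurableSet (cylAbove m t) :=
  (isClosed_le continuous_head.norm continuous_const).measurableSet.inter
    (isOpen_lt continuous_const continuous_last).measurableSet

lemma cylAbove_subset (t : ℝ) : cylAbove m t ⊆ {x | ‖head x‖ ≤ 1} := fun _ hx => hx.1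

/-- The set lies in the frontier of a convex set, which is null: each of its points is the limit of
c • x as c increases to 1. -/
lemma volume_norm_head_eq_one : volume {x : Rn m | ‖head x‖ = 1} = 0 := by
  have hconv : Convex ℝ {x : Rn m | ‖head x‖ < 1} := by
    have : {x : Rn m | ‖head x‖ < 1} = headL m ⁻¹' Metric.ball 0 1 := by
      ext; simp
    rw [this]
    exact (convex_ball _ _).is_linear_preimage (headL m).isLinear
  refine measure_mono_null (fun x hx => ?_) (hconv.addHaar_frontier volume)
  have hx : ‖head x‖ = 1 := hx
  have ho : IsOpen {x : Rn m | ‖head x‖ < 1} := isOpen_lt continuous_head.norm continuous_const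
  rw [ho.frontier_eq]
  refine ⟨?_, by simp [hx]⟩
  have hc : Tendsto (fun c : ℝ => c • x) (𝓝[<] 1) (𝓝 ((1 : ℝ) • x)) :=
    ((continuous_id.smul continuous_const).tendsto 1).mono_left nhdsWithin_le_nhds
  rw [one_smul] at hc
  refine mem_closure_of_tendsto hc ?_
  filter_upwards [self_mem_nhdsWithin, mem_nhdsWithin_of_mem_nhds (lt_mem_nhds one_pos)] with c h1 h2
  have h1 : c < 1 := h1
  simp only [head_smul, norm_smul, hx, Real.norm_eq_abs, abs_of_pos h2, mul_one, h1]

lemma restrict_cylAbove {t : ℝ} (ht : 0 ≤ t) :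
    (volume : Measure (Rn m)).restrict (cylAbove m t) = volume.restrict (cyl m \ cylBelow m t) := by
  rw [cyl_diff_cylBelow ht]
  refine Measure.restrict_congr_set ?_
  have : ∀ᵐ x : Rn m, x ∉ {x : Rn m | ‖head x‖ = 1} := measure_eq_zero_iff_ae_notMem.1
    volume_norm_head_eq_one
  filter_upwards [this] with x hx
  have hx : ‖head x‖ ≠ 1 := hx
  refine propext ⟨fun h => ⟨h.1.lt_of_ne hx, h.2⟩, fun h => ⟨h.1.le, h.2⟩⟩

lemma volume_slab_le (R : ℝ) :
    volume {x : Rn m | ‖head x‖ < 1 ∧ 0 < last x ∧ last x ≤ R} ≤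
      2 ^ m * ENNReal.ofReal R := by
  have hmp := EuclideanSpace.volume_preserving_symm_measurableEquiv_toLp (Fin (m + 1))
  set b : Fin (m + 1) → ℝ := Fin.snoc (α := fun _ => ℝ) (fun _ : Fin m => (1 : ℝ)) R
  set a : Fin (m + 1) → ℝ := Fin.snoc (α := fun _ => ℝ) (fun _ : Fin m => (-1 : ℝ)) 0
  have hsub : {x : Rn m | ‖head x‖ < 1 ∧ 0 < last x ∧ last x ≤ R} ⊆
      (MeasurableEquiv.toLp 2 (Fin (m + 1) → ℝ)).symm ⁻¹' Icc a b := by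
    rintro x ⟨h1, h2, h3⟩
    have h4 : ∀ i : Fin m, |x i.castSucc| ≤ 1 := fun i =>
      (PiLp.norm_apply_le (head x) i).trans h1.le
    constructor <;> intro i <;> refine Fin.lastCases ?_ (fun i => ?_) i
    · simpa [a, last] using h2.le
    · simpa [a] using (abs_le.1 (h4 i)).1
    · simpa [b, last] using h3
    · simpa [b] using (abs_le.1 (h4 i)).2
  refine (measure_mono hsub).trans ?_
  rw [hmp.measure_preimage measurableSet_Icc.nullMeasurableSet, Real.volume_Icc_pi,
    Fin.prod_univ_castSucc]
  simp only [a, b, Fin.snoc_castSucc, Fin.snoc_last, Finset.prod_const, Finset.card_univ,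
    Fintype.card_fin, sub_zero]
  gcongr
  rw [show (1 : ℝ) - -1 = 2 by norm_num]
  simp

/-! ### Pulling back the energy along `T` -/

lemma T_mem_ball_iff {κ t : ℝ} (hκ : 0 < κ) (x : Rn m) :
    T κ x ∈ Metric.ball (0 : Rn m) (Real.exp (-κ * t)) ↔ t < last x := by
  rw [mem_ball_zero_iff, norm_T, Real.exp_lt_exp]
  constructor <;> intro h <;> nlinarith

/-- The constant in `lintegral_gradient_comp_T_le`. -/
def pullConst (m : ℕ) (p κ : ℝ) : ℝ := (κ + 2) ^ p / min κ (2 / 5) ^ (m + 1)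

lemma pullConst_pos (m : ℕ) (p : ℝ) {κ : ℝ} (hκ : 0 < κ) : 0 < pullConst m p κ := by
  have : 0 < min κ (2 / 5) := lt_min hκ (by norm_num)
  unfold pullConst; positivity

/-- The chain rule produces the factor (κ + 2)^p e^{-pκ x_n}. Its exponential part is the Jacobian
scale times the weight, so the lower Jacobian bound finishes the change of variables. -/
lemma lintegral_gradient_comp_T_le {p κ : ℝ} (hp : 1 < p) (hκ : 0 < κ) (t : ℝ) {u : Rn m → ℝ}
    (hu : ContDiff ℝ ∞ u) :
    ∫⁻ x in cylAbove m t, ‖∇ (fun x => u (T κ x)) x‖ₑ ^ p ≤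
      ENNReal.ofReal (pullConst m p κ) *
        ∫⁻ ξ in Metric.ball 0 (Real.exp (-κ * t)), ‖∇ u ξ‖ₑ ^ p * ENNReal.ofReal (weight p ξ) := by
  have hT := isPolarChart_T (m := m) hκ
  have hp0 : 0 < p := by linarith
  have h1 := hT.le_lintegral_image hκ (measurableSet_cylAbove t) (cylAbove_subset t)
    (fun ξ => ‖∇ u ξ‖ₑ ^ p * ENNReal.ofReal (weight p ξ))
  have h2 : T κ '' cylAbove m t ⊆ Metric.ball 0 (Real.exp (-κ * t)) := by
    rintro _ ⟨x, hx, rfl⟩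
    exact (T_mem_ball_iff hκ x).2 hx.2
  have h3 := h1.trans (lintegral_mono_set h2)
  have h4 : ∫⁻ x in cylAbove m t, ‖∇ (fun x => u (T κ x)) x‖ₑ ^ p ≤ ENNReal.ofReal ((κ + 2) ^ p) *
      ∫⁻ x in cylAbove m t, ENNReal.ofReal (Real.exp (-κ * last x) ^ (m + 1)) *
        (‖∇ u (T κ x)‖ₑ ^ p * ENNReal.ofReal (weight p (T κ x))) := by
    rw [← lintegral_const_mul' _ _ ENNReal.ofReal_ne_top]
    refine lintegral_mono fun x => ?_
    have hd : fderiv ℝ (fun x => u (T κ x)) x = (fderiv ℝ u (T κ x)).comp (fderiv ℝ (T κ) x) :=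
      fderiv_comp x (hu.differentiable (by simp) _) (hT.hasFDerivAt x).differentiableAt
    have e1 : ‖∇ (fun x => u (T κ x)) x‖ₑ ≤
        ENNReal.ofReal ((κ + 2) * Real.exp (-κ * last x)) * ‖∇ u (T κ x)‖ₑ := by
      rw [← ofReal_norm, ← ofReal_norm, ← ENNReal.ofReal_mul (by positivity), norm_gradient,
        norm_gradient, hd]
      refine ENNReal.ofReal_le_ofReal ?_
      calc _ ≤ ‖fderiv ℝ u (T κ x)‖ * ‖fderiv ℝ (T κ) x‖ := ContinuousLinearMap.opNorm_comp_le _ _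
        _ ≤ ‖fderiv ℝ u (T κ x)‖ * ((κ + 2) * Real.exp (-κ * last x)) := by
          gcongr; exact hT.norm_fderiv_le hκ x
        _ = _ := by ring
    calc _ ≤ (ENNReal.ofReal ((κ + 2) * Real.exp (-κ * last x)) * ‖∇ u (T κ x)‖ₑ) ^ p := by gcongr
      _ = ENNReal.ofReal ((κ + 2) ^ p) * (ENNReal.ofReal (Real.exp (-κ * last x) ^ (m + 1) *
            weight p (T κ x)) * ‖∇ u (T κ x)‖ₑ ^ p) := by
          rw [hT.exp_pow_mul_weight, ENNReal.mul_rpow_of_nonneg _ _ hp0.le,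
            ENNReal.ofReal_rpow_of_nonneg (by positivity) hp0.le,
            Real.mul_rpow (by positivity) (by positivity), ENNReal.ofReal_mul (by positivity),
            mul_assoc]
      _ = _ := by
          rw [ENNReal.ofReal_mul (by positivity)]; ring
  refine h4.trans ?_
  have h5 : ENNReal.ofReal (pullConst m p κ) * ENNReal.ofReal (min κ (2 / 5) ^ (m + 1)) =
      ENNReal.ofReal ((κ + 2) ^ p) := by
    rw [← ENNReal.ofReal_mul (pullConst_pos m p hκ).le, pullConst, div_mul_cancel₀ _ (by positivity)]
  rw [← h5, mul_assoc]
  gcongr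

/-! ### A weighted Hardy inequality -/

/-- The exponential distribution turns the one-sided Hardy estimate into an average, to which
Jensen's inequality applies. -/
lemma exists_isProbabilityMeasure_exp {κ : ℝ} (hκ : 0 < κ) :
    ∃ ν : Measure ℝ, IsProbabilityMeasure ν ∧ SFinite ν ∧ ∀ f : ℝ → ℝ≥0∞, Measurable f →
      ∫⁻ s, f s ∂ν = ∫⁻ s in Ioi 0, ENNReal.ofReal (κ * Real.exp (-κ * s)) * f s := by
  have hm : Measurable fun s : ℝ => ENNReal.ofReal (κ * Real.exp (-κ * s)) := by fun_prop
  have hprob : IsProbabilityMeasure ((volume.restrict (Ioi (0 : ℝ))).withDensity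
      fun s => ENNReal.ofReal (κ * Real.exp (-κ * s))) := by
    constructor
    rw [withDensity_apply _ MeasurableSet.univ, Measure.restrict_univ,
      ← ofReal_integral_eq_lintegral_ofReal]
    · rw [integral_const_mul, integral_exp_mul_Ioi (by linarith)]
      simp [hκ.ne']
    · exact (integrableOn_exp_mul_Ioi (by linarith) 0).const_mul κ
    · exact Eventually.of_forall fun s => by positivity
  refine ⟨_, hprob, inferInstance, fun f hf => ?_⟩
  rw [lintegral_withDensity_eq_lintegral_mul _ hm hf]
  rfl

/-- Integrate the derivative along the axis from x down to height t, where v vanishes. The path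
length s stays below x_n, so e^{-κ x_n} ≤ e^{-κ s}, and the bound becomes a convolution in the axial
direction. -/
lemma enorm_mul_exp_le {κ t : ℝ} (hκ : 0 < κ) (ht : 0 ≤ t) {v : Rn m → ℝ} (hv : ContDiff ℝ ∞ v)
    (hv0 : ∀ x, last x ≤ t → v x = 0) {x : Rn m} (hx : x ∈ cyl m \ cylBelow m t) :
    ‖v x‖ₑ * ENNReal.ofReal (Real.exp (-κ * last x)) ≤
      ∫⁻ s in Ioi (0 : ℝ), ENNReal.ofReal (Real.exp (-κ * s)) *
        (cyl m \ cylBelow m t).indicator (fun y => ‖∇ v y‖ₑ) (x - s • point 0 1) := by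
  set e : Rn m := point 0 1 with he
  rw [cyl_diff_cylBelow ht] at hx ⊢
  obtain ⟨hx1, hx2⟩ := hx
  set a := last x - t with ha
  have ha0 : 0 < a := by linarith
  have hne : ‖e‖ = 1 := by
    have := norm_point_sq (0 : EuclideanSpace ℝ (Fin m)) 1
    rw [← he] at this
    have h0 := norm_nonneg e
    norm_num at this
    rcases this with h | h <;> linarith
  have hd : ∀ s : ℝ, HasDerivAt (fun s : ℝ => v (x - s • e)) (-(fderiv ℝ v (x - s • e) e)) s := by
    intro s
    have h1 : HasFDerivAt v (fderiv ℝ v (x - s • e)) (x - s • e) :=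
      (hv.differentiable (by simp) _).hasFDerivAt
    have h2 : HasDerivAt (fun s : ℝ => x - s • e) (-e) s := by
      simpa using ((hasDerivAt_id s).smul_const e).const_sub x
    simpa [Function.comp_def] using h1.comp_hasDerivAt s h2
  have hcont : Continuous fun s : ℝ => -(fderiv ℝ v (x - s • e) e) := by
    have h1 : Continuous fun s : ℝ => fderiv ℝ v (x - s • e) :=
      (hv.continuous_fderiv (by simp)).comp (by fun_prop)
    exact (h1.clm_apply continuous_const).neg
  have hftc := intervalIntegral.integral_eq_sub_of_hasDerivAt (fun s _ => hd s)
    (hcont.intervalIntegrable 0 a)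
  have hend : v (x - a • e) = 0 := hv0 _ (by simp [he, ha])
  rw [hend, zero_smul, sub_zero, zero_sub, intervalIntegral.integral_of_le ha0.le] at hftc
  have h1 : ‖v x‖ₑ ≤ ∫⁻ s in Ioc 0 a, ‖∇ v (x - s • e)‖ₑ := by
    rw [← enorm_neg, ← hftc]
    refine (enorm_integral_le_lintegral_enorm _).trans (lintegral_mono fun s => ?_)
    rw [enorm_neg, enorm_gradient, ← ofReal_norm, ← ofReal_norm]
    refine ENNReal.ofReal_le_ofReal ?_
    simpa [hne] using (fderiv ℝ v (x - s • e)).le_opNorm e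
  have h2 : ∫⁻ s in Ioc 0 a, ‖∇ v (x - s • e)‖ₑ = ∫⁻ s in Ioo 0 a, ‖∇ v (x - s • e)‖ₑ :=
    setLIntegral_congr Ioo_ae_eq_Ioc.symm
  rw [mul_comm]
  calc _ ≤ ENNReal.ofReal (Real.exp (-κ * last x)) * ∫⁻ s in Ioo 0 a, ‖∇ v (x - s • e)‖ₑ := by
        rw [← h2]; gcongr
    _ = ∫⁻ s in Ioo 0 a, ENNReal.ofReal (Real.exp (-κ * last x)) * ‖∇ v (x - s • e)‖ₑ :=
        (lintegral_const_mul' _ _ ENNReal.ofReal_ne_top).symm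
    _ ≤ ∫⁻ s in Ioo 0 a, ENNReal.ofReal (Real.exp (-κ * s)) *
        indicator {x | ‖head x‖ < 1 ∧ t < last x} (fun y => ‖∇ v y‖ₑ) (x - s • e) := by
        refine setLIntegral_mono' measurableSet_Ioo fun s hs => ?_
        rw [indicator_of_mem]
        · have : Real.exp (-κ * last x) ≤ Real.exp (-κ * s) := by
            rw [Real.exp_le_exp]; nlinarith [hs.2]
          gcongr
        · exact ⟨by simpa [he] using hx1, by simp [he]; linarith [hs.2]⟩
    _ ≤ _ := lintegral_mono_set Ioo_subset_Ioi_self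

/-- The pointwise bound is κ⁻¹ times an average of translates of |∇v|. Jensen, Tonelli and
translation invariance then give the constant κ^{-p}, independent of t. -/
lemma lintegral_rpow_mul_exp_le {p κ t : ℝ} (hp : 1 < p) (hκ : 0 < κ) (ht : 0 ≤ t) {v : Rn m → ℝ}
    (hv : ContDiff ℝ ∞ v) (hv0 : ∀ x, last x ≤ t → v x = 0) :
    ∫⁻ x in cyl m \ cylBelow m t, ‖v x‖ₑ ^ p * ENNReal.ofReal (Real.exp (-p * κ * last x)) ≤
      ENNReal.ofReal (κ⁻¹ ^ p) * ∫⁻ x in cyl m \ cylBelow m t, ‖∇ v x‖ₑ ^ p := by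
  have hp0 : 0 < p := by linarith
  obtain ⟨ν, hν, -, hνf⟩ := exists_isProbabilityMeasure_exp hκ
  set D := cyl m \ cylBelow m t with hD
  have hDm : MeasurableSet D := (isOpen_cyl_diff ht).measurableSet
  set H : Rn m → ℝ≥0∞ := D.indicator fun y => ‖∇ v y‖ₑ with hH
  have hHm : Measurable H := (continuous_gradient hv).enorm.measurable.indicator hDm
  have hpt : ∀ x ∈ D, ‖v x‖ₑ ^ p * ENNReal.ofReal (Real.exp (-p * κ * last x)) ≤
      ENNReal.ofReal (κ⁻¹ ^ p) * ∫⁻ s, H (x - s • point 0 1) ^ p ∂ν := by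
    intro x hx
    have h1 := enorm_mul_exp_le hκ ht hv hv0 hx
    have hms : Measurable fun s : ℝ => H (x - s • point 0 1) := hHm.comp (by fun_prop)
    have h2 : ∫⁻ s in Ioi (0 : ℝ), ENNReal.ofReal (Real.exp (-κ * s)) * H (x - s • point 0 1) =
        ENNReal.ofReal κ⁻¹ * ∫⁻ s, H (x - s • point 0 1) ∂ν := by
      rw [hνf _ hms, ← lintegral_const_mul' _ _ ENNReal.ofReal_ne_top]
      refine lintegral_congr fun s => ?_
      rw [← mul_assoc, ← ENNReal.ofReal_mul (by positivity), inv_mul_cancel_left₀ hκ.ne']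
    rw [h2] at h1
    calc _ = (‖v x‖ₑ * ENNReal.ofReal (Real.exp (-κ * last x))) ^ p := by
          rw [ENNReal.mul_rpow_of_nonneg _ _ hp0.le, ENNReal.ofReal_rpow_of_nonneg (by positivity)
            hp0.le, ← Real.exp_mul]
          ring_nf
      _ ≤ (ENNReal.ofReal κ⁻¹ * ∫⁻ s, H (x - s • point 0 1) ∂ν) ^ p := by gcongr
      _ = ENNReal.ofReal (κ⁻¹ ^ p) * (∫⁻ s, H (x - s • point 0 1) ∂ν) ^ p := by
          rw [ENNReal.mul_rpow_of_nonneg _ _ hp0.le, ENNReal.ofReal_rpow_of_nonneg (by positivity)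
            hp0.le]
      _ ≤ _ := by
          gcongr
          exact lintegral_rpow_le_of_isProbabilityMeasure ν hp hms.aemeasurable
  have hjoint : Measurable fun q : Rn m × ℝ => H (q.1 - q.2 • point 0 1) ^ p :=
    (hHm.comp (by fun_prop)).pow_const p
  calc _ ≤ ∫⁻ x in D, ENNReal.ofReal (κ⁻¹ ^ p) * ∫⁻ s, H (x - s • point 0 1) ^ p ∂ν :=
        setLIntegral_mono' hDm hpt
    _ = ENNReal.ofReal (κ⁻¹ ^ p) * ∫⁻ x in D, ∫⁻ s, H (x - s • point 0 1) ^ p ∂ν :=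
        lintegral_const_mul' _ _ ENNReal.ofReal_ne_top
    _ ≤ ENNReal.ofReal (κ⁻¹ ^ p) * ∫⁻ x, ∫⁻ s, H (x - s • point 0 1) ^ p ∂ν := by
        gcongr; exact Measure.restrict_le_self
    _ = ENNReal.ofReal (κ⁻¹ ^ p) * ∫⁻ s, (∫⁻ x, H (x - s • point 0 1) ^ p) ∂ν := by
        rw [lintegral_lintegral_swap hjoint.aemeasurable]
    _ = ENNReal.ofReal (κ⁻¹ ^ p) * ∫⁻ _ : ℝ, (∫⁻ x, H x ^ p) ∂ν := by
        congr 1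
        refine lintegral_congr fun s => ?_
        exact lintegral_sub_right_eq_self (fun x => H x ^ p) _
    _ = _ := by
        rw [lintegral_const, measure_univ, mul_one, ← lintegral_indicator hDm]
        congr 1
        refine lintegral_congr fun x => ?_
        by_cases hx : x ∈ D
        · simp [hH, hx]
        · simp [hH, hx, hp0]

/-! ### The energy, and approximation by test functions -/

/-- The `p`-th power of `normL` on `G \ Q_t`. -/
def energy (p κ t : ℝ) (v : Rn m → ℝ) (g : Rn m → Rn m) : ℝ≥0∞ :=
  ∫⁻ x in cyl m \ cylBelow m t,
    (‖v x‖ₑ ^ p * ENNReal.ofReal (Real.exp (-p * κ * last x)) + ‖g x‖ₑ ^ p)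

lemma normL_eq (p κ t : ℝ) (v : Rn m → ℝ) (g : Rn m → Rn m) :
    normL p κ (cyl m \ cylBelow m t) v g = energy p κ t v g ^ (1 / p) := rfl

lemma tendsto_normL_iff {p κ t : ℝ} (hp : 1 < p) {v : ℕ → Rn m → ℝ} {g : ℕ → Rn m → Rn m} :
    Tendsto (fun j => normL p κ (cyl m \ cylBelow m t) (v j) (g j)) atTop (𝓝 0) ↔
      Tendsto (fun j => energy p κ t (v j) (g j)) atTop (𝓝 0) := by
  have hp0 : 0 < p := by linarith
  simp only [normL_eq]
  constructor <;> intro h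
  · have := h.ennrpow_const p
    simpa [← ENNReal.rpow_mul, hp0.ne', hp0] using this
  · have := h.ennrpow_const (1 / p)
    rwa [ENNReal.zero_rpow_of_pos (by positivity)] at this

/-- A cutoff equal to one on `last x ≤ R` and to zero on `last x ≥ 2 R`. -/
lemma exists_cutoff : ∃ (L : ℝ) (η : ℝ → Rn m → ℝ), 0 ≤ L ∧ ∀ R : ℝ, 0 < R →
    ContDiff ℝ ∞ (η R) ∧ (∀ x, 0 ≤ η R x ∧ η R x ≤ 1) ∧ (∀ x, |last x| ≤ R → η R x = 1) ∧
      (∀ x, 2 * R ≤ |last x| → η R x = 0) ∧ ∀ x, ‖fderiv ℝ (η R) x‖ ≤ L / R := by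
  let b : ContDiffBump (0 : ℝ) := ⟨1, 2, one_pos, one_lt_two⟩
  obtain ⟨C, hC⟩ := b.contDiff.lipschitzWith_of_hasCompactSupport b.hasCompactSupport
    (n := ∞) (by simp)
  refine ⟨C, fun R x => b (last x / R), C.2, fun R hR => ⟨?_, ?_, ?_, ?_, ?_⟩⟩
  · exact b.contDiff.comp (contDiff_last.div_const R)
  · exact fun x => ⟨b.nonneg, b.le_one⟩
  · intro x hx
    refine b.one_of_mem_closedBall ?_
    rw [mem_closedBall_zero_iff, Real.norm_eq_abs, abs_div, abs_of_pos hR]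
    exact (div_le_one hR).2 hx
  · intro x hx
    refine b.zero_of_le_dist ?_
    rw [dist_zero_right, Real.norm_eq_abs, abs_div, abs_of_pos hR]
    exact (le_div_iff₀ hR).2 hx
  · intro x
    have hl : LipschitzWith (C / R.toNNReal) fun x : Rn m => b (last x / R) := by
      refine LipschitzWith.of_dist_le_mul fun x y => (hC.dist_le_mul _ _).trans ?_
      rw [Real.dist_eq, dist_eq_norm, ← sub_div, abs_div, abs_of_pos hR, ← last_sub]
      rw [NNReal.coe_div, Real.coe_toNNReal _ hR.le]
      rw [← mul_div_assoc, div_mul_eq_mul_div]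
      gcongr
      exact abs_last_le _
    simpa [hR.le] using norm_fderiv_le_of_lipschitz ℝ hl (x₀ := x)

/-- The composition u ∘ T need not have compact support: u may be nonzero at the origin, the image
of the end of the cylinder, and `T` is defined for every x'. Hence two cutoffs, one axial and one
equal to 1 over the closed cross-section. -/
lemma isTest_cutoff {κ t : ℝ} (hκ : 0 < κ) {u : Rn m → ℝ}
    (hu : IsTest (Metric.ball 0 (Real.exp (-κ * t))) u) {η : Rn m → ℝ} (hη : ContDiff ℝ ∞ η)
    {R : ℝ} (hη0 : ∀ x, R ≤ |last x| → η x = 0) :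
    ∃ φ, IsTest (cylBelow m t)ᶜ φ ∧ ∀ x, ‖head x‖ ≤ 1 → φ x = u (T κ x) * η x := by
  let χ : ContDiffBump (0 : EuclideanSpace ℝ (Fin m)) := ⟨1, 2, one_pos, one_lt_two⟩
  refine ⟨fun x => u (T κ x) * η x * χ (head x), ⟨?_, ?_, ?_⟩, fun x hx => ?_⟩
  · exact ((hu.1.comp (contDiff_T κ)).mul hη).mul (χ.contDiff.comp contDiff_head)
  · refine HasCompactSupport.of_support_subset_isCompact
      (isCompact_closedBall (0 : Rn m) (2 + |R|)) fun x hx => ?_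
    rw [Function.mem_support] at hx
    have h1 : |last x| < R := by
      by_contra! h; exact hx (by rw [hη0 x h]; ring)
    have h2 : ‖head x‖ < 2 := by
      by_contra! h
      exact hx (by rw [χ.zero_of_le_dist (by rw [dist_zero_right]; exact h)]; ring)
    rw [mem_closedBall_zero_iff]
    refine abs_le_of_sq_le_sq ?_ (by positivity) |> (le_abs_self _).trans
    rw [norm_sq_eq, ← sq_abs (last x)]
    have h3 := le_abs_self R
    nlinarith [norm_nonneg (head x), abs_nonneg (last x), abs_nonneg R]
  · have h1 : tsupport (fun x => u (T κ x) * η x * χ (head x)) ⊆ T κ ⁻¹' tsupport u := by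
      refine closure_minimal (fun x hx => subset_tsupport u ?_)
        ((isClosed_tsupport u).preimage (contDiff_T κ).continuous)
      rw [Function.mem_support] at hx ⊢
      intro h; exact hx (by rw [h]; ring)
    intro x hx hx'
    have := (T_mem_ball_iff hκ x).1 (hu.2.2 (h1 hx))
    exact absurd hx'.2.2 (not_le.2 this)
  · have : χ (head x) = 1 := χ.one_of_mem_closedBall (mem_closedBall_zero_iff.2 hx)
    simp [this]

lemma eq_zero_of_last_le {κ t : ℝ} (hκ : 0 < κ) {u : Rn m → ℝ}
    (hu : IsTest (Metric.ball 0 (Real.exp (-κ * t))) u) {x : Rn m} (hx : last x ≤ t) :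
    u (T κ x) = 0 := by
  by_contra h
  have := (T_mem_ball_iff hκ x).1 (hu.2.2 (subset_tsupport u h))
  linarith

/-- Cut off at height R. The terms carrying 1 - η tend to zero by dominated convergence, the
majorant being integrable by the Hardy inequality. The term v ∇η is O(1/R) on a slab of volume O(R),
so its p-th power integrates to O(R^{1-p}), which tends to zero because p > 1. -/
lemma exists_isTest_energy_sub_le {p κ t : ℝ} (hp : 1 < p) (hκ : 0 < κ) (ht : 0 ≤ t) {u : Rn m → ℝ}
    (hu : IsTest (Metric.ball 0 (Real.exp (-κ * t))) u)
    (hfin : ∫⁻ x in cyl m \ cylBelow m t, ‖∇ (fun x => u (T κ x)) x‖ₑ ^ p < ⊤)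
    {θ : ℝ≥0∞} (hθ : 0 < θ) :
    ∃ φ, IsTest (cylBelow m t)ᶜ φ ∧ energy p κ t (fun x => φ x - u (T κ x))
      (fun x => ∇ φ x - ∇ (fun x => u (T κ x)) x) ≤ θ := by
  have hp0 : 0 < p := by linarith
  set v : Rn m → ℝ := fun x => u (T κ x) with hv
  have hvs : ContDiff ℝ ∞ v := hu.1.comp (contDiff_T κ)
  set D := cyl m \ cylBelow m t with hD
  have hDo : IsOpen D := isOpen_cyl_diff ht
  obtain ⟨M, hM0, hM⟩ : ∃ M : ℝ, 0 ≤ M ∧ ∀ x, ‖v x‖ ≤ M := by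
    obtain ⟨M, hM⟩ := hu.2.1.exists_bound_of_continuous hu.1.continuous
    exact ⟨M, (norm_nonneg _).trans (hM 0), fun x => hM _⟩
  obtain ⟨L, η, hL, hη⟩ := exists_cutoff (m := m)
  have hR : ∀ k : ℕ, 0 < (k : ℝ) + 1 := fun k => by positivity
  choose φ hφt hφ using fun k : ℕ => isTest_cutoff hκ hu (hη _ (hR k)).1
    (hη _ (hR k)).2.2.2.1
  set h : Rn m → ℝ≥0∞ := fun x => ‖v x‖ₑ ^ p * ENNReal.ofReal (Real.exp (-p * κ * last x)) +
    2 ^ (p - 1) * ‖∇ v x‖ₑ ^ p with hh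
  set A : ℕ → Rn m → ℝ≥0∞ := fun k x => h x * ‖1 - η (k + 1) x‖ₑ ^ p with hA
  set B : ℕ → Rn m → ℝ≥0∞ := fun k => indicator {x | last x ≤ 2 * (k + 1)}
    fun _ => 2 ^ (p - 1) * ENNReal.ofReal ((M * (L / (k + 1))) ^ p) with hB
  have hgm : Measurable fun x => ‖∇ v x‖ₑ ^ p :=
    (continuous_gradient hvs).enorm.measurable.pow_const p
  have hvm : Measurable fun x => ‖v x‖ₑ ^ p * ENNReal.ofReal (Real.exp (-p * κ * last x)) := by
    refine (hvs.continuous.enorm.measurable.pow_const p).mul ?_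
    exact (Real.continuous_exp.comp (continuous_const.mul
      continuous_last)).measurable.ennreal_ofReal
  have hhm : Measurable h := hvm.add (hgm.const_mul _)
  have hAm : ∀ k, Measurable (A k) := fun k => hhm.mul
    ((continuous_const.sub (hη _ (hR k)).1.continuous).enorm.measurable.pow_const p)
  have hpt : ∀ k, ∀ x ∈ D, ‖φ k x - v x‖ₑ ^ p * ENNReal.ofReal (Real.exp (-p * κ * last x)) +
      ‖∇ (φ k) x - ∇ v x‖ₑ ^ p ≤ A k x + B k x := by
    intro k x hx
    have hx' := hx
    rw [hD, cyl_diff_cylBelow ht] at hx'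
    have h1 : φ k =ᶠ[𝓝 x] fun x => v x * η (k + 1) x := by
      filter_upwards [hDo.mem_nhds hx] with y hy
      rw [hD, cyl_diff_cylBelow ht] at hy
      exact hφ k y hy.1.le
    have h2 : ‖φ k x - v x‖ₑ = ‖v x‖ₑ * ‖1 - η (k + 1) x‖ₑ := by
      rw [h1.eq_of_nhds, ← enorm_mul, ← enorm_neg]; ring_nf
    have h3 : ‖∇ (φ k) x - ∇ v x‖ₑ ≤ ‖∇ v x‖ₑ * ‖1 - η (k + 1) x‖ₑ +
        ENNReal.ofReal (M * ‖fderiv ℝ (η (k + 1)) x‖) := by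
      rw [← ofReal_norm, ← ofReal_norm, ← ofReal_norm, norm_gradient_sub, norm_gradient,
        ← ENNReal.ofReal_mul (norm_nonneg _), ← ENNReal.ofReal_add (by positivity) (by positivity)]
      refine ENNReal.ofReal_le_ofReal ?_
      rw [h1.fderiv_eq, fderiv_fun_mul (hvs.differentiable (by simp) x)
        ((hη _ (hR k)).1.differentiable (by simp) x)]
      have : v x • fderiv ℝ (η (↑k + 1)) x + η (↑k + 1) x • fderiv ℝ v x - fderiv ℝ v x =
          v x • fderiv ℝ (η (↑k + 1)) x - (1 - η (↑k + 1) x) • fderiv ℝ v x := by module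
      rw [this]
      refine (norm_sub_le _ _).trans ?_
      rw [norm_smul, norm_smul, add_comm, mul_comm ‖1 - _‖]
      gcongr
      exact hM x
    have h4 : ENNReal.ofReal (M * ‖fderiv ℝ (η (k + 1)) x‖) ^ p * 2 ^ (p - 1) ≤ B k x := by
      simp only [hB, indicator]
      split_ifs with hl
      · rw [mul_comm, ENNReal.ofReal_rpow_of_nonneg (by positivity) hp0.le]
        have := (hη _ (hR k)).2.2.2.2 x
        gcongr
      · simp only [mem_ofPred_eq, not_le] at hl
        have h5 : η (k + 1) =ᶠ[𝓝 x] fun _ => 0 := by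
          filter_upwards [(isOpen_lt continuous_const continuous_last).mem_nhds hl] with y hy
          exact (hη _ (hR k)).2.2.2.1 y ((le_of_lt hy).trans (le_abs_self _))
        rw [h5.fderiv_eq]
        simp [hp0]
    calc _ ≤ (‖v x‖ₑ * ‖1 - η (k + 1) x‖ₑ) ^ p * ENNReal.ofReal (Real.exp (-p * κ * last x)) +
          (‖∇ v x‖ₑ * ‖1 - η (k + 1) x‖ₑ +
            ENNReal.ofReal (M * ‖fderiv ℝ (η (k + 1)) x‖)) ^ p := by rw [h2]; gcongr
      _ ≤ (‖v x‖ₑ * ‖1 - η (k + 1) x‖ₑ) ^ p * ENNReal.ofReal (Real.exp (-p * κ * last x)) +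
          2 ^ (p - 1) * ((‖∇ v x‖ₑ * ‖1 - η (k + 1) x‖ₑ) ^ p +
            ENNReal.ofReal (M * ‖fderiv ℝ (η (k + 1)) x‖) ^ p) := by
          gcongr; exact rpow_add_le hp _ _
      _ = A k x + ENNReal.ofReal (M * ‖fderiv ℝ (η (k + 1)) x‖) ^ p * 2 ^ (p - 1) := by
          simp only [hA, hh]
          rw [ENNReal.mul_rpow_of_nonneg _ _ hp0.le, ENNReal.mul_rpow_of_nonneg _ _ hp0.le]
          ring
      _ ≤ _ := by gcongr
  have hhfin : ∫⁻ x in D, h x ≠ ⊤ := by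
    simp only [hh]
    rw [lintegral_add_left hvm, lintegral_const_mul _ hgm]
    refine ENNReal.add_ne_top.2 ⟨?_, ENNReal.mul_ne_top (by finiteness) hfin.ne⟩
    exact ((lintegral_rpow_mul_exp_le hp hκ ht hvs fun x hx => eq_zero_of_last_le hκ hu hx).trans_lt
      (ENNReal.mul_lt_top ENNReal.ofReal_lt_top hfin)).ne
  have hAlim : Tendsto (fun k => ∫⁻ x in D, A k x) atTop (𝓝 0) := by
    have : ∫⁻ x in D, (0 : ℝ≥0∞) = 0 := by simp
    rw [← this]
    refine tendsto_lintegral_of_dominated_convergence h hAm ?_ hhfin ?_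
    · refine fun k => Eventually.of_forall fun x => ?_
      simp only [hA]
      refine mul_le_of_le_one_right' (ENNReal.rpow_le_one ?_ hp0.le)
      rw [← ofReal_norm, Real.norm_eq_abs, ← ENNReal.ofReal_one]
      have := (hη _ (hR k)).2.1 x
      exact ENNReal.ofReal_le_ofReal (abs_le.2 ⟨by linarith, by linarith⟩)
    · refine Eventually.of_forall fun x => ?_
      refine tendsto_const_nhds.congr' ?_
      obtain ⟨N, hN⟩ := exists_nat_ge |last x|
      filter_upwards [eventually_ge_atTop N] with k hk
      have : |last x| ≤ k + 1 := by
        have : (N : ℝ) ≤ k := by exact_mod_cast hk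
        linarith
      simp [hA, (hη _ (hR k)).2.2.1 x this, hp0]
  have hBle : ∀ k, ∫⁻ x in D, B k x ≤
      2 ^ (p - 1) * 2 ^ m * ENNReal.ofReal (2 * (M * L) ^ p * ((k : ℝ) + 1) ^ (-(p - 1))) := by
    intro k
    simp only [hB]
    rw [lintegral_indicator_const (isClosed_le continuous_last continuous_const).measurableSet,
      Measure.restrict_apply (isClosed_le continuous_last continuous_const).measurableSet]
    have h1 : volume ({x : Rn m | last x ≤ 2 * (k + 1)} ∩ D) ≤
        2 ^ m * ENNReal.ofReal (2 * (k + 1)) := by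
      refine (measure_mono ?_).trans (volume_slab_le _)
      rintro x ⟨hx1, hx2⟩
      rw [hD, cyl_diff_cylBelow ht] at hx2
      exact ⟨hx2.1, ht.trans_lt hx2.2, hx1⟩
    calc _ ≤ 2 ^ (p - 1) * ENNReal.ofReal ((M * (L / (k + 1))) ^ p) *
          (2 ^ m * ENNReal.ofReal (2 * (k + 1))) := by gcongr
      _ = 2 ^ (p - 1) * 2 ^ m * (ENNReal.ofReal ((M * (L / (k + 1))) ^ p) *
          ENNReal.ofReal (2 * (k + 1))) := by ring
      _ = _ := by
          rw [← ENNReal.ofReal_mul (by positivity)]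
          congr 2
          rw [← mul_div_assoc, Real.div_rpow (by positivity) (by positivity), neg_sub,
            Real.rpow_sub (hR k), Real.rpow_one]
          field_simp
  have hBlim : Tendsto (fun k => ∫⁻ x in D, B k x) atTop (𝓝 0) := by
    refine tendsto_of_tendsto_of_tendsto_of_le_of_le tendsto_const_nhds ?_
      (fun k => zero_le) hBle
    have h1 : Tendsto (fun k : ℕ => ((k : ℝ) + 1) ^ (-(p - 1))) atTop (𝓝 0) :=
      (tendsto_rpow_neg_atTop (by linarith)).comp
        (tendsto_atTop_add_const_right _ _ tendsto_natCast_atTop_atTop)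
    have h2 := ENNReal.tendsto_ofReal (h1.const_mul (2 * (M * L) ^ p))
    rw [mul_zero, ENNReal.ofReal_zero] at h2
    have h3 := ENNReal.Tendsto.const_mul (a := 2 ^ (p - 1) * 2 ^ m) h2 (Or.inr (by finiteness))
    rwa [mul_zero] at h3
  have hlim := hAlim.add hBlim
  rw [add_zero] at hlim
  obtain ⟨k, hk⟩ := (hlim.eventually_lt_const hθ).exists
  refine ⟨φ k, hφt k, le_trans ?_ hk.le⟩
  unfold energy
  rw [← lintegral_add_left (hAm k)]
  exact setLIntegral_mono' hDo.measurableSet (hpt k)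

/-! ### Completeness -/

/-- The pair `(e^{-κ x_n} v, g)`, whose `L ^ p` norm is comparable to `normL`. -/
def weightedPair (κ : ℝ) (v : Rn m → ℝ) (g : Rn m → Rn m) (x : Rn m) : ℝ × Rn m :=
  (Real.exp (-κ * last x) * v x, g x)

lemma enorm_prod_eq_max (a : ℝ × Rn m) : ‖a‖ₑ = max ‖a.1‖ₑ ‖a.2‖ₑ := by
  simp only [enorm_eq_nnnorm, Prod.nnnorm_def, ENNReal.coe_max]

lemma enorm_prod_rpow_le (p : ℝ) (a : ℝ × Rn m) :
    ‖a‖ₑ ^ p ≤ ‖a.1‖ₑ ^ p + ‖a.2‖ₑ ^ p := by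
  rw [enorm_prod_eq_max]
  rcases le_total ‖a.1‖ₑ ‖a.2‖ₑ with h | h
  · rw [max_eq_right h]; exact le_add_self
  · rw [max_eq_left h]; exact le_self_add

lemma le_enorm_prod_rpow {p : ℝ} (hp0 : 0 < p) (a : ℝ × Rn m) :
    ‖a.1‖ₑ ^ p + ‖a.2‖ₑ ^ p ≤ 2 * ‖a‖ₑ ^ p := by
  rw [enorm_prod_eq_max, two_mul]
  gcongr
  · exact le_max_left _ _
  · exact le_max_right _ _

lemma energy_eq {p : ℝ} (hp : 1 < p) (κ t : ℝ) (v : Rn m → ℝ) (g : Rn m → Rn m) :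
    energy p κ t v g = ∫⁻ x in cyl m \ cylBelow m t,
      (‖(weightedPair κ v g x).1‖ₑ ^ p + ‖(weightedPair κ v g x).2‖ₑ ^ p) := by
  have hp0 : 0 < p := by linarith
  unfold energy
  refine lintegral_congr fun x => ?_
  simp only [weightedPair]
  rw [enorm_mul, ENNReal.mul_rpow_of_nonneg _ _ hp0.le, Real.enorm_of_nonneg (Real.exp_pos (-κ * last x)).le,
    ENNReal.ofReal_rpow_of_nonneg (Real.exp_pos _).le hp0.le, ← Real.exp_mul, mul_comm]
  ring_nf

lemma eLpNorm_rpow_eq {p : ℝ} (hp : 1 < p) {α E : Type*} [MeasurableSpace α] (μ : Measure α)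
    [NormedAddCommGroup E] (f : α → E) :
    eLpNorm f (ENNReal.ofReal p) μ ^ p = ∫⁻ x, ‖f x‖ₑ ^ p ∂μ := by
  have hp0 : 0 < p := by linarith
  rw [eLpNorm_eq_lintegral_rpow_enorm_toReal (by simpa using hp0) ENNReal.ofReal_ne_top,
    ENNReal.toReal_ofReal hp0.le, ← ENNReal.rpow_mul, one_div_mul_cancel hp0.ne', ENNReal.rpow_one]

lemma eLpNorm_weightedPair_le {p : ℝ} (hp : 1 < p) (κ t : ℝ) (v : Rn m → ℝ) (g : Rn m → Rn m) :
    eLpNorm (weightedPair κ v g) (ENNReal.ofReal p) (volume.restrict (cyl m \ cylBelow m t)) ^ p ≤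
      energy p κ t v g := by
  rw [eLpNorm_rpow_eq hp, energy_eq hp]
  exact lintegral_mono fun x => enorm_prod_rpow_le p _

lemma energy_le_eLpNorm {p : ℝ} (hp : 1 < p) (κ t : ℝ) (v : Rn m → ℝ) (g : Rn m → Rn m) :
    energy p κ t v g ≤ 2 * eLpNorm (weightedPair κ v g) (ENNReal.ofReal p)
      (volume.restrict (cyl m \ cylBelow m t)) ^ p := by
  rw [eLpNorm_rpow_eq hp, energy_eq hp, ← lintegral_const_mul' _ _ (by simp)]
  exact lintegral_mono fun x => le_enorm_prod_rpow (by linarith) _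

lemma weightedPair_sub (κ : ℝ) (v w : Rn m → ℝ) (g h : Rn m → Rn m) :
    weightedPair κ (fun x => v x - w x) (fun x => g x - h x) =
      weightedPair κ v g - weightedPair κ w h := by
  funext x
  simp [weightedPair, mul_sub]

lemma memLp_weightedPair {p : ℝ≥0∞} (κ : ℝ) {Ω : Set (Rn m)} {φ : Rn m → ℝ} (hφ : IsTest Ω φ)
    (D : Set (Rn m)) : MemLp (weightedPair κ φ (∇ φ)) p (volume.restrict D) := by
  have hc : Continuous (weightedPair κ φ (∇ φ)) := by
    refine Continuous.prodMk ?_ (continuous_gradient hφ.1)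
    exact (Real.continuous_exp.comp (continuous_const.mul continuous_last)).mul hφ.1.continuous
  refine (hc.memLp_of_hasCompactSupport ?_).restrict _
  refine HasCompactSupport.intro hφ.2.1 fun x hx => ?_
  have h1 : φ x = 0 := image_eq_zero_of_notMem_tsupport hx
  have h2 : fderiv ℝ φ x = 0 := fderiv_of_notMem_tsupport ℝ hx
  simp [weightedPair, h1, gradient, h2]

/-- Only ψ has to be supported in Ω: the integrand then vanishes outside Ω, and integration by parts
takes place on the whole space. -/
lemma integral_test_mul_gradient {Ω' Ω : Set (Rn m)} {φ ψ : Rn m → ℝ} (hφ : IsTest Ω' φ)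
    (hψ : IsTest Ω ψ) (i : Fin (m + 1)) :
    ∫ x in Ω, (φ x * (∇ ψ x) i + (∇ φ x) i * ψ x) = 0 := by
  rw [setIntegral_eq_integral_of_forall_compl_eq_zero]
  · simp only [gradient_apply]
    have c1 : ∀ {f : Rn m → ℝ}, ContDiff ℝ ∞ f →
        Continuous fun x => fderiv ℝ f x (EuclideanSpace.single i 1) := fun hf =>
      (hf.continuous_fderiv (by simp)).clm_apply continuous_const
    have i1 : Integrable fun x => fderiv ℝ φ x (EuclideanSpace.single i 1) * ψ x :=
      ((c1 hφ.1).mul hψ.1.continuous).integrable_of_hasCompactSupport hψ.2.1.mul_left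
    have i2 : Integrable fun x => φ x * fderiv ℝ ψ x (EuclideanSpace.single i 1) :=
      (hφ.1.continuous.mul (c1 hψ.1)).integrable_of_hasCompactSupport hφ.2.1.mul_right
    have i3 : Integrable fun x => φ x * ψ x :=
      (hφ.1.continuous.mul hψ.1.continuous).integrable_of_hasCompactSupport hφ.2.1.mul_right
    rw [integral_add i2 i1, integral_mul_fderiv_eq_neg_fderiv_mul_of_integrable i1 i2 i3
      (fun x _ => hφ.1.differentiable (by simp) x) (fun x _ => hψ.1.differentiable (by simp) x)]
    simp
  · intro x hx
    have hx' : x ∉ tsupport ψ := fun h => hx (hψ.2.2 h)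
    have h1 : ψ x = 0 := image_eq_zero_of_notMem_tsupport hx'
    have h2 : fderiv ℝ ψ x = 0 := fderiv_of_notMem_tsupport ℝ hx'
    simp [h1, gradient, h2]

/-- For a fixed ψ the integration by parts identity involves only values on the compact support of
ψ, where the exponential weight is bounded above and below. By Hölder it is continuous under the
weighted L^p convergence. -/
lemma hasWeakGradient_of_tendsto {p κ : ℝ} (hp : 1 < p) {D Ω : Set (Rn m)}
    {φ : ℕ → Rn m → ℝ} (hφ : ∀ j, IsTest Ω (φ j)) {v : Rn m → ℝ} {g : Rn m → Rn m}
    (hL : MemLp (weightedPair κ v g) (ENNReal.ofReal p) (volume.restrict D))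
    (hlim : Tendsto (fun j => eLpNorm (weightedPair κ (φ j) (∇ (φ j)) - weightedPair κ v g)
      (ENNReal.ofReal p) (volume.restrict D)) atTop (𝓝 0)) :
    HasWeakGradient D v g := by
  have hp1 : 1 ≤ ENNReal.ofReal p := ENNReal.one_le_ofReal.2 hp.le
  set μ : Measure (Rn m) := volume.restrict D with hμ
  have hli1 : LocallyIntegrable (fun x => Real.exp (-κ * last x) * v x) μ :=
    (hL.continuousLinearMap_comp (ContinuousLinearMap.fst ℝ ℝ (Rn m))).locallyIntegrable hp1
  have hg : LocallyIntegrable g μ :=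
    (hL.continuousLinearMap_comp (ContinuousLinearMap.snd ℝ ℝ (Rn m))).locallyIntegrable hp1
  have hv : LocallyIntegrable v μ := by
    have hc : Continuous fun x : Rn m => Real.exp (κ * last x) :=
      Real.continuous_exp.comp (continuous_const.mul continuous_last)
    have h1 := (locallyIntegrableOn_univ.2 hli1).continuousOn_mul hc.continuousOn
      isOpen_univ.isLocallyClosed
    rw [locallyIntegrableOn_univ] at h1
    convert h1 using 1
    funext x
    rw [← mul_assoc, ← Real.exp_add]
    simp
  refine ⟨locallyIntegrableOn_of_locallyIntegrable_restrict hv,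
    locallyIntegrableOn_of_locallyIntegrable_restrict hg, fun ψ hψ i => ?_⟩
  have cψ' : Continuous fun x => (∇ ψ x) i := by
    simp only [gradient_apply]
    exact (hψ.1.continuous_fderiv (by simp)).clm_apply continuous_const
  have sψ' : HasCompactSupport fun x => (∇ ψ x) i := by
    refine HasCompactSupport.intro hψ.2.1 fun x hx => ?_
    have h2 : fderiv ℝ ψ x = 0 := fderiv_of_notMem_tsupport ℝ hx
    simp [gradient, h2]
  have hgi : LocallyIntegrable (fun x => g x i) μ :=
    ((hL.continuousLinearMap_comp (ContinuousLinearMap.snd ℝ ℝ (Rn m))).continuousLinearMap_comp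
      (EuclideanSpace.proj i : Rn m →L[ℝ] ℝ)).locallyIntegrable hp1
  have i1 : Integrable (fun x => v x * (∇ ψ x) i) μ :=
    hv.integrable_smul_right_of_hasCompactSupport cψ' sψ'
  have i2 : Integrable (fun x => g x i * ψ x) μ :=
    hgi.integrable_smul_right_of_hasCompactSupport hψ.1.continuous hψ.2.1
  suffices h : ∫ x, (v x * (∇ ψ x) i + g x i * ψ x) ∂μ = 0 by
    rw [integral_add i1 i2] at h; linarith
  set F : ℕ → Rn m → ℝ := fun j x => φ j x * (∇ ψ x) i + (∇ (φ j) x) i * ψ x with hF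
  have hFi : ∀ j, Integrable (F j) μ := by
    intro j
    have c1 : Continuous fun x => (∇ (φ j) x) i := by
      simp only [gradient_apply]
      exact ((hφ j).1.continuous_fderiv (by simp)).clm_apply continuous_const
    refine Integrable.mono_measure (Integrable.add ?_ ?_) Measure.restrict_le_self
    · exact ((hφ j).1.continuous.mul cψ').integrable_of_hasCompactSupport (sψ'.mul_left)
    · exact (c1.mul hψ.1.continuous).integrable_of_hasCompactSupport (hψ.2.1.mul_left)
  obtain ⟨C, hC0, hC⟩ : ∃ C : ℝ, 0 ≤ C ∧ ∀ x,
      ‖|Real.exp (κ * last x) * (∇ ψ x) i| + |ψ x|‖ ≤ C := by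
    have hc : Continuous fun x => |Real.exp (κ * last x) * (∇ ψ x) i| + |ψ x| :=
      ((Real.continuous_exp.comp (continuous_const.mul continuous_last)).mul cψ').abs.add
        hψ.1.continuous.abs
    have hs : HasCompactSupport fun x => |Real.exp (κ * last x) * (∇ ψ x) i| + |ψ x| := by
      refine HasCompactSupport.intro hψ.2.1 fun x hx => ?_
      have h1 : ψ x = 0 := image_eq_zero_of_notMem_tsupport hx
      have h2 : fderiv ℝ ψ x = 0 := fderiv_of_notMem_tsupport ℝ hx
      simp [h1, gradient, h2]
    obtain ⟨C, hC⟩ := hs.exists_bound_of_continuous hc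
    exact ⟨C, (norm_nonneg _).trans (hC 0), hC⟩
  set K := tsupport ψ with hK
  have hKm : MeasurableSet K := (isClosed_tsupport ψ).measurableSet
  set G : ℕ → Rn m → ℝ × Rn m := fun j => weightedPair κ (φ j) (∇ (φ j)) - weightedPair κ v g
    with hG
  have hpt : ∀ j x, ‖F j x - (v x * (∇ ψ x) i + g x i * ψ x)‖ₑ ≤
      K.indicator (fun x => ENNReal.ofReal C * ‖G j x‖ₑ) x := by
    intro j x
    by_cases hx : x ∈ K
    · rw [indicator_of_mem hx, ← ofReal_norm, ← ofReal_norm, ← ENNReal.ofReal_mul hC0]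
      refine ENNReal.ofReal_le_ofReal ?_
      have e1 : F j x - (v x * (∇ ψ x) i + g x i * ψ x) =
          (Real.exp (κ * last x) * (∇ ψ x) i) * (G j x).1 + ψ x * ((G j x).2 i) := by
        have : Real.exp (κ * last x) * Real.exp (-κ * last x) = 1 := by
          rw [← Real.exp_add]; simp
        simp only [hF, hG, weightedPair, Pi.sub_apply, Prod.fst_sub, Prod.snd_sub, PiLp.sub_apply]
        linear_combination (-(φ j x - v x) * (∇ ψ x) i) * this
      have h1 : |(G j x).1| ≤ ‖G j x‖ := by
        simpa using norm_fst_le (G j x)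
      have h2 : |(G j x).2 i| ≤ ‖G j x‖ := by
        simpa using (PiLp.norm_apply_le (G j x).2 i).trans (norm_snd_le (G j x))
      rw [e1, Real.norm_eq_abs]
      refine (abs_add_le _ _).trans ?_
      rw [abs_mul _ (G j x).1, abs_mul (ψ x)]
      calc _ ≤ |Real.exp (κ * last x) * (∇ ψ x) i| * ‖G j x‖ + |ψ x| * ‖G j x‖ := by gcongr
        _ = (|Real.exp (κ * last x) * (∇ ψ x) i| + |ψ x|) * ‖G j x‖ := by ring
        _ ≤ _ := by gcongr; exact (le_abs_self _).trans (hC x)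
    · have h1 : ψ x = 0 := image_eq_zero_of_notMem_tsupport hx
      have h2 : fderiv ℝ ψ x = 0 := fderiv_of_notMem_tsupport ℝ hx
      simp [hF, h1, gradient, h2]
  have hGm : ∀ j, AEStronglyMeasurable (G j) μ := fun j =>
    (memLp_weightedPair (p := 1) κ (hφ j) D).1.sub hL.1
  have hμK : μ K < ⊤ :=
    (Measure.restrict_apply_le _ _).trans_lt hψ.2.1.isCompact.measure_lt_top
  have hle : ∀ j, ∫⁻ x, ‖F j x - (v x * (∇ ψ x) i + g x i * ψ x)‖ₑ ∂μ ≤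
      ENNReal.ofReal C * (eLpNorm (G j) (ENNReal.ofReal p) μ * μ K ^ (1 - 1 / p)) := by
    intro j
    refine (lintegral_mono (hpt j)).trans ?_
    rw [lintegral_indicator hKm, lintegral_const_mul' _ _ ENNReal.ofReal_ne_top,
      ← eLpNorm_one_eq_lintegral_enorm]
    gcongr
    refine (eLpNorm_le_eLpNorm_mul_rpow_measure_univ hp1 (hGm j).restrict).trans ?_
    rw [Measure.restrict_apply_univ, ENNReal.toReal_one, ENNReal.toReal_ofReal (by linarith),
      div_one]
    gcongr
    exact Measure.restrict_le_self
  have hL1 : Tendsto (fun j => ∫⁻ x, ‖F j x - (v x * (∇ ψ x) i + g x i * ψ x)‖ₑ ∂μ) atTop (𝓝 0) := by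
    refine tendsto_of_tendsto_of_tendsto_of_le_of_le tendsto_const_nhds ?_ (fun j => zero_le) hle
    have hfin : μ K ^ (1 - 1 / p) ≠ ⊤ := by
      refine ENNReal.rpow_ne_top_of_nonneg ?_ hμK.ne
      rw [sub_nonneg, div_le_one (by linarith)]; exact hp.le
    have h1 := ENNReal.Tendsto.mul_const hlim (Or.inr hfin)
    have h2 := ENNReal.Tendsto.const_mul h1 (Or.inr (ENNReal.ofReal_ne_top (r := C)))
    simpa using h2
  have hint := tendsto_integral_of_L1 _ (i1.add i2).1 (Eventually.of_forall hFi) hL1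
  have hzero : ∀ j, ∫ x, F j x ∂μ = 0 := fun j => integral_test_mul_gradient (hφ j) hψ i
  simp only [hzero] at hint
  exact (tendsto_nhds_unique hint tendsto_const_nhds)

/-- Completeness of L^p for the weighted pairs; v is recovered from the first component of the limit
by undoing the exponential weight. -/
lemma exists_memLZero_of_cauchy {p κ t : ℝ} (hp : 1 < p)
    {φ : ℕ → Rn m → ℝ} (hφ : ∀ j, IsTest (cylBelow m t)ᶜ (φ j))
    (hc : ∀ θ : ℝ≥0∞, 0 < θ → ∃ N, ∀ i j, N ≤ i → N ≤ j →
      eLpNorm (weightedPair κ (φ i) (∇ (φ i)) - weightedPair κ (φ j) (∇ (φ j)))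
        (ENNReal.ofReal p) (volume.restrict (cyl m \ cylBelow m t)) < θ) :
    ∃ v g, MemLZero p κ (cylBelow m t) v g ∧
      MemLp (weightedPair κ v g) (ENNReal.ofReal p) (volume.restrict (cyl m \ cylBelow m t)) ∧
      Tendsto (fun j => eLpNorm (weightedPair κ (φ j) (∇ (φ j)) - weightedPair κ v g)
        (ENNReal.ofReal p) (volume.restrict (cyl m \ cylBelow m t))) atTop (𝓝 0) := by
  have hp0 : 0 < p := by linarith
  set D := cyl m \ cylBelow m t with hD
  set P := ENNReal.ofReal p with hP
  have hfact : Fact (1 ≤ P) := ⟨ENNReal.one_le_ofReal.2 hp.le⟩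
  have hF : ∀ j, MemLp (weightedPair κ (φ j) (∇ (φ j))) P (volume.restrict D) := fun j =>
    memLp_weightedPair κ (hφ j) D
  have hcs : CauchySeq fun j => (hF j).toLp := by
    refine EMetric.cauchySeq_iff.2 fun θ hθ => ?_
    obtain ⟨N, hN⟩ := hc θ hθ
    exact ⟨N, fun i hi j hj => by rw [Lp.edist_toLp_toLp]; exact hN i j hi hj⟩
  obtain ⟨L, hL⟩ := cauchySeq_tendsto_of_complete hcs
  set v : Rn m → ℝ := fun x => Real.exp (κ * last x) * (L x).1 with hv
  set g : Rn m → Rn m := fun x => (L x).2 with hg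
  have hvg : weightedPair κ v g = L := by
    funext x
    simp only [weightedPair, hv, hg]
    rw [← mul_assoc, ← Real.exp_add]
    simp
  have hLm : MemLp (weightedPair κ v g) P (volume.restrict D) := by rw [hvg]; exact Lp.memLp L
  have hLt : hLm.toLp = L := by
    refine Lp.ext (hLm.coeFn_toLp.trans ?_)
    rw [hvg]
  have hlim : Tendsto (fun j => eLpNorm (weightedPair κ (φ j) (∇ (φ j)) - weightedPair κ v g)
      P (volume.restrict D)) atTop (𝓝 0) := by
    rw [← Lp.tendsto_Lp_iff_tendsto_eLpNorm'' _ hF _ hLm, hLt]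
    exact hL
  refine ⟨v, g, ⟨⟨hasWeakGradient_of_tendsto hp hφ hLm hlim, ?_⟩, φ, hφ, ?_⟩, hLm, hlim⟩
  · rw [normL_eq]
    refine ENNReal.rpow_lt_top_of_nonneg (by positivity) ?_
    refine ne_top_of_le_ne_top ?_ (energy_le_eLpNorm hp κ t v g)
    exact ENNReal.mul_ne_top (by simp) (ENNReal.rpow_ne_top_of_nonneg hp0.le hLm.2.ne)
  · rw [tendsto_normL_iff hp]
    refine tendsto_of_tendsto_of_tendsto_of_le_of_le tendsto_const_nhds ?_ (fun j => zero_le)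
      (fun j => energy_le_eLpNorm hp κ t _ _)
    simp only [weightedPair_sub]
    have h1 := ENNReal.Tendsto.const_mul (hlim.ennrpow_const p) (Or.inr (ENNReal.ofNat_ne_top (n := 2)))
    rwa [ENNReal.zero_rpow_of_pos hp0, mul_zero] at h1

/-! ### The Neumann capacity is bounded by the weighted capacity -/

lemma IsTest.sub {Ω : Set (Rn m)} {u v : Rn m → ℝ} (hu : IsTest Ω u) (hv : IsTest Ω v) :
    IsTest Ω (fun x => u x - v x) :=
  ⟨hu.1.sub hv.1, hu.2.1.sub hv.2.1, (tsupport_sub u v).trans (union_subset hu.2.2 hv.2.2)⟩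

lemma IsTest.midpoint {Ω : Set (Rn m)} {u v : Rn m → ℝ} (hu : IsTest Ω u) (hv : IsTest Ω v) :
    IsTest Ω (fun x => (1 / 2 : ℝ) * (u x + v x)) :=
  ⟨contDiff_const.mul (hu.1.add hv.1), (hu.2.1.add hv.2.1).mul_left,
    (tsupport_mul_subset_right (f := fun _ => (1 / 2 : ℝ))).trans
      ((tsupport_add u v).trans (union_subset hu.2.2 hv.2.2))⟩

lemma gradient_fun_sub {u v : Rn m → ℝ} (hu : ContDiff ℝ ∞ u) (hv : ContDiff ℝ ∞ v) (x : Rn m) :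
    ∇ (fun x => u x - v x) x = ∇ u x - ∇ v x := by
  rw [gradient, gradient, gradient, ← map_sub,
    fderiv_fun_sub (hu.differentiable (by simp) x) (hv.differentiable (by simp) x)]

lemma gradient_midpoint {u v : Rn m → ℝ} (hu : ContDiff ℝ ∞ u) (hv : ContDiff ℝ ∞ v) (x : Rn m) :
    ∇ (fun x => (1 / 2 : ℝ) * (u x + v x)) x = (1 / 2 : ℝ) • (∇ u x + ∇ v x) := by
  have h1 := hu.differentiable (by simp) x
  have h2 := hv.differentiable (by simp) x
  rw [gradient, gradient, gradient, ← map_add, ← fderiv_add h1 h2]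
  rw [show (fun x => (1 / 2 : ℝ) * (u x + v x)) = fun x => (1 / 2 : ℝ) * (u + v) x from rfl,
    fderiv_const_mul (h1.add h2)]
  simp

/-- The measure `w dξ` on the ball of radius `r`. -/
def weightMeasure (m : ℕ) (p r : ℝ) : Measure (Rn m) :=
  (volume.restrict (Metric.ball 0 r)).withDensity fun ξ => ENNReal.ofReal (weight p ξ)

lemma lintegral_weightMeasure {p r : ℝ} {f : Rn m → ℝ≥0∞} (hf : Measurable f) :
    ∫⁻ ξ, f ξ ∂weightMeasure m p r =
      ∫⁻ ξ in Metric.ball 0 r, f ξ * ENNReal.ofReal (weight p ξ) := by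
  rw [weightMeasure, lintegral_withDensity_eq_lintegral_mul _ (measurable_weight p).ennreal_ofReal
    hf]
  simp only [Pi.mul_apply, mul_comm]

lemma wcapCompact_mono {p : ℝ} {w : Rn m → ℝ} {K L Ω : Set (Rn m)} (h : K ⊆ L) :
    wcapCompact p w K Ω ≤ wcapCompact p w L Ω :=
  le_iInf₂ fun v hv => le_iInf fun hL => iInf₂_le_of_le v hv (iInf_le_of_le (fun x hx => hL x (h hx))
    le_rfl)

lemma wcapCompact_le_wcapOpen {p : ℝ} {w : Rn m → ℝ} {K U Ω : Set (Rn m)} (hK : IsCompact K)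
    (h : K ⊆ U) : wcapCompact p w K Ω ≤ wcapOpen p w U Ω :=
  le_iSup₂_of_le K hK (le_iSup_of_le h le_rfl)

/-- Near-minimizers for the capacities of an exhaustion of an open set of finite capacity. -/
lemma exists_minimizing_seq {p r : ℝ} (hp : 1 < p) {U : Set (Rn m)} (hU : IsOpen U)
    (hfin : wcapOpen p (weight p) U (Metric.ball 0 r) ≠ ⊤) :
    ∃ u : ℕ → Rn m → ℝ, (∀ j, IsTest (Metric.ball 0 r) (u j)) ∧
      (∀ ξ ∈ U, ∀ᶠ j in atTop, 1 ≤ u j ξ) ∧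
      (∃ b : ℕ → ℝ≥0∞, Tendsto b atTop (𝓝 (wcapOpen p (weight p) U (Metric.ball 0 r))) ∧
        (∀ j, b j ≠ ⊤) ∧ ∀ j, ∫⁻ ξ, ‖∇ (u j) ξ‖ₑ ^ p ∂weightMeasure m p r ≤ b j) ∧
      ∀ θ : ℝ≥0∞, 0 < θ → ∃ N, ∀ i j, N ≤ i → N ≤ j →
        ∫⁻ ξ, ‖∇ (u i) ξ - ∇ (u j) ξ‖ₑ ^ p ∂weightMeasure m p r ≤ θ := by
  set α := wcapOpen p (weight p) U (Metric.ball 0 r) with hα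
  obtain ⟨K₀, hK₀c, hK₀⟩ : IsSigmaCompact U := by
    have := hU.locallyCompactSpace
    exact isSigmaCompact_iff_sigmaCompactSpace.2 inferInstance
  set K : ℕ → Set (Rn m) := accumulate K₀ with hKdef
  have hKc : ∀ j, IsCompact (K j) := isCompact_accumulate hK₀c
  have hKm : Monotone K := monotone_accumulate
  have hKU : ⋃ j, K j = U := by rw [iUnion_accumulate, hK₀]
  have hKsub : ∀ j, K j ⊆ U := fun j => hKU ▸ subset_iUnion K j
  set c' : ℕ → ℝ≥0∞ := fun j => wcapCompact p (weight p) (K j) (Metric.ball 0 r) with hc'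
  have hc'α : ∀ j, c' j ≤ α := fun j => wcapCompact_le_wcapOpen (hKc j) (hKsub j)
  have hc'fin : ∀ j, c' j ≠ ⊤ := fun j => ne_top_of_le_ne_top hfin (hc'α j)
  set c : ℕ → ℝ := fun j => (c' j).toReal with hc
  have hcm : Monotone c := fun i j hij =>
    ENNReal.toReal_mono (hc'fin j) (wcapCompact_mono (hKm hij))
  have hcα : ∀ j, c j ≤ α.toReal := fun j => ENNReal.toReal_mono hfin (hc'α j)
  have hclim := tendsto_atTop_ciSup hcm ⟨α.toReal, by rintro _ ⟨j, rfl⟩; exact hcα j⟩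
  have hex : ∀ j, ∃ u, IsTest (Metric.ball 0 r) u ∧ (∀ ξ ∈ K j, 1 ≤ u ξ) ∧
      ∫⁻ ξ in Metric.ball 0 r, ‖∇ u ξ‖ₑ ^ p * ENNReal.ofReal (weight p ξ) <
        c' j + ENNReal.ofReal (1 / (j + 1)) := by
    intro j
    have h1 : c' j < c' j + ENNReal.ofReal (1 / (j + 1)) :=
      ENNReal.lt_add_right (hc'fin j) (by simp; positivity)
    simp only [hc', wcapCompact, iInf_lt_iff] at h1
    obtain ⟨u, hu, h2, h3⟩ := h1
    exact ⟨u, hu, h2, h3⟩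
  choose u hut huK hue using hex
  have hmeas : ∀ j, Measurable (∇ (u j)) := fun j => (continuous_gradient (hut j).1).measurable
  have hb : ∀ j, ∫⁻ ξ, ‖∇ (u j) ξ‖ₑ ^ p ∂weightMeasure m p r ≤ ENNReal.ofReal (c j + 1 / (j + 1)) := by
    intro j
    rw [lintegral_weightMeasure ((hmeas j).enorm.pow_const p), ENNReal.ofReal_add
      ENNReal.toReal_nonneg (by positivity), ENNReal.ofReal_toReal (hc'fin j)]
    exact (hue j).le
  have hblim : Tendsto (fun j : ℕ => c j + 1 / ((j : ℝ) + 1)) atTop (𝓝 (⨆ j, c j)) := by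
    simpa using hclim.add tendsto_one_div_add_atTop_nhds_zero_nat
  -- The energy bound refers to the capacity α of U, whereas the Cauchy property uses the limit of
  -- the capacities of the exhaustion. Their equality is not needed.
  refine ⟨u, hut, ?_, ⟨fun j => α + ENNReal.ofReal (1 / (j + 1)), ?_,
    fun j => ENNReal.add_ne_top.2 ⟨hfin, ENNReal.ofReal_ne_top⟩, ?_⟩, ?_⟩
  · intro ξ hξ
    rw [← hKU] at hξ
    obtain ⟨n, hn⟩ := mem_iUnion.1 hξ
    filter_upwards [eventually_ge_atTop n] with j hj
    exact huK j ξ (hKm hj hn)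
  · have h1 := ENNReal.tendsto_ofReal (tendsto_one_div_add_atTop_nhds_zero_nat (𝕜 := ℝ))
    simpa using (tendsto_const_nhds (x := α)).add h1
  · intro j
    rw [lintegral_weightMeasure ((hmeas j).enorm.pow_const p)]
    exact (hue j).le.trans (add_le_add (hc'α j) le_rfl)
  · intro θ hθ
    obtain ⟨s, hs0, hsθ⟩ := ENNReal.lt_iff_exists_nnreal_btwn.1 hθ
    have hs0' : 0 < (s : ℝ) := by exact_mod_cast hs0
    -- For i ≤ j the midpoint of u_i and u_j is at least 1 on the smaller compact set, so it
    -- competes for its capacity.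
    have hmid : ∀ i j, i ≤ j → ENNReal.ofReal (c i) ≤
        ∫⁻ ξ, ‖(1 / 2 : ℝ) • (∇ (u i) ξ + ∇ (u j) ξ)‖ₑ ^ p ∂weightMeasure m p r := by
      intro i j hij
      have ht := (hut i).midpoint (hut j)
      have he : ∀ ξ, ‖(1 / 2 : ℝ) • (∇ (u i) ξ + ∇ (u j) ξ)‖ₑ ^ p =
          ‖∇ (fun x => (1 / 2 : ℝ) * (u i x + u j x)) ξ‖ₑ ^ p := fun ξ => by
        rw [gradient_midpoint (hut i).1 (hut j).1]
      rw [ENNReal.ofReal_toReal (hc'fin i), lintegral_congr he,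
        lintegral_weightMeasure ((continuous_gradient ht.1).enorm.measurable.pow_const p)]
      refine iInf₂_le_of_le _ ht (iInf_le_of_le (fun ξ hξ => ?_) le_rfl)
      have h1 := huK i ξ hξ
      have h2 := huK j ξ (hKm hij hξ)
      linarith
    obtain ⟨N, hN⟩ := cauchy_of_midpoint hp (weightMeasure m p r) hmeas hclim hblim
      (fun j => add_nonneg ENNReal.toReal_nonneg (by positivity)) hb hmid hs0'
    refine ⟨N, fun i j hi hj => ?_⟩
    have hle : ENNReal.ofReal (s : ℝ) ≤ θ := by simpa using hsθ.le
    rcases le_total i j with h | h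
    · exact (hN i j hi h).trans hle
    · refine le_trans (le_of_eq ?_) ((hN j i hj h).trans hle)
      refine lintegral_congr fun ξ => ?_
      rw [← enorm_neg, neg_sub]

lemma lintegral_gradient_comp_T_sub_le {p κ t : ℝ} (hp : 1 < p) (hκ : 0 < κ) (ht : 0 ≤ t)
    {u w : Rn m → ℝ} (hu : ContDiff ℝ ∞ u) (hw : ContDiff ℝ ∞ w) :
    ∫⁻ x in cyl m \ cylBelow m t, ‖∇ (fun x => u (T κ x) - w (T κ x)) x‖ₑ ^ p ≤
      ENNReal.ofReal (pullConst m p κ) *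
        ∫⁻ ξ, ‖∇ u ξ - ∇ w ξ‖ₑ ^ p ∂weightMeasure m p (Real.exp (-κ * t)) := by
  have hd : ContDiff ℝ ∞ fun ξ => u ξ - w ξ := hu.sub hw
  have h1 := lintegral_gradient_comp_T_le hp hκ t hd
  rw [← lintegral_weightMeasure ((continuous_gradient hd).enorm.measurable.pow_const p),
    restrict_cylAbove ht] at h1
  refine h1.trans_eq ?_
  congr 1
  exact lintegral_congr fun ξ => by rw [gradient_fun_sub hu hw]

/-- Both compositions vanish at heights up to t, so the Hardy inequality applies to their difference
and the gradient alone controls the full norm. -/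
lemma eLpNorm_weightedPair_comp_T_sub_le {p κ t : ℝ} (hp : 1 < p) (hκ : 0 < κ) (ht : 0 ≤ t)
    {u w : Rn m → ℝ} (hu : IsTest (Metric.ball 0 (Real.exp (-κ * t))) u)
    (hw : IsTest (Metric.ball 0 (Real.exp (-κ * t))) w) :
    eLpNorm (weightedPair κ (fun x => u (T κ x)) (∇ fun x => u (T κ x)) -
      weightedPair κ (fun x => w (T κ x)) (∇ fun x => w (T κ x))) (ENNReal.ofReal p)
        (volume.restrict (cyl m \ cylBelow m t)) ^ p ≤
      ENNReal.ofReal ((κ⁻¹ ^ p + 1) * pullConst m p κ) *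
        ∫⁻ ξ, ‖∇ u ξ - ∇ w ξ‖ₑ ^ p ∂weightMeasure m p (Real.exp (-κ * t)) := by
  have huT : ContDiff ℝ ∞ fun x => u (T κ x) := hu.1.comp (contDiff_T κ)
  have hwT : ContDiff ℝ ∞ fun x => w (T κ x) := hw.1.comp (contDiff_T κ)
  rw [← weightedPair_sub]
  refine (eLpNorm_weightedPair_le hp κ t _ _).trans ?_
  simp only [← gradient_fun_sub huT hwT]
  have hd : ContDiff ℝ ∞ fun x => u (T κ x) - w (T κ x) := huT.sub hwT
  unfold energy
  rw [lintegral_add_right _ ((continuous_gradient hd).enorm.measurable.pow_const p)]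
  have h1 := lintegral_rpow_mul_exp_le hp hκ ht hd fun x hx => by
    rw [eq_zero_of_last_le hκ hu hx, eq_zero_of_last_le hκ hw hx, sub_zero]
  calc _ ≤ (ENNReal.ofReal (κ⁻¹ ^ p) + 1) *
        ∫⁻ x in cyl m \ cylBelow m t, ‖∇ (fun x => u (T κ x) - w (T κ x)) x‖ₑ ^ p := by
        rw [add_mul, one_mul]; gcongr
    _ ≤ (ENNReal.ofReal (κ⁻¹ ^ p) + 1) * (ENNReal.ofReal (pullConst m p κ) *
        ∫⁻ ξ, ‖∇ u ξ - ∇ w ξ‖ₑ ^ p ∂weightMeasure m p (Real.exp (-κ * t))) := by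
        gcongr; exact lintegral_gradient_comp_T_sub_le hp hκ ht hu.1 hw.1
    _ = _ := by
        rw [ENNReal.ofReal_mul (by positivity), ENNReal.ofReal_add (by positivity) zero_le_one,
          ENNReal.ofReal_one, mul_assoc]

/-- The competitor is the limit of the near-minimizers of U composed with `T`. Passing to the limit
makes it at least 1 on the whole open preimage of U, not only on compact parts of it. -/
lemma capCyl_le_wcapOpen {p κ t : ℝ} (hp : 1 < p) (hκ : 0 < κ) (ht : 0 ≤ t) {E U : Set (Rn m)}
    (hU : IsOpen U) (hEU : sym κ E ⊆ U) :
    capCyl p κ t E ≤ ENNReal.ofReal (pullConst m p κ) *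
      wcapOpen p (weight p) U (Metric.ball 0 (Real.exp (-κ * t))) := by
  have hp0 : 0 < p := by linarith
  set r := Real.exp (-κ * t) with hr
  by_cases hfin : wcapOpen p (weight p) U (Metric.ball 0 r) = ⊤
  · rw [hfin, ENNReal.mul_top (by simpa using pullConst_pos m p hκ)]
    exact le_top
  obtain ⟨u, hut, huU, ⟨b, hb, hbt, hub⟩, hcau⟩ := exists_minimizing_seq hp hU hfin
  set D := cyl m \ cylBelow m t with hD
  set μ : Measure (Rn m) := volume.restrict D with hμ
  set P := ENNReal.ofReal p with hP
  have hP1 : 1 ≤ P := ENNReal.one_le_ofReal.2 hp.le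
  set v : ℕ → Rn m → ℝ := fun j x => u j (T κ x) with hv
  have hvs : ∀ j, ContDiff ℝ ∞ (v j) := fun j => (hut j).1.comp (contDiff_T κ)
  have hvb : ∀ j, ∫⁻ x in D, ‖∇ (v j) x‖ₑ ^ p ≤ ENNReal.ofReal (pullConst m p κ) * b j := by
    intro j
    rw [hD, ← restrict_cylAbove ht]
    refine (lintegral_gradient_comp_T_le hp hκ t (hut j).1).trans ?_
    gcongr
    rw [← lintegral_weightMeasure ((continuous_gradient (hut j).1).enorm.measurable.pow_const p)]
    exact hub j
  have hvfin : ∀ j, ∫⁻ x in D, ‖∇ (v j) x‖ₑ ^ p < ⊤ := fun j =>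
    (hvb j).trans_lt (ENNReal.mul_lt_top ENNReal.ofReal_lt_top (hbt j).lt_top)
  set F : (Rn m → ℝ) → Rn m → ℝ × Rn m := fun w => weightedPair κ w (∇ w) with hF
  have hFc : ∀ {w : Rn m → ℝ}, ContDiff ℝ ∞ w → Continuous (F w) := fun {w} hw =>
    ((Real.continuous_exp.comp (continuous_const.mul continuous_last)).mul hw.continuous).prodMk
      (continuous_gradient hw)
  have hvC : ∀ i j, eLpNorm (F (v i) - F (v j)) P μ ^ p ≤
      ENNReal.ofReal ((κ⁻¹ ^ p + 1) * pullConst m p κ) *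
        ∫⁻ ξ, ‖∇ (u i) ξ - ∇ (u j) ξ‖ₑ ^ p ∂weightMeasure m p r := fun i j =>
    eLpNorm_weightedPair_comp_T_sub_le hp hκ ht (hut i) (hut j)
  have hvcau : ∀ θ : ℝ≥0∞, 0 < θ → ∃ N, ∀ i j, N ≤ i → N ≤ j →
      eLpNorm (F (v i) - F (v j)) P μ ≤ θ := by
    intro θ hθ
    set C : ℝ≥0∞ := ENNReal.ofReal ((κ⁻¹ ^ p + 1) * pullConst m p κ) with hC
    have hC0 : C ≠ 0 := by
      have := pullConst_pos m p hκ
      rw [hC, Ne, ENNReal.ofReal_eq_zero, not_le]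
      positivity
    obtain ⟨N, hN⟩ := hcau (θ ^ p / C)
      (ENNReal.div_pos (ENNReal.rpow_pos_of_nonneg hθ hp0.le).ne' ENNReal.ofReal_ne_top)
    refine ⟨N, fun i j hi hj => ?_⟩
    rw [← ENNReal.rpow_le_rpow_iff hp0]
    refine (hvC i j).trans ((mul_le_mul_right (hN i j hi hj) _).trans ?_)
    rw [ENNReal.mul_div_cancel hC0 ENNReal.ofReal_ne_top]
  -- The functions v_j are not test functions on the cylinder side. Replacing them by nearby ones
  -- keeps the sequence Cauchy and puts the limit in the completion.
  have hex : ∀ j : ℕ, ∃ φ, IsTest (cylBelow m t)ᶜ φ ∧ eLpNorm (F φ - F (v j)) P μ ≤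
      ENNReal.ofReal (1 / (j + 1)) := by
    intro j
    have hj : 0 < ENNReal.ofReal (1 / ((j : ℝ) + 1)) := ENNReal.ofReal_pos.2 (by positivity)
    obtain ⟨φ, hφ, h1⟩ := exists_isTest_energy_sub_le hp hκ ht (hut j) (hvfin j)
      (ENNReal.rpow_pos_of_nonneg hj hp0.le)
    refine ⟨φ, hφ, ?_⟩
    rw [← ENNReal.rpow_le_rpow_iff hp0, hF]
    simp only [← weightedPair_sub]
    exact (eLpNorm_weightedPair_le hp κ t _ _).trans h1
  choose φ hφt hφ using hex
  have hsm : Tendsto (fun j : ℕ => ENNReal.ofReal (1 / ((j : ℝ) + 1))) atTop (𝓝 0) := by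
    simpa using ENNReal.tendsto_ofReal (tendsto_one_div_add_atTop_nhds_zero_nat (𝕜 := ℝ))
  have hmeasF : ∀ {w w' : Rn m → ℝ}, ContDiff ℝ ∞ w → ContDiff ℝ ∞ w' →
      AEStronglyMeasurable (F w - F w') μ := fun hw hw' =>
    ((hFc hw).sub (hFc hw')).aestronglyMeasurable
  obtain ⟨w, g, hwg, hwL, hlim⟩ := exists_memLZero_of_cauchy (κ := κ) hp hφt (fun θ hθ => by
    -- Three quarters go to the triangle inequality; the fourth makes the final inequality strict.
    have h4 : 0 < θ / 4 := ENNReal.div_pos hθ.ne' (by simp)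
    by_cases hθt : θ = ⊤
    · refine ⟨0, fun i j _ _ => hθt ▸ ?_⟩
      exact ((memLp_weightedPair κ (hφt i) D).sub (memLp_weightedPair κ (hφt j) D)).2
    obtain ⟨N, hN⟩ := hvcau (θ / 4) h4
    obtain ⟨N', hN'⟩ := (hsm.eventually_le_const h4).exists_forall_of_atTop
    refine ⟨max N N', fun i j hi hj => ?_⟩
    have h1 : weightedPair κ (φ i) (∇ (φ i)) - weightedPair κ (φ j) (∇ (φ j)) =
        (F (φ i) - F (v i)) + ((F (v i) - F (v j)) + (F (v j) - F (φ j))) := by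
      simp only [hF]; abel
    rw [h1]
    have e1 := eLpNorm_add_le (hmeasF (hφt i).1 (hvs i))
      ((hmeasF (hvs i) (hvs j)).add (hmeasF (hvs j) (hφt j).1)) hP1
    have e2 := eLpNorm_add_le (hmeasF (hvs i) (hvs j)) (hmeasF (hvs j) (hφt j).1) hP1
    have e3 := (hφ i).trans (hN' i ((le_max_right _ _).trans hi))
    have e4 := (hφ j).trans (hN' j ((le_max_right _ _).trans hj))
    rw [eLpNorm_sub_comm] at e4
    have e5 := hN i j ((le_max_left _ _).trans hi) ((le_max_left _ _).trans hj)
    calc _ ≤ θ / 4 + (θ / 4 + θ / 4) := e1.trans (add_le_add e3 (e2.trans (add_le_add e5 e4)))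
      _ < θ / 4 + (θ / 4 + θ / 4) + θ / 4 := by
          refine ENNReal.lt_add_right ?_ h4.ne'
          have : θ / 4 ≠ ⊤ := ENNReal.div_ne_top hθt (by simp)
          finiteness
      _ = 4 * (θ / 4) := by ring
      _ = θ := ENNReal.mul_div_cancel (by simp) (by simp))
  have hmeasW : ∀ {w' : Rn m → ℝ}, ContDiff ℝ ∞ w' →
      AEStronglyMeasurable (F w' - weightedPair κ w g) μ := fun hw' =>
    (hFc hw').aestronglyMeasurable.sub hwL.1
  have hvlim : Tendsto (fun j => eLpNorm (F (v j) - weightedPair κ w g) P μ) atTop (𝓝 0) := by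
    have h0 := hsm.add hlim
    rw [add_zero] at h0
    refine tendsto_of_tendsto_of_tendsto_of_le_of_le tendsto_const_nhds h0 (fun j => zero_le)
      fun j => ?_
    have h1 : F (v j) - weightedPair κ w g =
        (F (v j) - F (φ j)) + (F (φ j) - weightedPair κ w g) := by abel
    rw [h1]
    refine (eLpNorm_add_le (hmeasF (hvs j) (hφt j).1) (hmeasW (hφt j).1) hP1).trans ?_
    rw [eLpNorm_sub_comm]
    exact add_le_add (hφ j) le_rfl
  -- Each point of U eventually enters the exhaustion, so the bound 1 survives along a subsequence
  -- converging almost everywhere.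
  have hge : ∀ᵐ x, x ∈ cylAbove m t ∩ T κ ⁻¹' U → 1 ≤ w x := by
    have hmeas := tendstoInMeasure_of_tendsto_eLpNorm (by simpa [hP] using hp0)
      (fun j => (hFc (hvs j)).aestronglyMeasurable) hwL.1 hvlim
    obtain ⟨ns, hns, hae⟩ := hmeas.exists_seq_tendsto_ae
    rw [← restrict_cylAbove ht, ae_restrict_iff' (measurableSet_cylAbove t)] at hae
    filter_upwards [hae] with x hx hxU
    have h1 := (continuous_fst.tendsto _).comp (hx hxU.1)
    have h2 : ∀ᶠ i in atTop, Real.exp (-κ * last x) ≤ (F (v (ns i)) x).1 := by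
      filter_upwards [hns.tendsto_atTop.eventually (huU _ hxU.2)] with i hi
      simp only [hF, weightedPair, hv]
      exact le_mul_of_one_le_right (Real.exp_pos _).le hi
    have h3 := ge_of_tendsto h1 h2
    simp only [weightedPair] at h3
    exact (le_mul_iff_one_le_right (Real.exp_pos _)).1 h3
  refine iInf₂_le_of_le w g (iInf₂_le_of_le hwg ⟨T κ ⁻¹' U,
    hU.preimage (contDiff_T κ).continuous, fun x hx => hEU (Or.inl ⟨x, hx, rfl⟩), hge⟩ ?_)
  rw [restrict_cylAbove ht, ← eLpNorm_rpow_eq hp]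
  have hgm : AEStronglyMeasurable g μ := hwL.1.snd
  have h1 : ∀ j, eLpNorm g P μ ≤ eLpNorm (F (v j) - weightedPair κ w g) P μ +
      (ENNReal.ofReal (pullConst m p κ) * b j) ^ (1 / p) := by
    intro j
    have e1 : g = (g - ∇ (v j)) + ∇ (v j) := by abel
    have e2 : eLpNorm (g - ∇ (v j)) P μ ≤ eLpNorm (F (v j) - weightedPair κ w g) P μ := by
      rw [eLpNorm_sub_comm]
      exact eLpNorm_mono fun x => norm_snd_le (F (v j) x - weightedPair κ w g x)
    have e3 : eLpNorm (∇ (v j)) P μ ≤ (ENNReal.ofReal (pullConst m p κ) * b j) ^ (1 / p) := by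
      rw [← ENNReal.rpow_le_rpow_iff hp0, eLpNorm_rpow_eq hp, ← ENNReal.rpow_mul,
        one_div_mul_cancel hp0.ne', ENNReal.rpow_one]
      exact hvb j
    have hgv : AEStronglyMeasurable (∇ (v j)) μ := (continuous_gradient (hvs j)).aestronglyMeasurable
    calc eLpNorm g P μ = eLpNorm ((g - ∇ (v j)) + ∇ (v j)) P μ := by rw [← e1]
      _ ≤ _ := (eLpNorm_add_le (hgm.sub hgv) hgv hP1).trans (add_le_add e2 e3)
  have h2 := hvlim.add ((ENNReal.Tendsto.const_mul hb
    (Or.inr (ENNReal.ofReal_ne_top (r := pullConst m p κ)))).ennrpow_const (1 / p))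
  rw [zero_add] at h2
  have h3 := ge_of_tendsto' h2 h1
  rw [← ENNReal.rpow_le_rpow_iff hp0, ← ENNReal.rpow_mul, one_div_mul_cancel hp0.ne',
    ENNReal.rpow_one] at h3
  exact h3

/-! ### Mollification with a variable radius -/

/-- A smooth probability density supported in the unit ball. -/
def stdBump (m : ℕ) : ContDiffBump (0 : Rn m) := ⟨1 / 2, 1, by norm_num, by norm_num⟩

/-- The probability measure with density `stdBump`. -/
def bumpMeasure (m : ℕ) : Measure (Rn m) :=
  volume.withDensity fun z => ENNReal.ofReal ((stdBump m).normed volume z)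

instance : IsProbabilityMeasure (bumpMeasure m) := by
  constructor
  rw [bumpMeasure, withDensity_apply _ MeasurableSet.univ, Measure.restrict_univ,
    ← ofReal_integral_eq_lintegral_ofReal (stdBump m).integrable_normed
      (Eventually.of_forall (stdBump m).nonneg_normed), (stdBump m).integral_normed,
    ENNReal.ofReal_one]

lemma bumpMeasure_absolutelyContinuous : bumpMeasure m ≪ volume :=
  withDensity_absolutelyContinuous _ _

lemma measurable_bump : Measurable fun z : Rn m => ENNReal.ofReal ((stdBump m).normed volume z) :=
  (stdBump m).continuous_normed.measurable.ennreal_ofReal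

lemma norm_le_one_ae : ∀ᵐ z ∂bumpMeasure m, ‖z‖ ≤ 1 := by
  rw [bumpMeasure, ae_withDensity_iff measurable_bump]
  refine Eventually.of_forall fun z hz => ?_
  by_contra! h
  refine hz ?_
  have : (stdBump m).normed volume z = 0 := by
    rw [← Function.notMem_support, (stdBump m).support_normed_eq, mem_ball_zero_iff, not_lt]
    exact h.le
  rw [this, ENNReal.ofReal_zero]

/-- The average of `ψ` over the ball of radius `ρ ξ` about `ξ`, against a smooth density. -/
def mollify (ρ ψ : Rn m → ℝ) (ξ : Rn m) : ℝ := ∫ z, ψ (ξ - ρ ξ • z) ∂bumpMeasure m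

/-- The dependence on ξ is moved from the argument of ψ to the smooth kernel, so that smoothness of
a convolution with parameter applies although ψ is merely continuous. -/
lemma mollify_eq_convolution {ρ ψ : Rn m → ℝ} {ξ : Rn m} (h : 0 < ρ ξ) :
    mollify ρ ψ ξ = (convolution ψ (fun x => (ρ ξ ^ (m + 1))⁻¹ *
      (stdBump m).normed volume ((ρ ξ)⁻¹ • x)) (ContinuousLinearMap.mul ℝ ℝ) volume) ξ := by
  unfold mollify bumpMeasure convolution
  rw [integral_withDensity_eq_integral_toReal_smul₀ measurable_bump.aemeasurable
    (Eventually.of_forall fun _ => ENNReal.ofReal_lt_top)]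
  have h1 := Measure.integral_comp_smul volume
    (fun x : Rn m => (stdBump m).normed volume ((ρ ξ)⁻¹ • x) * ψ (ξ - x)) (ρ ξ)
  have h2 := integral_sub_left_eq_self (fun t => ψ t * ((ρ ξ ^ (m + 1))⁻¹ *
    (stdBump m).normed volume ((ρ ξ)⁻¹ • (ξ - t)))) volume ξ
  simp only [sub_sub_cancel] at h2
  simp only [smul_smul, inv_mul_cancel₀ h.ne', one_smul, finrank_euclideanSpace,
    Fintype.card_fin, smul_eq_mul] at h1
  simp only [ENNReal.toReal_ofReal ((stdBump m).nonneg_normed _), smul_eq_mul,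
    ContinuousLinearMap.mul_apply']
  rw [← h2, h1, abs_of_pos (by positivity), ← integral_const_mul]
  congr 1
  funext x
  ring

lemma contDiff_mollify {ρ ψ : Rn m → ℝ} (hρ : ContDiff ℝ ∞ ρ) (hρ0 : ∀ ξ, 0 < ρ ξ) {R : ℝ}
    (hR : ∀ ξ, ρ ξ ≤ R) (hψ : Continuous ψ) : ContDiff ℝ ∞ (mollify ρ ψ) := by
  have h : mollify ρ ψ = fun ξ => (convolution ψ (fun x => (ρ ξ ^ (m + 1))⁻¹ *
      (stdBump m).normed volume ((ρ ξ)⁻¹ • x)) (ContinuousLinearMap.mul ℝ ℝ) volume) ξ :=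
    funext fun ξ => mollify_eq_convolution (hρ0 ξ)
  rw [h, ← contDiffOn_univ]
  refine contDiffOn_convolution_right_with_param_comp (n := (⊤ : ℕ∞)) (ContinuousLinearMap.mul ℝ ℝ)
    (g := fun ξ x => (ρ ξ ^ (m + 1))⁻¹ * (stdBump m).normed volume ((ρ ξ)⁻¹ • x))
    contDiffOn_id isOpen_univ (isCompact_closedBall (0 : Rn m) R) ?_ hψ.locallyIntegrable ?_
  · intro ξ x _ hx
    rw [mem_closedBall_zero_iff, not_le] at hx
    have : (stdBump m).normed volume ((ρ ξ)⁻¹ • x) = 0 := by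
      rw [← Function.notMem_support, (stdBump m).support_normed_eq, mem_ball_zero_iff, not_lt,
        norm_smul, norm_inv, Real.norm_eq_abs, abs_of_pos (hρ0 ξ)]
      refine (le_inv_mul_iff₀ (hρ0 ξ)).2 ?_
      have := hR ξ
      change ρ ξ * 1 ≤ _
      linarith
    rw [this, mul_zero]
  · have c1 : ContDiff ℝ ∞ fun q : Rn m × Rn m => ρ q.1 := hρ.comp contDiff_fst
    refine ContDiff.contDiffOn (ContDiff.mul ?_ ?_)
    · exact (c1.pow _).inv fun q => (pow_pos (hρ0 q.1) _).ne'
    · exact (stdBump m).contDiff_normed.comp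
        ((c1.inv fun q => (hρ0 q.1).ne').smul contDiff_snd)

/-! ### Derivatives and weighted energy of the variable-radius averages. -/

section Deriv

variable {ρ ψ : Rn m → ℝ} {K : NNReal}

lemma lipschitz_radius (hρ : ContDiff ℝ ∞ ρ) (hρ' : ∀ ξ, ‖fderiv ℝ ρ ξ‖ ≤ 1 / 2) (ξ η : Rn m) :
    |ρ ξ - ρ η| ≤ 1 / 2 * ‖ξ - η‖ :=
  convex_univ.norm_image_sub_le_of_norm_fderiv_le (𝕜 := ℝ)
    (fun x _ => hρ.differentiable (by simp) x) (fun x _ => hρ' x) (mem_univ _) (mem_univ _)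

/-- Rademacher's theorem, transported by a reflection and a nonzero dilation, which preserve null
sets. -/
lemma ae_differentiableAt_sub_smul (hψ : LipschitzWith K ψ) (ξ : Rn m) {s : ℝ} (hs : s ≠ 0) :
    ∀ᵐ z : Rn m, DifferentiableAt ℝ ψ (ξ - s • z) := by
  have h1 : ∀ᵐ x : Rn m, DifferentiableAt ℝ ψ x := hψ.ae_differentiableAt
  have h2 : ∀ᵐ x : Rn m, DifferentiableAt ℝ ψ (ξ - x) :=
    (Measure.measurePreserving_sub_left volume ξ).quasiMeasurePreserving.ae h1
  rw [ae_iff] at h2 ⊢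
  have := Measure.addHaar_preimage_smul volume hs {x : Rn m | ¬DifferentiableAt ℝ ψ (ξ - x)}
  rwa [h2, mul_zero] at this

/-- Differentiate under the integral sign. The inner map ξ ↦ ξ - ρ(ξ) z has derivative Id - ρ' ⊗ z,
of norm at most 1 + 1/2 when |z| ≤ 1. -/
lemma norm_fderiv_mollify_le (hρ : ContDiff ℝ ∞ ρ) (hρ0 : ∀ ξ, 0 < ρ ξ)
    (hρ' : ∀ ξ, ‖fderiv ℝ ρ ξ‖ ≤ 1 / 2) (hψ : LipschitzWith K ψ) (ξ : Rn m) :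
    ‖fderiv ℝ (mollify ρ ψ) ξ‖ₑ ≤
      ENNReal.ofReal (3 / 2) * ∫⁻ z, ‖fderiv ℝ ψ (ξ - ρ ξ • z)‖ₑ ∂bumpMeasure m := by
  set F' : Rn m → Rn m →L[ℝ] ℝ := fun z => (fderiv ℝ ψ (ξ - ρ ξ • z)).comp
    (ContinuousLinearMap.id ℝ (Rn m) - (fderiv ℝ ρ ξ).smulRight z) with hF'
  have hFm : ∀ η : Rn m, Continuous fun z => ψ (η - ρ η • z) := fun η =>
    hψ.continuous.comp (by fun_prop)
  have hF'm : AEStronglyMeasurable F' (bumpMeasure m) := by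
    have h1 : StronglyMeasurable fun z => fderiv ℝ ψ (ξ - ρ ξ • z) :=
      ((measurable_fderiv ℝ ψ).comp (by fun_prop)).stronglyMeasurable
    have h2 : Continuous fun z => ContinuousLinearMap.id ℝ (Rn m) - (fderiv ℝ ρ ξ).smulRight z :=
      continuous_const.sub ((ContinuousLinearMap.smulRightL ℝ (Rn m) (Rn m) (fderiv ℝ ρ ξ)).continuous)
    have h3 : Continuous fun q : (Rn m →L[ℝ] ℝ) × (Rn m →L[ℝ] Rn m) => q.1.comp q.2 :=
      continuous_fst.clm_comp continuous_snd
    exact h3.comp_aestronglyMeasurable (h1.aestronglyMeasurable.prodMk h2.aestronglyMeasurable)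
  have hlip : ∀ᵐ z ∂bumpMeasure m, LipschitzOnWith (Real.nnabs ((fun _ => (K : ℝ) * (3 / 2)) z))
      (fun η => ψ (η - ρ η • z)) univ := by
    filter_upwards [norm_le_one_ae] with z hz
    refine LipschitzOnWith.of_dist_le_mul fun x _ y _ => ?_
    rw [Real.coe_nnabs, abs_of_nonneg (by positivity), mul_assoc]
    refine (hψ.dist_le_mul _ _).trans ?_
    gcongr
    rw [dist_eq_norm, dist_eq_norm]
    have e : x - ρ x • z - (y - ρ y • z) = (x - y) - (ρ x - ρ y) • z := by module
    rw [e]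
    refine (norm_sub_le _ _).trans ?_
    rw [norm_smul, Real.norm_eq_abs]
    have := lipschitz_radius hρ hρ' x y
    nlinarith [norm_nonneg z, abs_nonneg (ρ x - ρ y)]
  have hint : Integrable (fun z => ψ (ξ - ρ ξ • z)) (bumpMeasure m) := by
    refine Integrable.of_bound (hFm ξ).aestronglyMeasurable (‖ψ ξ‖ + K * ρ ξ) ?_
    filter_upwards [norm_le_one_ae] with z hz
    have h1 := hψ.norm_sub_le (ξ - ρ ξ • z) ξ
    have h2 : ‖ξ - ρ ξ • z - ξ‖ ≤ ρ ξ := by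
      rw [sub_sub_cancel_left, norm_neg, norm_smul, Real.norm_eq_abs, abs_of_pos (hρ0 ξ)]
      exact mul_le_of_le_one_right (hρ0 ξ).le hz
    have h3 : (K : ℝ) * ‖ξ - ρ ξ • z - ξ‖ ≤ K * ρ ξ := by gcongr
    have h4 := norm_sub_norm_le (ψ (ξ - ρ ξ • z)) (ψ ξ)
    linarith
  have hdiff : ∀ᵐ z ∂bumpMeasure m, HasFDerivAt (fun η => ψ (η - ρ η • z)) (F' z) ξ := by
    filter_upwards [bumpMeasure_absolutelyContinuous.ae_le
      (ae_differentiableAt_sub_smul hψ ξ (hρ0 ξ).ne')] with z hz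
    have h1 : HasFDerivAt (fun η => η - ρ η • z)
        (ContinuousLinearMap.id ℝ (Rn m) - (fderiv ℝ ρ ξ).smulRight z) ξ :=
      (hasFDerivAt_id ξ).sub ((hρ.differentiable (by simp) ξ).hasFDerivAt.smul_const z)
    exact HasFDerivAt.comp ξ (f := fun η => η - ρ η • z) hz.hasFDerivAt h1
  have hmain := (hasFDerivAt_integral_of_dominated_loc_of_lip (s := univ) univ_mem
    (Eventually.of_forall fun η => (hFm η).aestronglyMeasurable) hint hF'm hlip
    (integrable_const _) hdiff).2
  have heq : fderiv ℝ (mollify ρ ψ) ξ = ∫ z, F' z ∂bumpMeasure m := hmain.fderiv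
  rw [heq, ← lintegral_const_mul' _ _ ENNReal.ofReal_ne_top]
  refine (enorm_integral_le_lintegral_enorm _).trans (lintegral_mono_ae ?_)
  filter_upwards [norm_le_one_ae] with z hz
  rw [← ofReal_norm, ← ofReal_norm, ← ENNReal.ofReal_mul (by norm_num)]
  refine ENNReal.ofReal_le_ofReal ((ContinuousLinearMap.opNorm_comp_le _ _).trans ?_)
  rw [mul_comm]
  gcongr
  refine (norm_sub_le _ _).trans ?_
  rw [ContinuousLinearMap.norm_smulRight_apply]
  have h1 := hρ' ξ
  have h2 : ‖ContinuousLinearMap.id ℝ (Rn m)‖ ≤ 1 := ContinuousLinearMap.norm_id_le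
  nlinarith [norm_nonneg z, norm_nonneg (fderiv ℝ ρ ξ)]

/-- Since ρ is 1/2-Lipschitz, ξ ↦ ξ - ρ(ξ) z is injective and its derivative shrinks lengths by at
most a factor 2, so its Jacobian is at least 2^{-(m+1)}. -/
lemma lintegral_comp_sub_smul_le (hρ : ContDiff ℝ ∞ ρ) (hρ' : ∀ ξ, ‖fderiv ℝ ρ ξ‖ ≤ 1 / 2)
    {z : Rn m} (hz : ‖z‖ ≤ 1) (h : Rn m → ℝ≥0∞) :
    ∫⁻ ξ, h (ξ - ρ ξ • z) ≤ ENNReal.ofReal (2 ^ (m + 1)) * ∫⁻ ξ, h ξ := by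
  set A : Rn m → Rn m →L[ℝ] Rn m := fun ξ =>
    ContinuousLinearMap.id ℝ (Rn m) - (fderiv ℝ ρ ξ).smulRight z with hA
  have hd : ∀ ξ ∈ univ, HasFDerivWithinAt (fun η => η - ρ η • z) (A ξ) univ ξ := fun ξ _ =>
    ((hasFDerivAt_id ξ).sub
      ((hρ.differentiable (by simp) ξ).hasFDerivAt.smul_const z)).hasFDerivWithinAt
  have hinj : InjOn (fun η => η - ρ η • z) univ := by
    intro x _ y _ hxy
    have e : x - y = (ρ x - ρ y) • z := by
      have : x - ρ x • z = y - ρ y • z := hxy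
      rw [sub_smul, sub_eq_sub_iff_add_eq_add]
      rw [sub_eq_sub_iff_add_eq_add] at this
      rw [this]; abel
    have h1 : ‖x - y‖ ≤ 1 / 2 * ‖x - y‖ := by
      calc ‖x - y‖ = |ρ x - ρ y| * ‖z‖ := by rw [← Real.norm_eq_abs, ← norm_smul, ← e]
        _ ≤ |ρ x - ρ y| * 1 := by gcongr
        _ ≤ _ := by rw [mul_one]; exact lipschitz_radius hρ hρ' x y
    exact sub_eq_zero.1 (norm_le_zero_iff.1 (by linarith [norm_nonneg (x - y)]))
  have hdet : ∀ ξ, (1 / 2 : ℝ) ^ (m + 1) ≤ |(A ξ).det| := by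
    intro ξ
    have := pow_le_abs_det_of_le_norm (A ξ) (c := 1 / 2) (by norm_num) fun v => ?_
    · simpa using this
    · have e : A ξ v = v - (fderiv ℝ ρ ξ v) • z := by simp [hA]
      have h1 := norm_sub_norm_le v ((fderiv ℝ ρ ξ v) • z)
      have h2 : ‖(fderiv ℝ ρ ξ v) • z‖ ≤ 1 / 2 * ‖v‖ := by
        rw [norm_smul]
        calc _ ≤ ‖fderiv ℝ ρ ξ v‖ * 1 := by gcongr
          _ ≤ ‖fderiv ℝ ρ ξ‖ * ‖v‖ := by rw [mul_one]; exact (fderiv ℝ ρ ξ).le_opNorm v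
          _ ≤ _ := by gcongr; exact hρ' ξ
      rw [e]; linarith
  have hcv := lintegral_image_eq_lintegral_abs_det_fderiv_mul volume MeasurableSet.univ hd hinj h
  rw [Measure.restrict_univ] at hcv
  calc ∫⁻ ξ, h (ξ - ρ ξ • z) ≤ ∫⁻ ξ, ENNReal.ofReal (2 ^ (m + 1)) *
        (ENNReal.ofReal |(A ξ).det| * h (ξ - ρ ξ • z)) := by
        refine lintegral_mono fun ξ => ?_
        rw [← mul_assoc, ← ENNReal.ofReal_mul (by positivity)]
        refine le_mul_of_one_le_left' ?_
        rw [← ENNReal.ofReal_one]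
        refine ENNReal.ofReal_le_ofReal ?_
        calc (1 : ℝ) = 2 ^ (m + 1) * (1 / 2) ^ (m + 1) := by rw [← mul_pow]; norm_num
          _ ≤ _ := by gcongr; exact hdet ξ
    _ = ENNReal.ofReal (2 ^ (m + 1)) * ∫⁻ ξ in (fun η => η - ρ η • z) '' univ, h ξ := by
        rw [lintegral_const_mul' _ _ ENNReal.ofReal_ne_top, hcv]
    _ ≤ _ := by gcongr; exact Measure.restrict_le_self

/-- Jensen in z, comparison of the weights at ξ and at the shifted point, then Tonelli and a change
of variables for each z. Comparability is asked only where ψ has nonzero gradient, because it may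
fail near the origin. -/
lemma lintegral_fderiv_mollify_le {p : ℝ} (hp : 1 < p) (hρ : ContDiff ℝ ∞ ρ) (hρ0 : ∀ ξ, 0 < ρ ξ)
    (hρ' : ∀ ξ, ‖fderiv ℝ ρ ξ‖ ≤ 1 / 2) (hψ : LipschitzWith K ψ) {w : Rn m → ℝ≥0∞}
    (hw : Measurable w) {C : ℝ≥0∞} (hC : C ≠ ⊤) (hCw : ∀ ξ z, ‖z‖ ≤ 1 →
      fderiv ℝ ψ (ξ - ρ ξ • z) ≠ 0 → w ξ ≤ C * w (ξ - ρ ξ • z)) :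
    ∫⁻ ξ, ‖fderiv ℝ (mollify ρ ψ) ξ‖ₑ ^ p * w ξ ≤
      ENNReal.ofReal (3 / 2) ^ p * C * ENNReal.ofReal (2 ^ (m + 1)) *
        ∫⁻ ξ, ‖fderiv ℝ ψ ξ‖ₑ ^ p * w ξ := by
  have hp0 : 0 < p := by linarith
  have hfm : Measurable fun ξ => ‖fderiv ℝ ψ ξ‖ₑ ^ p := (measurable_fderiv ℝ ψ).enorm.pow_const p
  have hjoint : Measurable fun q : Rn m × Rn m => q.1 - ρ q.1 • q.2 :=
    (continuous_fst.sub ((hρ.continuous.comp continuous_fst).smul continuous_snd)).measurable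
  have hpt : ∀ ξ, ‖fderiv ℝ (mollify ρ ψ) ξ‖ₑ ^ p * w ξ ≤ ENNReal.ofReal (3 / 2) ^ p * C *
      ∫⁻ z, (‖fderiv ℝ ψ (ξ - ρ ξ • z)‖ₑ ^ p * w (ξ - ρ ξ • z)) ∂bumpMeasure m := by
    intro ξ
    have hmz : Measurable fun z => ‖fderiv ℝ ψ (ξ - ρ ξ • z)‖ₑ :=
      (measurable_fderiv ℝ ψ).enorm.comp (by fun_prop)
    calc _ ≤ (ENNReal.ofReal (3 / 2) * ∫⁻ z, ‖fderiv ℝ ψ (ξ - ρ ξ • z)‖ₑ ∂bumpMeasure m) ^ p * w ξ := by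
          gcongr; exact norm_fderiv_mollify_le hρ hρ0 hρ' hψ ξ
      _ = ENNReal.ofReal (3 / 2) ^ p *
          ((∫⁻ z, ‖fderiv ℝ ψ (ξ - ρ ξ • z)‖ₑ ∂bumpMeasure m) ^ p * w ξ) := by
          rw [ENNReal.mul_rpow_of_nonneg _ _ hp0.le, mul_assoc]
      _ ≤ ENNReal.ofReal (3 / 2) ^ p *
          ((∫⁻ z, ‖fderiv ℝ ψ (ξ - ρ ξ • z)‖ₑ ^ p ∂bumpMeasure m) * w ξ) := by
          gcongr; exact lintegral_rpow_le_of_isProbabilityMeasure _ hp hmz.aemeasurable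
      _ = ENNReal.ofReal (3 / 2) ^ p *
          (∫⁻ z, ‖fderiv ℝ ψ (ξ - ρ ξ • z)‖ₑ ^ p * w ξ ∂bumpMeasure m) := by
          rw [lintegral_mul_const _ (hmz.pow_const p)]
      _ ≤ ENNReal.ofReal (3 / 2) ^ p *
          (∫⁻ z, C * (‖fderiv ℝ ψ (ξ - ρ ξ • z)‖ₑ ^ p * w (ξ - ρ ξ • z)) ∂bumpMeasure m) := by
          gcongr 1
          refine lintegral_mono_ae ?_
          filter_upwards [norm_le_one_ae] with z hz
          by_cases h0 : fderiv ℝ ψ (ξ - ρ ξ • z) = 0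
          · have h0 : ‖fderiv ℝ ψ (ξ - ρ ξ • z)‖ₑ = 0 := by
              rw [← ofReal_norm, h0, norm_zero, ENNReal.ofReal_zero]
            rw [h0, ENNReal.zero_rpow_of_pos hp0, zero_mul]; exact zero_le
          · calc _ ≤ ‖fderiv ℝ ψ (ξ - ρ ξ • z)‖ₑ ^ p * (C * w (ξ - ρ ξ • z)) := by
                  gcongr; exact hCw ξ z hz h0
              _ = _ := by ring
      _ = _ := by rw [lintegral_const_mul' _ _ hC]; ring
  refine (lintegral_mono hpt).trans ?_
  have hc : ENNReal.ofReal (3 / 2) ^ p * C ≠ ⊤ :=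
    ENNReal.mul_ne_top (ENNReal.rpow_ne_top_of_nonneg hp0.le ENNReal.ofReal_ne_top) hC
  rw [lintegral_const_mul' _ _ hc, mul_assoc (_ * C)]
  gcongr 1
  have hm2 : Measurable fun q : Rn m × Rn m =>
      ‖fderiv ℝ ψ (q.1 - ρ q.1 • q.2)‖ₑ ^ p * w (q.1 - ρ q.1 • q.2) := (hfm.mul hw).comp hjoint
  rw [lintegral_lintegral_swap hm2.aemeasurable]
  calc _ ≤ ∫⁻ _ : Rn m, ENNReal.ofReal (2 ^ (m + 1)) *
        (∫⁻ ξ, ‖fderiv ℝ ψ ξ‖ₑ ^ p * w ξ) ∂bumpMeasure m := by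
        refine lintegral_mono_ae ?_
        filter_upwards [norm_le_one_ae] with z hz
        exact lintegral_comp_sub_smul_le hρ hρ' hz (fun ξ => ‖fderiv ℝ ψ ξ‖ₑ ^ p * w ξ)
    _ = _ := by rw [lintegral_const, measure_univ, mul_one]

end Deriv

/-! ### Transplanting functions from the cylinder to the ball -/

/-- The even transplant of `φ` to the punctured ball of radius `e^{-κ t}`, extended by zero. -/
def descend (κ t : ℝ) (φ : Rn m → ℝ) : Rn m → ℝ :=
  ({0}ᶜ ∩ Metric.ball 0 (Real.exp (-κ * t))).indicator fun ξ => φ (unfold κ ξ)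

section Descend

variable {κ t : ℝ} {φ : Rn m → ℝ}

lemma descend_of_mem {ξ : Rn m} (h0 : ξ ≠ 0) (h : ‖ξ‖ < Real.exp (-κ * t)) :
    descend κ t φ ξ = φ (unfold κ ξ) :=
  indicator_of_mem (show ξ ∈ ({0}ᶜ ∩ Metric.ball 0 (Real.exp (-κ * t)) : Set (Rn m)) from
    ⟨h0, mem_ball_zero_iff.2 h⟩) _

lemma of_descend_ne_zero {ξ : Rn m} (h : descend κ t φ ξ ≠ 0) :
    ξ ≠ 0 ∧ ‖ξ‖ < Real.exp (-κ * t) ∧ φ (unfold κ ξ) ≠ 0 := by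
  have h1 := mem_of_indicator_ne_zero h
  have h2 : ‖ξ‖ < Real.exp (-κ * t) := mem_ball_zero_iff.1 h1.2
  exact ⟨h1.1, h2, by rwa [descend_of_mem h1.1 h2] at h⟩

/-- Over the closed cylinder above height t the support of φ is compact. Its greatest height gives
the inner radius; its least height exceeds t, since the support avoids Q_t, and gives the outer one.
-/
lemma exists_annulus (hκ : 0 < κ) (ht : 0 ≤ t) (hφ : IsTest (cylBelow m t)ᶜ φ) :
    ∃ a r₁ : ℝ, 0 < a ∧ r₁ < Real.exp (-κ * t) ∧
      ∀ ξ, descend κ t φ ξ ≠ 0 → 2 * a ≤ ‖ξ‖ ∧ ‖ξ‖ ≤ r₁ := by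
  set K : Set (Rn m) := tsupport φ ∩ {x | ‖head x‖ ≤ 1 ∧ t ≤ last x} with hK
  have hKc : IsCompact K := hφ.2.1.isCompact.inter_right
    ((isClosed_le continuous_head.norm continuous_const).inter
      (isClosed_le continuous_const continuous_last))
  have hmem : ∀ ξ, descend κ t φ ξ ≠ 0 → ξ ≠ 0 ∧ unfold κ ξ ∈ K := by
    intro ξ hξ
    obtain ⟨h0, h1, h2⟩ := of_descend_ne_zero hξ
    exact ⟨h0, subset_tsupport φ h2, norm_head_unfold_le κ ξ, (lt_last_unfold hκ h0 h1).le⟩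
  rcases K.eq_empty_or_nonempty with h | h
  · refine ⟨1, 0, one_pos, Real.exp_pos _, fun ξ hξ => ?_⟩
    have := (hmem ξ hξ).2
    simp [h] at this
  · obtain ⟨x, hx, hmin⟩ := hKc.exists_isMinOn h continuous_last.continuousOn
    obtain ⟨y, hy, hmax⟩ := hKc.exists_isMaxOn h continuous_last.continuousOn
    refine ⟨Real.exp (-κ * last y) / 2, Real.exp (-κ * last x), by positivity, ?_, fun ξ hξ => ?_⟩
    · have h1 : t < last x := by
        by_contra! hle
        exact hφ.2.2 hx.1 ⟨hx.2.1, ht.trans hx.2.2, hle⟩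
      rw [Real.exp_lt_exp]; nlinarith
    · obtain ⟨h0, h1⟩ := hmem ξ hξ
      have h2 : last x ≤ last (unfold κ ξ) := hmin h1
      have h3 : last (unfold κ ξ) ≤ last y := hmax h1
      rw [← exp_last_unfold hκ h0, mul_div_cancel₀ _ two_ne_zero, Real.exp_le_exp, Real.exp_le_exp]
      constructor <;> nlinarith

/-- On a slightly larger annulus `unfold` is Lipschitz. A pair with one point outside it and a
nonzero value at the other is at distance at least d, and boundedness of φ then suffices. -/
lemma exists_lipschitzWith_descend (hκ : 0 < κ) (ht : 0 ≤ t) (hφ : IsTest (cylBelow m t)ᶜ φ) :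
    ∃ K, LipschitzWith K (descend κ t φ) := by
  obtain ⟨a, r₁, ha, hr₁, hsupp⟩ := exists_annulus hκ ht hφ
  obtain ⟨C, hC⟩ := hφ.1.lipschitzWith_of_hasCompactSupport hφ.2.1 (by simp)
  obtain ⟨M, hM⟩ := hφ.2.1.exists_bound_of_continuous hφ.1.continuous
  have hM0 : 0 ≤ M := (norm_nonneg _).trans (hM 0)
  set l := min κ (2 / 5) with hl
  set r := Real.exp (-κ * t) with hr
  set d := min a (r - r₁) with hd
  have hd0 : 0 < d := lt_min ha (by linarith)
  have hout : ∀ ξ, ¬(a ≤ ‖ξ‖ ∧ ‖ξ‖ < r) → descend κ t φ ξ = 0 := by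
    intro ξ h
    by_contra hne
    have := hsupp ξ hne
    exact h ⟨by linarith, by linarith⟩
  have hbd : ∀ ξ, |descend κ t φ ξ| ≤ M := by
    intro ξ
    by_cases h : descend κ t φ ξ = 0
    · rw [h, abs_zero]; exact hM0
    · obtain ⟨h0, h1, -⟩ := of_descend_ne_zero h
      rw [descend_of_mem h0 h1]; exact hM _
  have hone : ∀ ξ η, (a ≤ ‖ξ‖ ∧ ‖ξ‖ < r) → ¬(a ≤ ‖η‖ ∧ ‖η‖ < r) →
      |descend κ t φ ξ - descend κ t φ η| ≤ M / d * ‖ξ - η‖ := by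
    intro ξ η hξ hη
    rw [hout η hη, sub_zero]
    by_cases h : descend κ t φ ξ = 0
    · rw [h, abs_zero]; positivity
    · obtain ⟨h1, h2⟩ := hsupp ξ h
      have h3 : d ≤ ‖ξ - η‖ := by
        rw [not_and_or, not_le, not_lt] at hη
        rcases hη with h' | h'
        · have := norm_sub_norm_le ξ η
          exact (min_le_left _ _).trans (by linarith)
        · have := norm_sub_norm_le η ξ
          rw [norm_sub_rev] at this
          exact (min_le_right _ _).trans (by linarith)
      calc _ ≤ M := hbd ξ
        _ = M / d * d := (div_mul_cancel₀ _ hd0.ne').symm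
        _ ≤ _ := by gcongr
  refine ⟨Real.toNNReal (C / (l * a) + M / d), LipschitzWith.of_dist_le_mul fun ξ η => ?_⟩
  rw [Real.coe_toNNReal _ (by positivity), Real.dist_eq, dist_eq_norm, add_mul]
  have p1 : 0 ≤ C / (l * a) * ‖ξ - η‖ := by positivity
  have p2 : 0 ≤ M / d * ‖ξ - η‖ := by positivity
  by_cases hξ : a ≤ ‖ξ‖ ∧ ‖ξ‖ < r <;> by_cases hη : a ≤ ‖η‖ ∧ ‖η‖ < r
  · have h0 : ξ ≠ 0 := norm_pos_iff.1 (by linarith)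
    have h0' : η ≠ 0 := norm_pos_iff.1 (by linarith)
    rw [descend_of_mem h0 hξ.2, descend_of_mem h0' hη.2]
    have h1 := norm_unfold_sub_le hκ h0 h0'
    have h2 : ‖unfold κ ξ - unfold κ η‖ ≤ ‖ξ - η‖ / (l * a) := by
      rw [le_div_iff₀ (by positivity)]
      refine le_trans ?_ h1
      rw [mul_comm]
      gcongr
      exact le_min hξ.1 hη.1
    have h3 := hC.dist_le_mul (unfold κ ξ) (unfold κ η)
    rw [Real.dist_eq, dist_eq_norm] at h3
    have h4 : (C : ℝ) * ‖unfold κ ξ - unfold κ η‖ ≤ C * (‖ξ - η‖ / (l * a)) := by gcongr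
    have h5 : (C : ℝ) * (‖ξ - η‖ / (l * a)) = C / (l * a) * ‖ξ - η‖ := by ring
    linarith
  · linarith [hone ξ η hξ hη]
  · have := hone η ξ hη hξ
    rw [abs_sub_comm, norm_sub_rev] at this
    linarith
  · rw [hout ξ hξ, hout η hη, sub_zero, abs_zero]; positivity

/-- `unfold` is only Lipschitz across ξ_n = 0, so a local Lipschitz estimate replaces the chain
rule. The factor 2 comes from nearby η with |η| > |ξ|/2; where the transplant is not differentiable,
`fderiv` is 0 by convention. -/
lemma norm_fderiv_descend_le (hκ : 0 < κ) (hφ : ContDiff ℝ ∞ φ) {ξ : Rn m} (h0 : ξ ≠ 0)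
    (h : ‖ξ‖ < Real.exp (-κ * t)) :
    ‖fderiv ℝ (descend κ t φ) ξ‖ ≤
      2 / (min κ (2 / 5) * ‖ξ‖) * ‖fderiv ℝ φ (unfold κ ξ)‖ := by
  set l := min κ (2 / 5) with hl
  have hn : 0 < ‖ξ‖ := norm_pos_iff.2 h0
  by_cases hd : DifferentiableAt ℝ (descend κ t φ) ξ
  swap
  · rw [fderiv_zero_of_not_differentiableAt hd, norm_zero]; positivity
  set A := ‖fderiv ℝ φ (unfold κ ξ)‖ with hA
  have key : ∀ ε > 0, ‖fderiv ℝ (descend κ t φ) ξ‖ ≤ 2 / (l * ‖ξ‖) * (A + ε) := by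
    intro ε hε
    refine hd.hasFDerivAt.le_of_lip' (by positivity) ?_
    have hφd : HasFDerivAt φ (fderiv ℝ φ (unfold κ ξ)) (unfold κ ξ) :=
      (hφ.differentiable (by simp) _).hasFDerivAt
    have hc : ContinuousAt (unfold κ) ξ :=
      (continuousOn_unfold κ).continuousAt (isOpen_compl_singleton.mem_nhds h0)
    have e1 := hc.eventually (hφd.isLittleO.def hε)
    have e2 : ∀ᶠ η in 𝓝 ξ, ‖ξ‖ / 2 < ‖η‖ :=
      continuous_norm.continuousAt.eventually_const_lt (by linarith)
    have e3 : ∀ᶠ η in 𝓝 ξ, ‖η‖ < Real.exp (-κ * t) :=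
      continuous_norm.continuousAt.eventually_lt_const h
    filter_upwards [e1, e2, e3] with η h1 h2 h3
    have h0' : η ≠ 0 := norm_pos_iff.1 (by linarith)
    rw [descend_of_mem h0 h, descend_of_mem h0' h3]
    have h4 := norm_unfold_sub_le hκ h0' h0
    have h5 : ‖unfold κ η - unfold κ ξ‖ ≤ 2 / (l * ‖ξ‖) * ‖η - ξ‖ := by
      rw [div_mul_eq_mul_div, le_div_iff₀ (by positivity)]
      have : l * (‖ξ‖ / 2) * ‖unfold κ η - unfold κ ξ‖ ≤ ‖η - ξ‖ := by
        refine le_trans ?_ h4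
        gcongr
        exact le_min h2.le (by linarith)
      linarith
    have h6 := (fderiv ℝ φ (unfold κ ξ)).le_opNorm (unfold κ η - unfold κ ξ)
    have h7 : ‖φ (unfold κ η) - φ (unfold κ ξ)‖ ≤ (A + ε) * ‖unfold κ η - unfold κ ξ‖ := by
      have := norm_sub_norm_le (φ (unfold κ η) - φ (unfold κ ξ))
        (fderiv ℝ φ (unfold κ ξ) (unfold κ η - unfold κ ξ))
      linarith
    calc _ ≤ (A + ε) * ‖unfold κ η - unfold κ ξ‖ := h7
      _ ≤ (A + ε) * (2 / (l * ‖ξ‖) * ‖η - ξ‖) := by gcongr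
      _ = _ := by ring
  refine le_of_forall_pos_le_add fun ε hε => ?_
  have hq : 0 < 2 / (l * ‖ξ‖) := by positivity
  have := key (ε / (2 / (l * ‖ξ‖))) (by positivity)
  rwa [mul_add, mul_div_cancel₀ _ hq.ne'] at this

end Descend

/-- Weighted integrals over a set covered by the two charts. -/
lemma lintegral_mul_weight_le {κ p : ℝ} (hκ : 0 < κ) {A B : Set (Rn m)} (hA : MeasurableSet A)
    (hA1 : A ⊆ {x | ‖head x‖ ≤ 1})
    (hB : ∀ ξ ∈ B, ξ ≠ 0 → ∃ x ∈ A, ξ = T κ x ∨ ξ = reflect (T κ x)) {q Q : Rn m → ℝ≥0∞}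
    (hq : ∀ x ∈ A, q (T κ x) ≤ Q x) (hq' : ∀ x ∈ A, q (reflect (T κ x)) ≤ Q x) :
    ∫⁻ ξ in B, q ξ * ENNReal.ofReal (weight p ξ) ≤ ENNReal.ofReal (2 * (κ + 2) ^ (m + 1)) *
      ∫⁻ x in A, ENNReal.ofReal (Real.exp (-κ * last x) ^ p) * Q x := by
  have hone : ∀ Φ : Rn m → Rn m, IsPolarChart κ Φ → (∀ x ∈ A, q (Φ x) ≤ Q x) →
      ∫⁻ ξ in Φ '' A, q ξ * ENNReal.ofReal (weight p ξ) ≤ ENNReal.ofReal ((κ + 2) ^ (m + 1)) *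
        ∫⁻ x in A, ENNReal.ofReal (Real.exp (-κ * last x) ^ p) * Q x := by
    intro Φ hΦ hqΦ
    refine (hΦ.lintegral_image_le hκ hA hA1 _).trans ?_
    gcongr 1
    refine setLIntegral_mono' hA fun x hx => ?_
    rw [← hΦ.exp_pow_mul_weight, ENNReal.ofReal_mul (by positivity), mul_assoc,
      mul_comm (ENNReal.ofReal (weight p (Φ x)))]
    gcongr
    exact hqΦ x hx
  have hsub : B ⊆ {0} ∪ (T κ '' A ∪ (fun x => reflect (T κ x)) '' A) := by
    intro ξ hξ
    by_cases h0 : ξ = 0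
    · exact Or.inl h0
    · obtain ⟨x, hx, h | h⟩ := hB ξ hξ h0
      · exact Or.inr (Or.inl ⟨x, hx, h.symm⟩)
      · exact Or.inr (Or.inr ⟨x, hx, h.symm⟩)
  refine (lintegral_mono_set hsub).trans ((lintegral_union_le _ _ _).trans ?_)
  have hzero : ∫⁻ ξ in ({0} : Set (Rn m)), q ξ * ENNReal.ofReal (weight p ξ) = 0 := by
    rw [lintegral_singleton]; simp [weight]
  rw [hzero, zero_add]
  refine (lintegral_union_le _ _ _).trans ?_
  refine (add_le_add (hone _ (isPolarChart_T hκ) hq)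
    (hone _ (isPolarChart_reflect_T hκ) hq')).trans_eq ?_
  rw [← two_mul, ← mul_assoc, ENNReal.ofReal_mul zero_le_two, ENNReal.ofReal_ofNat]

/-! ### Energy and deficit of the transplanted function. -/

section DescendEnergy

variable {κ t p : ℝ}

lemma mem_ball_descend {ξ : Rn m} (hκ : 0 < κ) (h0 : ξ ≠ 0) (h : ‖ξ‖ < Real.exp (-κ * t)) :
    ∃ x ∈ cylAbove m t, x = unfold κ ξ ∧ (ξ = T κ x ∨ ξ = reflect (T κ x)) :=
  ⟨unfold κ ξ, ⟨norm_head_unfold_le κ ξ, lt_last_unfold hκ h0 h⟩, rfl, eq_T_or_eq_reflect_T hκ h0⟩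

lemma T_ne_zero (κ : ℝ) (x : Rn m) : T κ x ≠ 0 :=
  norm_pos_iff.1 (by rw [norm_T]; positivity)

lemma reflect_T_ne_zero (κ : ℝ) (x : Rn m) : reflect (T κ x) ≠ 0 :=
  norm_pos_iff.1 (by rw [norm_reflect, norm_T]; positivity)

lemma norm_T_lt (hκ : 0 < κ) {x : Rn m} (hx : x ∈ cylAbove m t) :
    ‖T κ x‖ < Real.exp (-κ * t) := by
  have := hx.2
  rw [norm_T, Real.exp_lt_exp]; nlinarith

/-- The constant in `lintegral_fderiv_descend_le`. -/
def pushConst (m : ℕ) (p κ : ℝ) : ℝ := 2 * (κ + 2) ^ (m + 1) * (2 / min κ (2 / 5)) ^ p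

lemma lintegral_fderiv_descend_le (hp : 1 < p) (hκ : 0 < κ) {φ : Rn m → ℝ}
    (hφ : ContDiff ℝ ∞ φ) :
    ∫⁻ ξ in Metric.ball 0 (Real.exp (-κ * t)), ‖fderiv ℝ (descend κ t φ) ξ‖ₑ ^ p *
        ENNReal.ofReal (weight p ξ) ≤
      ENNReal.ofReal (pushConst m p κ) * ∫⁻ x in cylAbove m t, ‖∇ φ x‖ₑ ^ p := by
  have hp0 : 0 < p := by linarith
  set L := 2 / min κ (2 / 5) with hL
  have hbd : ∀ x ∈ cylAbove m t, ∀ ξ : Rn m, ξ ≠ 0 → ‖ξ‖ = Real.exp (-κ * last x) →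
      unfold κ ξ = x → ‖fderiv ℝ (descend κ t φ) ξ‖ₑ ^ p ≤
      ENNReal.ofReal ((L / Real.exp (-κ * last x)) ^ p) * ‖∇ φ x‖ₑ ^ p := by
    intro x hx ξ h0 hn hu
    have h1 := norm_fderiv_descend_le (t := t) hκ hφ h0 (by
      rw [hn, Real.exp_lt_exp]; have := hx.2; nlinarith)
    rw [hu, hn, ← div_div] at h1
    rw [← ENNReal.ofReal_rpow_of_nonneg (by positivity) hp0.le, ← ENNReal.mul_rpow_of_nonneg _ _ hp0.le,
      enorm_gradient, ← ofReal_norm, ← ofReal_norm, ← ENNReal.ofReal_mul (by positivity)]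
    gcongr
  have h := lintegral_mul_weight_le (p := p) hκ (measurableSet_cylAbove t) (cylAbove_subset t)
    (B := Metric.ball 0 (Real.exp (-κ * t))) (q := fun ξ => ‖fderiv ℝ (descend κ t φ) ξ‖ₑ ^ p)
    (Q := fun x => ENNReal.ofReal ((L / Real.exp (-κ * last x)) ^ p) * ‖∇ φ x‖ₑ ^ p)
    (fun ξ hξ h0 => by
      obtain ⟨x, hx, -, h⟩ := mem_ball_descend hκ h0 (mem_ball_zero_iff.1 hξ)
      exact ⟨x, hx, h⟩)
    (fun x hx => hbd x hx _ (T_ne_zero κ x) (norm_T κ x) (unfold_T hκ hx.1))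
    (fun x hx => hbd x hx _ (reflect_T_ne_zero κ x) (by rw [norm_reflect, norm_T])
      (by rw [unfold_reflect, unfold_T hκ hx.1]))
  refine h.trans_eq ?_
  -- The factor e^{-pκ x_n} left by Jacobian and weight cancels the blow-up |ξ|^{-p} of the
  -- transplanted gradient.
  have e : ∀ x : Rn m, ENNReal.ofReal (Real.exp (-κ * last x) ^ p) *
      (ENNReal.ofReal ((L / Real.exp (-κ * last x)) ^ p) * ‖∇ φ x‖ₑ ^ p) =
      ENNReal.ofReal (L ^ p) * ‖∇ φ x‖ₑ ^ p := by
    intro x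
    rw [← mul_assoc, ← ENNReal.ofReal_mul (by positivity), ← Real.mul_rpow (by positivity)
      (by positivity), mul_div_cancel₀ _ (Real.exp_pos _).ne']
  simp only [e]
  rw [lintegral_const_mul' _ _ ENNReal.ofReal_ne_top, ← mul_assoc, ← ENNReal.ofReal_mul (by positivity)]
  rfl

/-- Where v ≥ 1, the deficit 1 - φ is at most |φ - v|. The weighted L^p distance from φ to v thus
controls how far the transplant falls below 1 on W. -/
lemma lintegral_one_sub_descend_le (hp : 1 < p) (hκ : 0 < κ) {φ v : Rn m → ℝ} {U W : Set (Rn m)}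
    (hU : IsOpen U) (hv : ∀ᵐ x, x ∈ cylAbove m t ∩ U → 1 ≤ v x)
    (hW : ∀ ξ ∈ W, ξ ≠ 0 ∧ ‖ξ‖ < Real.exp (-κ * t) ∧ unfold κ ξ ∈ U) :
    ∫⁻ ξ in W, ENNReal.ofReal (1 - descend κ t φ ξ) ^ p * ENNReal.ofReal (weight p ξ) ≤
      ENNReal.ofReal (2 * (κ + 2) ^ (m + 1)) * ∫⁻ x in cylAbove m t,
        ‖φ x - v x‖ₑ ^ p * ENNReal.ofReal (Real.exp (-p * κ * last x)) := by
  have hAm : MeasurableSet (cylAbove m t ∩ U) := (measurableSet_cylAbove t).inter hU.measurableSet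
  have h := lintegral_mul_weight_le (p := p) (B := W) hκ hAm
    (inter_subset_left.trans (cylAbove_subset t))
    (q := fun ξ => ENNReal.ofReal (1 - descend κ t φ ξ) ^ p)
    (Q := fun x => ENNReal.ofReal (1 - φ x) ^ p)
    (fun ξ hξ h0 => by
      obtain ⟨-, h1, h2⟩ := hW ξ hξ
      obtain ⟨x, hx, rfl, h⟩ := mem_ball_descend hκ h0 h1
      exact ⟨_, ⟨hx, h2⟩, h⟩)
    (fun x hx => by
      rw [descend_of_mem (T_ne_zero κ x) (norm_T_lt hκ hx.1), unfold_T hκ hx.1.1])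
    (fun x hx => by
      rw [descend_of_mem (reflect_T_ne_zero κ x) (by rw [norm_reflect]; exact norm_T_lt hκ hx.1),
        unfold_reflect, unfold_T hκ hx.1.1])
  refine h.trans ?_
  gcongr 1
  refine le_trans ?_ (lintegral_mono_set (inter_subset_left (t := U)))
  refine lintegral_mono_ae ((ae_restrict_iff' hAm).2 ?_)
  filter_upwards [hv] with x hx hxU
  have h1 : Real.exp (-κ * last x) ^ p = Real.exp (-p * κ * last x) := by
    rw [← Real.exp_mul]; ring_nf
  rw [h1, mul_comm]
  gcongr
  rw [← ofReal_norm, Real.norm_eq_abs, abs_sub_comm]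
  exact ENNReal.ofReal_le_ofReal ((sub_le_sub_right (hx hxU) _).trans (le_abs_self _))

end DescendEnergy

/-! ### The weighted capacity is bounded by the Neumann capacity -/

lemma weight_le_of_comparable (p : ℝ) {ξ ζ : Rn m} (hζ : ζ ≠ 0) (h1 : ‖ξ‖ ≤ 2 * ‖ζ‖)
    (h2 : ‖ζ‖ ≤ 2 * ‖ξ‖) : weight p ξ ≤ 2 ^ |p - ((m : ℝ) + 1)| * weight p ζ := by
  have hζ0 : 0 < ‖ζ‖ := norm_pos_iff.2 hζ
  have hξ0 : 0 < ‖ξ‖ := by linarith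
  rw [weight_of_ne hζ, weight_of_ne (norm_pos_iff.1 hξ0)]
  set q := p - ((m : ℝ) + 1)
  rcases le_total 0 q with hq | hq
  · rw [abs_of_nonneg hq, ← Real.mul_rpow zero_le_two hζ0.le]
    exact Real.rpow_le_rpow hξ0.le h1 hq
  · have h3 : ‖ζ‖ / 2 ≤ ‖ξ‖ := by linarith
    refine (Real.rpow_le_rpow_of_nonpos (by positivity) h3 hq).trans_eq ?_
    rw [abs_of_nonpos hq, Real.div_rpow hζ0.le zero_le_two, Real.rpow_neg zero_le_two]
    ring

/-- Data for the averaging radius, fixed before any approximating function is chosen. The conditions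
on ε serve, in order, the Lipschitz bound on the radius, the comparability of weights, and averages
over K that see only W. -/
lemma exists_cutoff_radius {K W : Set (Rn m)} (hK : IsCompact K) (hW : IsOpen W) (hKW : K ⊆ W)
    (h0 : (0 : Rn m) ∉ W) :
    ∃ (χ : Rn m → ℝ) (ε : ℝ) (K' : Set (Rn m)), ContDiff ℝ ∞ χ ∧ (∀ ξ, 0 ≤ χ ξ ∧ χ ξ ≤ 1) ∧
      (∀ ξ ∈ K, χ ξ = 1) ∧ (∀ ξ, ξ ∉ K' → χ ξ = 0) ∧ IsCompact K' ∧ K' ⊆ W ∧ 0 < ε ∧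
      (∀ ξ, ε * ‖fderiv ℝ χ ξ‖ ≤ 1 / 2) ∧ (∀ ξ ∈ K', 2 * ε ≤ ‖ξ‖) ∧ Metric.cthickening ε K ⊆ W := by
  obtain ⟨K', hK', hKK', hK'W⟩ := exists_compact_between hK hW hKW
  obtain ⟨χ, hχ1, hχ0, hχ⟩ := exists_contMDiffMap_one_nhds_of_subset_interior (n := (⊤ : ℕ∞))
    (modelWithCornersSelf ℝ (Rn m)) hK.isClosed hKK'
  have hχs : ContDiff ℝ ∞ χ := χ.contMDiff.contDiff
  have hχc : HasCompactSupport χ := HasCompactSupport.intro hK' fun x hx => hχ0 x hx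
  obtain ⟨L, hL⟩ := (hχc.fderiv (𝕜 := ℝ)).exists_bound_of_continuous
    (hχs.continuous_fderiv (by simp))
  have hL0 : 0 ≤ L := (norm_nonneg _).trans (hL 0)
  obtain ⟨d₁, hd₁, hd₁W⟩ := hK.exists_cthickening_subset_open hW hKW
  obtain ⟨d₂, hd₂, hd₂K⟩ : ∃ d > 0, ∀ ξ ∈ K', d ≤ ‖ξ‖ := by
    have h1 : K'ᶜ ∈ 𝓝 (0 : Rn m) := hK'.isClosed.isOpen_compl.mem_nhds fun h => h0 (hK'W h)
    obtain ⟨d, hd, hball⟩ := Metric.mem_nhds_iff.1 h1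
    refine ⟨d, hd, fun ξ hξ => ?_⟩
    by_contra! hlt
    exact hball (mem_ball_zero_iff.2 hlt) hξ
  refine ⟨χ, min (min d₁ (d₂ / 2)) (1 / (2 * (L + 1))), K', hχs, fun ξ => hχ ξ,
    fun ξ hξ => hχ1.self_of_nhdsSet ξ hξ, fun ξ hξ => hχ0 ξ hξ, hK', hK'W, by positivity,
    fun ξ => ?_, fun ξ hξ => ?_, ?_⟩
  · calc _ ≤ 1 / (2 * (L + 1)) * (L + 1) := by
          gcongr
          · exact min_le_right _ _
          · linarith [hL ξ]
      _ = 1 / 2 := by field_simp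
  · have h1 : min (min d₁ (d₂ / 2)) (1 / (2 * (L + 1))) ≤ d₂ / 2 :=
      (min_le_left _ _).trans (min_le_right _ _)
    linarith [hd₂K ξ hξ]
  · exact (Metric.cthickening_mono ((min_le_left _ _).trans (min_le_left _ _)) _).trans hd₁W

/-- The constant in `exists_isTest_of_descend`. -/
def smoothConst (m : ℕ) (p κ : ℝ) : ℝ≥0∞ :=
  ENNReal.ofReal (3 / 2) ^ p * ENNReal.ofReal (2 ^ |p - ((m : ℝ) + 1)|) *
    ENNReal.ofReal (2 ^ (m + 1)) * ENNReal.ofReal (pushConst m p κ)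

/-- The radius is ε on K and decreases to δ off K'. Only δ depends on φ, which is what allows ε, and
hence the later pointwise estimate on K, to be uniform along an approximating sequence. -/
lemma exists_isTest_of_descend {p κ t : ℝ} (hp : 1 < p) (hκ : 0 < κ) (ht : 0 ≤ t)
    {χ : Rn m → ℝ} {ε : ℝ} {K K' : Set (Rn m)} (hχ : ContDiff ℝ ∞ χ)
    (hχ01 : ∀ ξ, 0 ≤ χ ξ ∧ χ ξ ≤ 1) (hχ1 : ∀ ξ ∈ K, χ ξ = 1) (hχ0 : ∀ ξ, ξ ∉ K' → χ ξ = 0)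
    (hK' : IsCompact K') (hK'W : K' ⊆ Metric.ball 0 (Real.exp (-κ * t))) (hε : 0 < ε)
    (hεχ : ∀ ξ, ε * ‖fderiv ℝ χ ξ‖ ≤ 1 / 2) (hεK : ∀ ξ ∈ K', 2 * ε ≤ ‖ξ‖) {φ : Rn m → ℝ}
    (hφ : IsTest (cylBelow m t)ᶜ φ) :
    ∃ f, IsTest (Metric.ball 0 (Real.exp (-κ * t))) f ∧
      (∀ ξ ∈ K, f ξ = ∫ z, descend κ t φ (ξ - ε • z) ∂bumpMeasure m) ∧
      ∫⁻ ξ in Metric.ball 0 (Real.exp (-κ * t)), ‖∇ f ξ‖ₑ ^ p * ENNReal.ofReal (weight p ξ) ≤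
        smoothConst m p κ * ∫⁻ x in cylAbove m t, ‖∇ φ x‖ₑ ^ p := by
  have hp0 : 0 < p := by linarith
  obtain ⟨a, r₁, ha, hr₁, hann⟩ := exists_annulus hκ ht hφ
  obtain ⟨L, hL⟩ := exists_lipschitzWith_descend hκ ht hφ
  set ψ := descend κ t φ with hψ
  set r := Real.exp (-κ * t) with hr
  have hts : tsupport ψ ⊆ {ξ | 2 * a ≤ ‖ξ‖ ∧ ‖ξ‖ ≤ r₁} :=
    closure_minimal (fun ξ hξ => hann ξ hξ) ((isClosed_le continuous_const continuous_norm).inter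
      (isClosed_le continuous_norm continuous_const))
  have hψ' : ∀ ζ, fderiv ℝ ψ ζ ≠ 0 → 2 * a ≤ ‖ζ‖ ∧ ‖ζ‖ ≤ r₁ := fun ζ hζ => hts (by
    by_contra h; exact hζ (fderiv_of_notMem_tsupport ℝ h))
  set δ := min ε (min a ((r - r₁) / 2)) with hδ
  have hδ0 : 0 < δ := lt_min hε (lt_min ha (by linarith))
  have hδε : δ ≤ ε := min_le_left _ _
  have hδa : δ ≤ a := (min_le_right _ _).trans (min_le_left _ _)
  have hδr : δ ≤ (r - r₁) / 2 := (min_le_right _ _).trans (min_le_right _ _)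
  set ρ : Rn m → ℝ := fun ξ => δ + (ε - δ) * χ ξ with hρ
  have hρs : ContDiff ℝ ∞ ρ := contDiff_const.add (contDiff_const.mul hχ)
  have hρ0 : ∀ ξ, 0 < ρ ξ := fun ξ => by
    have := mul_nonneg (sub_nonneg.2 hδε) (hχ01 ξ).1
    simp only [hρ]; linarith
  have hρε : ∀ ξ, ρ ξ ≤ ε := fun ξ => by
    have := mul_le_mul_of_nonneg_left (hχ01 ξ).2 (sub_nonneg.2 hδε)
    simp only [hρ]; linarith
  have hρ' : ∀ ξ, ‖fderiv ℝ ρ ξ‖ ≤ 1 / 2 := fun ξ => by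
    have hd := hχ.differentiable (by simp) ξ
    have : fderiv ℝ ρ ξ = (ε - δ) • fderiv ℝ χ ξ := by
      simp only [hρ]
      rw [fderiv_const_add, fderiv_const_mul hd]
    rw [this, norm_smul, Real.norm_eq_abs, abs_of_nonneg (sub_nonneg.2 hδε)]
    refine le_trans ?_ (hεχ ξ)
    gcongr; linarith
  have hsub : ∀ ξ z : Rn m, ‖z‖ ≤ 1 → ‖ρ ξ • z‖ ≤ ρ ξ := fun ξ z hz => by
    rw [norm_smul, Real.norm_eq_abs, abs_of_pos (hρ0 ξ)]
    exact mul_le_of_le_one_right (hρ0 ξ).le hz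
  have hsupp : Function.support (mollify ρ ψ) ⊆ K' ∪ Metric.closedBall 0 (r₁ + δ) := by
    intro ξ hξ
    by_contra hnot
    rw [mem_union, not_or, mem_closedBall_zero_iff, not_le] at hnot
    refine hξ (integral_eq_zero_of_ae ?_)
    filter_upwards [norm_le_one_ae] with z hz
    have h1 : ρ ξ = δ := by simp [hρ, hχ0 ξ hnot.1]
    by_contra hne
    have h2 := (hann _ hne).2
    have h3 := hsub ξ z hz
    have h4 := norm_sub_norm_le ξ (ρ ξ • z)
    rw [h1] at h2 h3 h4
    linarith [hnot.2]
  have hcomp : IsCompact (K' ∪ Metric.closedBall (0 : Rn m) (r₁ + δ)) :=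
    hK'.union (isCompact_closedBall _ _)
  refine ⟨mollify ρ ψ, ⟨contDiff_mollify hρs hρ0 hρε hL.continuous,
    HasCompactSupport.of_support_subset_isCompact hcomp hsupp,
    (closure_minimal hsupp hcomp.isClosed).trans (union_subset hK'W ?_)⟩, fun ξ hξ => ?_, ?_⟩
  · exact Metric.closedBall_subset_ball (by linarith)
  · have : ρ ξ = ε := by simp [hρ, hχ1 ξ hξ]
    rw [mollify, this]
  · have hw := lintegral_fderiv_mollify_le (p := p) hp hρs hρ0 hρ' hL
      (w := fun ξ => ENNReal.ofReal (weight p ξ)) (measurable_weight p).ennreal_ofReal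
      (C := ENNReal.ofReal (2 ^ |p - ((m : ℝ) + 1)|)) ENNReal.ofReal_ne_top (fun ξ z hz hne => by
        have h1 := (hψ' _ hne).1
        have h2 := hsub ξ z hz
        have h3 : ‖ξ‖ ≤ ‖ξ - ρ ξ • z‖ + ρ ξ := by
          have := norm_sub_norm_le ξ (ρ ξ • z); linarith
        have h4 : ‖ξ - ρ ξ • z‖ ≤ ‖ξ‖ + ρ ξ := (norm_sub_le _ _).trans (by linarith)
        rw [← ENNReal.ofReal_mul (by positivity)]
        refine ENNReal.ofReal_le_ofReal
          (weight_le_of_comparable p (norm_pos_iff.1 (by linarith)) ?_ ?_)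
        -- On K' the radius is at most ε ≤ |ξ|/2. Off K' it is δ ≤ a, while the shifted point has
        -- norm at least 2a. Either way the two norms differ by at most a factor 2.
        · by_cases hξ : ξ ∈ K'
          · linarith [hεK ξ hξ, hρε ξ]
          · have : ρ ξ = δ := by simp [hρ, hχ0 ξ hξ]
            linarith
        · by_cases hξ : ξ ∈ K'
          · linarith [hεK ξ hξ, hρε ξ]
          · have : ρ ξ = δ := by simp [hρ, hχ0 ξ hξ]
            linarith)
    have hball : ∫⁻ ξ, ‖fderiv ℝ ψ ξ‖ₑ ^ p * ENNReal.ofReal (weight p ξ) =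
        ∫⁻ ξ in Metric.ball 0 r, ‖fderiv ℝ ψ ξ‖ₑ ^ p * ENNReal.ofReal (weight p ξ) := by
      rw [← lintegral_indicator Metric.isOpen_ball.measurableSet]
      refine lintegral_congr fun ξ => ?_
      by_cases hξ : ξ ∈ Metric.ball 0 r
      · rw [indicator_of_mem hξ]
      · rw [indicator_of_notMem hξ]
        have h0 : ‖fderiv ℝ ψ ξ‖ₑ = 0 := by
          rw [← ofReal_norm, ENNReal.ofReal_eq_zero, norm_le_zero_iff]
          by_contra hne
          exact hξ (mem_ball_zero_iff.2 ((hψ' ξ hne).2.trans_lt hr₁))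
        rw [h0, ENNReal.zero_rpow_of_pos hp0, zero_mul]
    simp only [enorm_gradient]
    refine (setLIntegral_le_lintegral _ _).trans (hw.trans ?_)
    rw [hball, smoothConst, mul_assoc (_ * ENNReal.ofReal (2 ^ (m + 1)))]
    gcongr
    have := lintegral_fderiv_descend_le (t := t) hp hκ hφ.1
    simpa only [enorm_gradient] using this

/-- Jensen, together with a bounded kernel at the fixed scale ε and a weight bounded below on the
compact thickening of K. The constant depends on K and ε but not on ψ. -/
lemma exists_const_one_sub_integral_le {p : ℝ} (hp : 1 < p) {K W : Set (Rn m)} (hK : IsCompact K)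
    (h0 : (0 : Rn m) ∉ W) {ε : ℝ} (hε : 0 < ε) (hεW : Metric.cthickening ε K ⊆ W) :
    ∃ C : ℝ≥0∞, C ≠ ⊤ ∧ ∀ ψ : Rn m → ℝ, Continuous ψ → ∀ ξ ∈ K,
      ENNReal.ofReal (1 - ∫ z, ψ (ξ - ε • z) ∂bumpMeasure m) ^ p ≤
        C * ∫⁻ ζ in W, ENNReal.ofReal (1 - ψ ζ) ^ p * ENNReal.ofReal (weight p ζ) := by
  set K₂ := Metric.cthickening ε K with hK₂
  have hK₂c : IsCompact K₂ := hK.cthickening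
  have hK₂m : MeasurableSet K₂ := hK₂c.isClosed.measurableSet
  obtain ⟨c, hc, hcw⟩ : ∃ c > 0, ∀ ζ ∈ K₂, c ≤ weight p ζ := by
    rcases K₂.eq_empty_or_nonempty with h | h
    · exact ⟨1, one_pos, by simp [h]⟩
    · have hne : ∀ ζ ∈ K₂, ζ ≠ 0 := fun ζ hζ h => h0 (h ▸ hεW hζ)
      have hcont : ContinuousOn (fun ζ : Rn m => ‖ζ‖ ^ (p - ((m : ℝ) + 1))) K₂ :=
        continuous_norm.continuousOn.rpow_const fun ζ hζ => Or.inl (norm_ne_zero_iff.2 (hne ζ hζ))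
      obtain ⟨ζ, hζ, hmin⟩ := hK₂c.exists_isMinOn h hcont
      refine ⟨_, Real.rpow_pos_of_pos (norm_pos_iff.2 (hne ζ hζ)) (p - ((m : ℝ) + 1)),
        fun η hη => ?_⟩
      rw [weight_of_ne (hne η hη)]
      exact hmin hη
  obtain ⟨B, hB⟩ : ∃ B : ℝ, ∀ z : Rn m, ‖(stdBump m).normed volume z‖ ≤ B :=
    (stdBump m).hasCompactSupport_normed.exists_bound_of_continuous (stdBump m).continuous_normed
  refine ⟨ENNReal.ofReal B * ENNReal.ofReal |(ε ^ (m + 1))⁻¹| * ENNReal.ofReal c⁻¹, by finiteness,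
    fun ψ hψ ξ hξ => ?_⟩
  set H : Rn m → ℝ≥0∞ := fun ζ => ENNReal.ofReal (1 - ψ ζ) ^ p with hH
  have hHm : Measurable H := ((continuous_const.sub hψ).measurable.ennreal_ofReal).pow_const p
  have hcz : Continuous fun z => ψ (ξ - ε • z) := hψ.comp (by fun_prop)
  have hint : Integrable (fun z => ψ (ξ - ε • z)) (bumpMeasure m) := by
    obtain ⟨M, hM⟩ := (isCompact_closedBall (0 : Rn m) 1).exists_bound_of_continuousOn
      hcz.continuousOn
    refine Integrable.of_bound hcz.aestronglyMeasurable M ?_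
    filter_upwards [norm_le_one_ae] with z hz
    exact hM z (mem_closedBall_zero_iff.2 hz)
  have e1 : 1 - ∫ z, ψ (ξ - ε • z) ∂bumpMeasure m = ∫ z, (1 - ψ (ξ - ε • z)) ∂bumpMeasure m := by
    rw [integral_sub (integrable_const _) hint]; simp
  have e2 : ENNReal.ofReal (∫ z, (1 - ψ (ξ - ε • z)) ∂bumpMeasure m) ≤
      ∫⁻ z, ENNReal.ofReal (1 - ψ (ξ - ε • z)) ∂bumpMeasure m := by
    have hi : Integrable (fun z => 1 - ψ (ξ - ε • z)) (bumpMeasure m) :=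
      (integrable_const _).sub hint
    rw [integral_eq_lintegral_pos_part_sub_lintegral_neg_part hi]
    refine (ENNReal.ofReal_le_ofReal (sub_le_self _ ENNReal.toReal_nonneg)).trans ?_
    exact ENNReal.ofReal_toReal_le
  have hmz : Measurable fun z => ENNReal.ofReal (1 - ψ (ξ - ε • z)) :=
    (continuous_const.sub hcz).measurable.ennreal_ofReal
  have e3 : ∀ z, ENNReal.ofReal ((stdBump m).normed volume z) * H (ξ - ε • z) ≤
      ENNReal.ofReal B * K₂.indicator H (ξ - ε • z) := by
    intro z
    by_cases hz : ‖z‖ < 1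
    · rw [indicator_of_mem]
      · gcongr
        exact (le_abs_self _).trans (hB z)
      · refine Metric.mem_cthickening_of_dist_le _ ξ _ _ hξ ?_
        rw [dist_eq_norm, sub_sub_cancel_left, norm_neg, norm_smul, Real.norm_eq_abs,
          abs_of_pos hε]
        exact mul_le_of_le_one_right hε.le hz.le
    · have : (stdBump m).normed volume z = 0 := by
        rw [← Function.notMem_support, (stdBump m).support_normed_eq, mem_ball_zero_iff]
        exact hz
      rw [this, ENNReal.ofReal_zero, zero_mul]; exact zero_le
  have hKm : Measurable (K₂.indicator H) := hHm.indicator hK₂m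
  have e4 : ∫⁻ z, K₂.indicator H (ξ - ε • z) =
      ENNReal.ofReal |(ε ^ (m + 1))⁻¹| * ∫⁻ ζ in K₂, H ζ := by
    have hm1 : Measurable fun y => K₂.indicator H (ξ - y) := hKm.comp (by fun_prop)
    have h1 := lintegral_map (μ := (volume : Measure (Rn m))) hm1 (measurable_const_smul ε)
    rw [Measure.map_addHaar_smul volume hε.ne', lintegral_smul_measure,
      lintegral_sub_left_eq_self (fun y => K₂.indicator H y) ξ, lintegral_indicator hK₂m,
      finrank_euclideanSpace, Fintype.card_fin] at h1
    rw [← h1, smul_eq_mul]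
  calc ENNReal.ofReal (1 - ∫ z, ψ (ξ - ε • z) ∂bumpMeasure m) ^ p
      ≤ (∫⁻ z, ENNReal.ofReal (1 - ψ (ξ - ε • z)) ∂bumpMeasure m) ^ p := by rw [e1]; gcongr
    _ ≤ ∫⁻ z, H (ξ - ε • z) ∂bumpMeasure m :=
        lintegral_rpow_le_of_isProbabilityMeasure _ hp hmz.aemeasurable
    _ = ∫⁻ z, ENNReal.ofReal ((stdBump m).normed volume z) * H (ξ - ε • z) := by
        rw [bumpMeasure, lintegral_withDensity_eq_lintegral_mul _ measurable_bump
          (hmz.pow_const p)]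
        rfl
    _ ≤ ∫⁻ z, ENNReal.ofReal B * K₂.indicator H (ξ - ε • z) := lintegral_mono e3
    _ = ENNReal.ofReal B * (ENNReal.ofReal |(ε ^ (m + 1))⁻¹| * ∫⁻ ζ in K₂, H ζ) := by
        rw [lintegral_const_mul' _ _ ENNReal.ofReal_ne_top, e4]
    _ ≤ ENNReal.ofReal B * (ENNReal.ofReal |(ε ^ (m + 1))⁻¹| *
        ∫⁻ ζ in K₂, ENNReal.ofReal c⁻¹ * (H ζ * ENNReal.ofReal (weight p ζ))) := by
        gcongr 2
        refine setLIntegral_mono' hK₂m fun ζ hζ => ?_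
        rw [mul_left_comm, ← ENNReal.ofReal_mul (by positivity)]
        refine le_mul_of_one_le_right' ?_
        rw [← ENNReal.ofReal_one]
        refine ENNReal.ofReal_le_ofReal ?_
        rw [inv_mul_eq_div, one_le_div hc]
        exact hcw ζ hζ
    _ = ENNReal.ofReal B * ENNReal.ofReal |(ε ^ (m + 1))⁻¹| * ENNReal.ofReal c⁻¹ *
        ∫⁻ ζ in K₂, H ζ * ENNReal.ofReal (weight p ζ) := by
        rw [lintegral_const_mul' _ _ ENNReal.ofReal_ne_top]; ring
    _ ≤ _ := by gcongr

/-- The constant in `wcapCompact_le_lintegral`. -/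
def smoothConst' (m : ℕ) (p κ : ℝ) : ℝ≥0∞ := 2 ^ p * smoothConst m p κ * 2 ^ (p - 1)

/-- The constant from the pointwise estimate may depend on K, because it multiplies a quantity
tending to zero; only the K-independent `smoothConst'` survives in the limit. -/
lemma wcapCompact_le_lintegral {p κ t : ℝ} (hp : 1 < p) (hκ : 0 < κ) (ht : 0 ≤ t)
    {v : Rn m → ℝ} {g : Rn m → Rn m} (hvg : MemLZero p κ (cylBelow m t) v g) {U W K : Set (Rn m)}
    (hU : IsOpen U) (hv : ∀ᵐ x, x ∈ cylAbove m t ∩ U → 1 ≤ v x) (hWo : IsOpen W)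
    (hW : ∀ ξ ∈ W, ξ ≠ 0 ∧ ‖ξ‖ < Real.exp (-κ * t) ∧ unfold κ ξ ∈ U) (hK : IsCompact K)
    (hKW : K ⊆ W) :
    wcapCompact p (weight p) K (Metric.ball 0 (Real.exp (-κ * t))) ≤
      smoothConst' m p κ * ∫⁻ x in cylAbove m t, ‖g x‖ₑ ^ p := by
  have hp0 : 0 < p := by linarith
  obtain ⟨⟨⟨-, hgl, -⟩, -⟩, φ, hφ, hlim⟩ := hvg
  rw [tendsto_normL_iff hp] at hlim
  have hgm : AEStronglyMeasurable g (volume.restrict (cylAbove m t)) := by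
    rw [restrict_cylAbove ht]; exact hgl.aestronglyMeasurable
  have hW0 : (0 : Rn m) ∉ W := fun h => (hW 0 h).1 rfl
  obtain ⟨χ, ε, K', hχ, hχ01, hχ1, hχ0, hK', hK'W, hε, hεχ, hεK, hεW⟩ :=
    exists_cutoff_radius hK hWo hKW hW0
  have hK'b : K' ⊆ Metric.ball 0 (Real.exp (-κ * t)) := fun ξ hξ =>
    mem_ball_zero_iff.2 (hW ξ (hK'W hξ)).2.1
  obtain ⟨C, hC, hCK⟩ := exists_const_one_sub_integral_le hp hK hW0 hε hεW
  choose f hft hfK hfe using fun j => exists_isTest_of_descend hp hκ ht hχ hχ01 hχ1 hχ0 hK' hK'b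
    hε hεχ hεK (hφ j)
  set N : ℕ → ℝ≥0∞ := fun j => energy p κ t (fun x => φ j x - v x) (fun x => ∇ (φ j) x - g x) with hN
  have hN1 : ∀ j, ∫⁻ x in cylAbove m t, ‖φ j x - v x‖ₑ ^ p *
      ENNReal.ofReal (Real.exp (-p * κ * last x)) ≤ N j := fun j => by
    rw [restrict_cylAbove ht]; exact lintegral_mono fun x => le_self_add
  have hN2 : ∀ j, ∫⁻ x in cylAbove m t, ‖∇ (φ j) x - g x‖ₑ ^ p ≤ N j := fun j => by
    rw [restrict_cylAbove ht]; exact lintegral_mono fun x => le_add_self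
  have hsmall : Tendsto (fun j => C * (ENNReal.ofReal (2 * (κ + 2) ^ (m + 1)) * N j)) atTop
      (𝓝 0) := by
    have h1 := ENNReal.Tendsto.const_mul hlim
      (Or.inr (ENNReal.ofReal_ne_top (r := 2 * (κ + 2) ^ (m + 1))))
    have h2 := ENNReal.Tendsto.const_mul h1 (Or.inr hC)
    simpa using h2
  have hhalf : (0 : ℝ≥0∞) < ENNReal.ofReal (1 / 2) ^ p :=
    ENNReal.rpow_pos_of_nonneg (ENNReal.ofReal_pos.2 (by norm_num)) hp0.le
  -- Here weighted L^p closeness becomes a uniform lower bound on K. The value 1/2 is repaired below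
  -- by doubling f_j, which costs 2^p in energy.
  have hge : ∀ᶠ j in atTop, ∀ ξ ∈ K, 1 / 2 ≤ f j ξ := by
    filter_upwards [hsmall.eventually_le_const hhalf] with j hj ξ hξ
    obtain ⟨L, hL⟩ := exists_lipschitzWith_descend hκ ht (hφ j)
    have h1 := hCK _ hL.continuous ξ hξ
    rw [← hfK j ξ hξ] at h1
    have h2 := lintegral_one_sub_descend_le (φ := φ j) hp hκ hU hv hW
    have h3 := (h1.trans (mul_le_mul_right (h2.trans (mul_le_mul_right (hN1 j) _)) _)).trans hj
    rw [ENNReal.rpow_le_rpow_iff hp0, ENNReal.ofReal_le_ofReal_iff (by norm_num)] at h3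
    linarith
  have hgrad : ∀ j, ∫⁻ x in cylAbove m t, ‖∇ (φ j) x‖ₑ ^ p ≤
      2 ^ (p - 1) * (N j + ∫⁻ x in cylAbove m t, ‖g x‖ₑ ^ p) := by
    intro j
    have hm : AEMeasurable (fun x => ‖∇ (φ j) x - g x‖ₑ ^ p) (volume.restrict (cylAbove m t)) :=
      (((continuous_gradient (hφ j).1).aestronglyMeasurable.sub hgm).enorm).pow_const p
    calc _ ≤ ∫⁻ x in cylAbove m t, 2 ^ (p - 1) * (‖∇ (φ j) x - g x‖ₑ ^ p + ‖g x‖ₑ ^ p) := by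
          refine lintegral_mono fun x => le_trans ?_ (rpow_add_le hp _ _)
          gcongr
          simpa using enorm_add_le (∇ (φ j) x - g x) (g x)
      _ = 2 ^ (p - 1) * ((∫⁻ x in cylAbove m t, ‖∇ (φ j) x - g x‖ₑ ^ p) +
            ∫⁻ x in cylAbove m t, ‖g x‖ₑ ^ p) := by
          rw [lintegral_const_mul' _ _ (by finiteness), lintegral_add_left' hm]
      _ ≤ _ := by gcongr; exact hN2 j
  have hcap : ∀ᶠ j in atTop, wcapCompact p (weight p) K (Metric.ball 0 (Real.exp (-κ * t))) ≤
      smoothConst' m p κ * (N j + ∫⁻ x in cylAbove m t, ‖g x‖ₑ ^ p) := by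
    filter_upwards [hge] with j hj
    have htest : IsTest (Metric.ball 0 (Real.exp (-κ * t))) (fun x => 2 * f j x) :=
      ⟨contDiff_const.mul (hft j).1, (hft j).2.1.mul_left,
        (tsupport_mul_subset_right (f := fun _ => (2 : ℝ))).trans (hft j).2.2⟩
    refine iInf₂_le_of_le _ htest (iInf_le_of_le (fun ξ hξ => by linarith [hj ξ hξ]) ?_)
    have hgr : ∀ ξ, ‖∇ (fun x => 2 * f j x) ξ‖ₑ ^ p = 2 ^ p * ‖∇ (f j) ξ‖ₑ ^ p := by
      intro ξ
      rw [← ENNReal.mul_rpow_of_nonneg _ _ hp0.le, ← ofReal_norm, ← ofReal_norm, norm_gradient,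
        norm_gradient, fderiv_const_mul ((hft j).1.differentiable (by simp) ξ), norm_smul,
        ENNReal.ofReal_mul (norm_nonneg _)]
      simp
    simp only [hgr, mul_assoc]
    rw [lintegral_const_mul' _ _ (by finiteness), smoothConst', mul_assoc, mul_assoc]
    gcongr 1
    exact (hfe j).trans (mul_le_mul_right (hgrad j) _)
  have hlim2 : Tendsto (fun j => smoothConst' m p κ * (N j + ∫⁻ x in cylAbove m t, ‖g x‖ₑ ^ p))
      atTop (𝓝 (smoothConst' m p κ * (0 + ∫⁻ x in cylAbove m t, ‖g x‖ₑ ^ p))) := by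
    refine ENNReal.Tendsto.const_mul (hlim.add tendsto_const_nhds) (Or.inr ?_)
    unfold smoothConst' smoothConst
    finiteness
  rw [zero_add] at hlim2
  exact ge_of_tendsto hlim2 hcap

lemma wcap_le_capCyl {p κ t : ℝ} (hp : 1 < p) (hκ : 0 < κ) (ht : 0 ≤ t) {E : Set (Rn m)}
    (hE : E ⊆ cylAbove m t) {C : ℝ} (hC : 0 < C) (hC' : smoothConst' m p κ ≤ ENNReal.ofReal C) :
    wcap p (weight p) (sym κ E) (Metric.ball 0 (Real.exp (-κ * t))) ≤
      ENNReal.ofReal C * capCyl p κ t E := by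
  have hC0 : ENNReal.ofReal C ≠ 0 := by simpa using hC
  -- Dividing by the constant isolates the infimum, so that a single admissible v can be fixed.
  rw [mul_comm (ENNReal.ofReal C), ← ENNReal.div_le_iff hC0 ENNReal.ofReal_ne_top]
  refine le_iInf₂ fun v g => le_iInf₂ fun hvg ⟨U, hU, hEU, hv⟩ => ?_
  rw [ENNReal.div_le_iff hC0 ENNReal.ofReal_ne_top, mul_comm _ (ENNReal.ofReal C)]
  -- The symmetric open neighbourhood of `sym κ E` on which the transplant of v should be at least
  -- 1; the origin is removed because `unfold` is continuous only away from it.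
  set W : Set (Rn m) := ({0}ᶜ ∩ unfold κ ⁻¹' U) ∩ Metric.ball 0 (Real.exp (-κ * t)) with hWdef
  have hWo : IsOpen W :=
    ((continuousOn_unfold κ).isOpen_inter_preimage isOpen_compl_singleton hU).inter
      Metric.isOpen_ball
  have hW : ∀ ξ ∈ W, ξ ≠ 0 ∧ ‖ξ‖ < Real.exp (-κ * t) ∧ unfold κ ξ ∈ U := fun ξ hξ =>
    ⟨hξ.1.1, mem_ball_zero_iff.1 hξ.2, hξ.1.2⟩
  refine iInf₂_le_of_le W hWo (iInf₂_le_of_le ?_ inter_subset_right ?_)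
  · rintro _ (⟨x, hx, rfl⟩ | ⟨x, hx, rfl⟩)
    · refine ⟨⟨T_ne_zero κ x, ?_⟩, mem_ball_zero_iff.2 (norm_T_lt hκ (hE hx))⟩
      rw [mem_preimage, unfold_T hκ (hE hx).1]
      exact hEU hx
    · refine ⟨⟨reflect_T_ne_zero κ x, ?_⟩, mem_ball_zero_iff.2 ?_⟩
      · rw [mem_preimage, unfold_reflect, unfold_T hκ (hE hx).1]
        exact hEU hx
      · rw [norm_reflect]; exact norm_T_lt hκ (hE hx)
  · exact iSup₂_le fun K hK => iSup_le fun hKW =>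
      (wcapCompact_le_lintegral hp hκ ht hvg hU hv hWo hW hK hKW).trans (by gcongr)

end CylCap

end


/-! ### The two-sided estimate. -/

theorem lemma7p4 (m : ℕ) (hm : 1 ≤ m) (p κ : ℝ) (hp : 1 < p) (hκ : 0 < κ) :
    ∃ C₁ C₂ : ℝ, 0 < C₁ ∧ 0 < C₂ ∧
      ∀ t : ℝ, 0 ≤ t → ∀ E : Set (CylCap.Rn m), MeasurableSet E → E ⊆ CylCap.cylAbove m t →
        ENNReal.ofReal C₁ * CylCap.capCyl p κ t E ≤
            CylCap.wcap p (CylCap.weight p) (CylCap.sym κ E) (Metric.ball 0 (Real.exp (-κ * t))) ∧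
          CylCap.wcap p (CylCap.weight p) (CylCap.sym κ E) (Metric.ball 0 (Real.exp (-κ * t))) ≤
            ENNReal.ofReal C₂ * CylCap.capCyl p κ t E := by
  have hc := CylCap.pullConst_pos m p hκ
  have hfin : CylCap.smoothConst' m p κ ≠ ⊤ := by
    unfold CylCap.smoothConst' CylCap.smoothConst
    finiteness
  -- Neither constant involves t or E; the added 1 makes positivity immediate.
  refine ⟨(CylCap.pullConst m p κ)⁻¹, (CylCap.smoothConst' m p κ).toReal + 1, inv_pos.2 hc,
    by positivity, fun t ht E _ hE => ⟨?_, ?_⟩⟩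
  · refine le_iInf₂ fun U hU => le_iInf₂ fun hEU _ => ?_
    calc _ ≤ ENNReal.ofReal (CylCap.pullConst m p κ)⁻¹ *
          (ENNReal.ofReal (CylCap.pullConst m p κ) * CylCap.wcapOpen p (CylCap.weight p) U
            (Metric.ball 0 (Real.exp (-κ * t)))) := by
          gcongr; exact CylCap.capCyl_le_wcapOpen hp hκ ht hU hEU
      _ = _ := by
          rw [← mul_assoc, ← ENNReal.ofReal_mul (by positivity), inv_mul_cancel₀ hc.ne',
            ENNReal.ofReal_one, one_mul]
  · refine CylCap.wcap_le_capCyl hp hκ ht hE (by positivity) ?_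
    rw [ENNReal.ofReal_add ENNReal.toReal_nonneg zero_le_one, ENNReal.ofReal_toReal hfin]
    exact le_self_add
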